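/- Let $\mathcal F$ be a minor-closed family of finite simple graphs that is not the family of all finite graphs, and let $k\ge 3$ be a fixed integer. Then there is a deterministic algorithm which, given a graph $G\in\mathcal F$ on $n$ vertices by its adjacency lists, finds an induced cycle of size $k$ in $G$, or reports that there is none if $G$ contains no induced cycle of size $k$, in worst-case time $O(n\log n)$ on a unit-cost random access machine with words of $O(\log n)$ bits. The algorithm and the constants hidden in the $O$-notation may depend on $\mathcal F$ and $k$, but not on $G$ or $n$. -/

import Mathlib

namespace InducedCycle

/-! ### Minors and minor-closed families of finite simple graphs -/

/-- `H` is a minor of `G`: there are pairwise disjoint, connected (hence non-empty) branch sets in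
`G`, one for each vertex of `H`, such that adjacent vertices of `H` have branch sets joined by an
edge of `G`. Equivalently, `H` arises from a subgraph of `G` by contracting edges. -/
def IsMinor {W V : Type*} (H : SimpleGraph W) (G : SimpleGraph V) : Prop :=
  ∃ B : W → Set V,
    (∀ a, (G.induce (B a)).Connected) ∧
    (∀ a b, a ≠ b → Disjoint (B a) (B b)) ∧
    (∀ a b, H.Adj a b → ∃ x ∈ B a, ∃ y ∈ B b, G.Adj x y)

/-- A family of finite simple graphs, every finite graph being represented on the vertex sets
`Fin n`. -/
abbrev GraphFamily : Type := ∀ n : ℕ, Set (SimpleGraph (Fin n))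

/-- The family contains all minors (in particular all isomorphic copies) of its members. -/
def GraphFamily.MinorClosed (F : GraphFamily) : Prop :=
  ∀ (n m : ℕ) (G : SimpleGraph (Fin n)) (H : SimpleGraph (Fin m)),
    G ∈ F n → IsMinor H G → H ∈ F m

/-- The family is not the family of all finite graphs. -/
def GraphFamily.NonTrivial (F : GraphFamily) : Prop :=
  ∃ (m : ℕ) (H : SimpleGraph (Fin m)), H ∉ F m

/-! ### A word RAM with structured programs

A program uses registers and zero-based arrays of machine words, named by natural numbers; a fixed
program mentions only finitely many of them. Reading or writing an array entry at a computed index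
(random access), every arithmetic operation and every test takes one unit of time. -/

/-- The contents of the memory: registers and arrays. -/
structure State where
  reg : ℕ → ℕ
  arr : ℕ → ℕ → ℕ

/-- Write `x` to register `r`. -/
def State.setReg (s : State) (r x : ℕ) : State :=
  { s with reg := Function.update s.reg r x }

/-- Write `x` to entry `i` of array `a`. -/
def State.setArr (s : State) (a i x : ℕ) : State :=
  { s with arr := Function.update s.arr a (Function.update (s.arr a) i x) }

/-- The operations on words; `sub` is truncated at zero, tests return `1` or `0`. -/
inductive BinOp where
  | add | sub | mul | div | mod | lt | eq

def BinOp.eval : BinOp → ℕ → ℕ → ℕ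
  | .add, x, y => x + y
  | .sub, x, y => x - y
  | .mul, x, y => x * y
  | .div, x, y => x / y
  | .mod, x, y => x % y
  | .lt, x, y => if x < y then 1 else 0
  | .eq, x, y => if x = y then 1 else 0

/-- Expressions: constants, registers, array entries, operations. -/
inductive Expr where
  | lit (c : ℕ)
  | reg (r : ℕ)
  | get (a : ℕ) (i : Expr)
  | op (o : BinOp) (e₁ e₂ : Expr)

def Expr.eval (s : State) : Expr → ℕ
  | .lit c => c
  | .reg r => s.reg r
  | .get a i => s.arr a (i.eval s)
  | .op o e₁ e₂ => o.eval (e₁.eval s) (e₂.eval s)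

/-- The time to evaluate an expression: one unit for each of its nodes. -/
def Expr.cost : Expr → ℕ
  | .lit _ => 1
  | .reg _ => 1
  | .get _ i => i.cost + 1
  | .op _ e₁ e₂ => e₁.cost + e₂.cost + 1

/-- All values that occur in the evaluation of the expression are words of `w` bits. -/
def Expr.Fits (w : ℕ) (s : State) : Expr → Prop
  | .lit c => c < 2 ^ w
  | .reg r => s.reg r < 2 ^ w
  | .get a i => i.Fits w s ∧ s.arr a (i.eval s) < 2 ^ w
  | .op o e₁ e₂ => e₁.Fits w s ∧ e₂.Fits w s ∧ o.eval (e₁.eval s) (e₂.eval s) < 2 ^ w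

/-- Programs. -/
inductive Program where
  | skip
  | assign (r : ℕ) (e : Expr)
  | store (a : ℕ) (i e : Expr)
  | seq (p q : Program)
  | ite (c : Expr) (p q : Program)
  | loop (c : Expr) (p : Program)

/-- `Exec w p s s' t`: with words of `w` bits, program `p` started in `s` halts in `s'` after
`t` units of time. There is no such run if a value that does not fit in a word is computed.
A condition counts as true if its value is not zero. -/
inductive Exec (w : ℕ) : Program → State → State → ℕ → Prop where
  | skip (s : State) : Exec w .skip s s 1
  | assign (s : State) (r : ℕ) (e : Expr) (he : e.Fits w s) :
      Exec w (.assign r e) s (s.setReg r (e.eval s)) (e.cost + 1)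
  | store (s : State) (a : ℕ) (i e : Expr) (hi : i.Fits w s) (he : e.Fits w s) :
      Exec w (.store a i e) s (s.setArr a (i.eval s) (e.eval s)) (i.cost + e.cost + 1)
  | seq (p q : Program) (s s' s'' : State) (t t' : ℕ)
      (hp : Exec w p s s' t) (hq : Exec w q s' s'' t') :
      Exec w (.seq p q) s s'' (t + t')
  | ite_true (c : Expr) (p q : Program) (s s' : State) (t : ℕ)
      (hc : c.Fits w s) (h : c.eval s ≠ 0) (hp : Exec w p s s' t) :
      Exec w (.ite c p q) s s' (c.cost + 1 + t)
  | ite_false (c : Expr) (p q : Program) (s s' : State) (t : ℕ)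
      (hc : c.Fits w s) (h : c.eval s = 0) (hq : Exec w q s s' t) :
      Exec w (.ite c p q) s s' (c.cost + 1 + t)
  | loop_true (c : Expr) (p : Program) (s s' s'' : State) (t t' : ℕ)
      (hc : c.Fits w s) (h : c.eval s ≠ 0)
      (hp : Exec w p s s' t) (hl : Exec w (.loop c p) s' s'' t') :
      Exec w (.loop c p) s s'' (c.cost + 1 + t + t')
  | loop_false (c : Expr) (p : Program) (s : State)
      (hc : c.Fits w s) (h : c.eval s = 0) :
      Exec w (.loop c p) s s (c.cost + 1)

/-! ### Input and output -/

/-- `adj v` lists the neighbours of `v`, in any order and without repetition. -/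
def IsAdjacencyLists {n : ℕ} (G : SimpleGraph (Fin n)) (adj : Fin n → List (Fin n)) : Prop :=
  ∀ v, (adj v).Nodup ∧ ∀ u, u ∈ adj v ↔ G.Adj v u

/-- The initial memory for given adjacency lists on the vertices `0, …, n - 1`. Register `0` holds
`n`; array `1` holds the lists one after the other; array `0` holds at the indices `0, …, n` the
total length of the lists of the vertices before `v`, so that the list of `v` occupies the
positions from entry `v` up to, and not including, entry `v + 1` of array `0`. Everything else
is `0`. -/
def inputState {n : ℕ} (adj : Fin n → List (Fin n)) : State where
  reg := fun r => if r = 0 then n else 0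
  arr := fun a i =>
    if a = 0 then (if i ≤ n then (((List.ofFn adj).take i).flatten).length else 0)
    else if a = 1 then (((List.ofFn adj).flatten).map Fin.val).getD i 0
    else 0

/-- The final memory holds a correct answer: either register `0` holds `1` and the first `k`
entries of array `0` are, in cyclic order, the vertices of an induced cycle of `G` of size `k`, or
register `0` holds `0` and `G` has no induced cycle of size `k`. -/
def CorrectOutput {n : ℕ} (k : ℕ) (G : SimpleGraph (Fin n)) (s : State) : Prop :=
  (s.reg 0 = 1 ∧
    ∃ φ : SimpleGraph.cycleGraph k ↪g G, ∀ i : Fin k, s.arr 0 i = (φ i : ℕ)) ∨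
  (s.reg 0 = 0 ∧ ¬ (SimpleGraph.cycleGraph k).IsIndContained G)

end InducedCycle

/-! The family omits some graph `H` on `m` vertices, so no member has a model of the complete graph
on `m` vertices. By Mader's contraction argument (`KModel.of_dense`) every minor of a member then
has average degree below `2 ^ m`.

Cycles are found by growing induced paths. A family of paths with `L` vertices is a partial function
from first vertices to paths. An edge `xy` prolongs the path of `y` to a candidate with ends `x` and
`z`. There may be many candidates, but the pairs of ends form a sparse graph (`PathFam.sparse`).
Indeed, for a fixed colouring of the vertices the well-coloured paths with different last vertices
are disjoint (`Owned`), so contracting them gives a minor of the input whose edges are the pairs.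
Averaging over all colourings costs only the factor `k ^ k`.

A sparse graph is oriented with at most `D` arcs per vertex and side by rounds that each settle half
of the remaining edges (`run_peelP`). This is where the factor `log n` comes from. Arc number `j`
out of each `x` is again a partial function from first vertices to paths (`PathFam.prolong`); arc
number `j` out of each `z` is one after reversal (`PathFam.prolong_reverse`). So one family of paths
with `L` vertices gives at most `2 * D` families with `L + 1` vertices per group of candidates, and
the recursion has bounded width and depth.

Only one path, the leader, is kept for each pair of ends, and it may touch the rest of the cycle
that is sought. An orientation of the input graph gives every vertex `T` out-neighbours. With it, a
conflict becomes a common element of a set read off the path and a set `restSet` of at most `k * (T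
+ 1)` elements read off the rest of the cycle (`disjoint_restSet_iff`). If the leader hits the
latter, the true path avoids the element that is hit. Branching over the elements of the leader, and
keeping only candidates that avoid the chosen one, removes one element from the unknown set. Hence
`k * (T + 1)` levels of branching suffice (`nodeP_spec`).

The number of nodes of the search depends on `k`, `T` and `D` only, and each node costs `O(n log n)`
time. -/

namespace InducedCycle

/-! ### Graph theory: excluded clique models make the graphs of path ends sparse. -/

/-! ### Connected sets and clique models for a relation -/

/-- `S` is non-empty and connected with respect to `R`. -/
def Conn {α : Type*} (R : α → α → Prop) (S : Set α) : Prop :=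
  S.Nonempty ∧ ∀ u ∈ S, ∀ v ∈ S, Relation.ReflTransGen (fun a b => R a b ∧ a ∈ S ∧ b ∈ S) u v

/-- A model of the complete graph on `m` vertices inside `U`. -/
def KModel {α : Type*} (R : α → α → Prop) (m : ℕ) (U : Set α) : Prop :=
  ∃ B : Fin m → Set α, (∀ a, B a ⊆ U) ∧ (∀ a, Conn R (B a)) ∧
    (∀ a b, a ≠ b → Disjoint (B a) (B b)) ∧
    ∀ a b, a ≠ b → ∃ x ∈ B a, ∃ y ∈ B b, R x y

section
variable {α β : Type*} {R : α → α → Prop} {S : β → β → Prop}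

theorem Conn.singleton (x : α) : Conn R {x} := by
  refine ⟨⟨x, rfl⟩, ?_⟩
  rintro u rfl v rfl
  exact .refl

theorem Conn.insert (hR : ∀ x y, R x y → R y x) {W : Set α} (hW : Conn R W) {x w : α} (hw : w ∈ W)
    (hx : R w x) : Conn R (insert x W) := by
  have mono : ∀ u v, Relation.ReflTransGen (fun a b => R a b ∧ a ∈ W ∧ b ∈ W) u v →
      Relation.ReflTransGen (fun a b => R a b ∧ a ∈ Insert.insert x W ∧ b ∈ Insert.insert x W)
        u v := fun u v h =>
    Relation.ReflTransGen.mono (fun a b h => ⟨h.1, Or.inr h.2.1, Or.inr h.2.2⟩) _ _ h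
  refine ⟨⟨x, Or.inl rfl⟩, ?_⟩
  rintro u (rfl | hu) v (rfl | hv)
  · exact .refl
  · exact .head ⟨hR _ _ hx, Or.inl rfl, Or.inr hw⟩ (mono _ _ (hW.2 _ hw _ hv))
  · exact .tail (mono _ _ (hW.2 _ hu _ hw)) ⟨hx, Or.inr hw, Or.inl rfl⟩
  · exact mono _ _ (hW.2 _ hu _ hv)

theorem Conn.biUnion {T : Set α} (hT : Conn R T) {φ : α → Set β}
    (hφ : ∀ x ∈ T, Conn S (φ x))
    (hadj : ∀ x ∈ T, ∀ y ∈ T, R x y → ∃ a ∈ φ x, ∃ b ∈ φ y, S a b) :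
    Conn S (⋃ x ∈ T, φ x) := by
  obtain ⟨⟨x₀, hx₀⟩, hconn⟩ := hT
  have inner : ∀ x ∈ T, ∀ a ∈ φ x, ∀ b ∈ φ x, Relation.ReflTransGen
      (fun a b => S a b ∧ a ∈ (⋃ x ∈ T, φ x) ∧ b ∈ (⋃ x ∈ T, φ x)) a b := fun x hx a ha b hb =>
    Relation.ReflTransGen.mono (fun c d h =>
      ⟨h.1, Set.mem_biUnion hx h.2.1, Set.mem_biUnion hx h.2.2⟩) _ _
      ((hφ x hx).2 a ha b hb)
  refine ⟨?_, ?_⟩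
  · obtain ⟨a, ha⟩ := (hφ x₀ hx₀).1
    exact ⟨a, Set.mem_biUnion hx₀ ha⟩
  · intro u hu v hv
    simp only [Set.mem_iUnion] at hu hv
    obtain ⟨x, hx, hu⟩ := hu
    obtain ⟨y, hy, hv⟩ := hv
    have key : ∀ z, Relation.ReflTransGen (fun a b => R a b ∧ a ∈ T ∧ b ∈ T) x z → z ∈ T →
        ∀ c ∈ φ z, Relation.ReflTransGen
          (fun a b => S a b ∧ a ∈ (⋃ x ∈ T, φ x) ∧ b ∈ (⋃ x ∈ T, φ x)) u c := by
      intro z hz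
      induction hz with
      | refl => intro _ c hc; exact inner x hx u hu c hc
      | tail h1 h2 ih =>
        intro hzT c hc
        obtain ⟨a, ha, b, hb, hab⟩ := hadj _ h2.2.1 _ hzT h2.1
        exact ((ih h2.2.1 a ha).tail
          ⟨hab, Set.mem_biUnion h2.2.1 ha, Set.mem_biUnion hzT hb⟩).trans (inner _ hzT b hb c hc)
    exact key y (hconn x hx y hy) hy v hv

/-- Models can be pulled through a family of disjoint branch sets. -/
theorem KModel.expand {m : ℕ} {U : Set α} {V : Set β} (h : KModel R m U) (φ : α → Set β)
    (hV : ∀ x ∈ U, φ x ⊆ V) (hφ : ∀ x ∈ U, Conn S (φ x))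
    (hdis : ∀ x ∈ U, ∀ y ∈ U, x ≠ y → Disjoint (φ x) (φ y))
    (hadj : ∀ x ∈ U, ∀ y ∈ U, R x y → ∃ a ∈ φ x, ∃ b ∈ φ y, S a b) : KModel S m V := by
  obtain ⟨B, hU, hc, hd, ha⟩ := h
  refine ⟨fun a => ⋃ x ∈ B a, φ x, ?_, ?_, ?_, ?_⟩
  · exact fun a => Set.iUnion₂_subset fun x hx => hV x (hU a hx)
  · exact fun a => (hc a).biUnion (fun x hx => hφ x (hU a hx))
      fun x hx y hy => hadj x (hU a hx) y (hU a hy)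
  · intro a b hab
    simp only [Set.disjoint_iUnion_left, Set.disjoint_iUnion_right]
    intro x hx y hy
    refine hdis _ (hU _ ‹_›) _ (hU _ ‹_›) ?_
    rintro rfl
    exact Set.disjoint_left.1 (hd a b hab) ‹_› ‹_›
  · intro a b hab
    obtain ⟨x, hx, y, hy, hxy⟩ := ha a b hab
    obtain ⟨c, hc', d, hd', hcd⟩ := hadj x (hU a hx) y (hU b hy) hxy
    exact ⟨c, Set.mem_biUnion hx hc', d, Set.mem_biUnion hy hd', hcd⟩

end

/-! ### Dense graphs contain large clique models -/

section
open Classical in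
/-- Number of neighbours of `x` inside `U`. -/
noncomputable def degIn {α : Type*} (R : α → α → Prop) (U : Finset α) (x : α) : ℕ :=
  (U.filter (R x)).card

/-- Twice the number of edges inside `U`. -/
noncomputable def edgesIn {α : Type*} (R : α → α → Prop) (U : Finset α) : ℕ :=
  ∑ x ∈ U, degIn R U x

variable {α : Type*} {R : α → α → Prop}

-- Each edge is counted from both of its ends, so deleting `x` loses the degree of `x` once at `x`
-- itself and once more, spread over its neighbours.
open Classical in
theorem edgesIn_erase (hR : ∀ x y, R x y → R y x) (hi : ∀ x, ¬ R x x) (U : Finset α) {x : α} (hx : x ∈ U) :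
    edgesIn R U = edgesIn R (U.erase x) + 2 * degIn R U x := by
  have h1 : ∀ y ∈ U.erase x, degIn R U y = degIn R (U.erase x) y + if R x y then 1 else 0 := by
    intro y hy
    unfold degIn
    by_cases h : R x y
    · have : U.filter (R y) = insert x ((U.erase x).filter (R y)) := by
        ext z
        simp only [Finset.mem_filter, Finset.mem_insert, Finset.mem_erase]
        constructor
        · rintro ⟨a, b⟩
          by_cases hz : z = x <;> simp [*]
        · rintro (rfl | ⟨⟨_, a⟩, b⟩)
          · exact ⟨hx, hR _ _ h⟩
          · exact ⟨a, b⟩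
      rw [this, Finset.card_insert_of_notMem (by simp), if_pos h]
    · rw [if_neg h, add_zero]
      congr 1
      ext z
      simp only [Finset.mem_filter, Finset.mem_erase]
      constructor
      · rintro ⟨a, b⟩
        exact ⟨⟨by rintro rfl; exact h (hR _ _ b), a⟩, b⟩
      · rintro ⟨⟨_, a⟩, b⟩
        exact ⟨a, b⟩
  have h2 : ∑ y ∈ U.erase x, (if R x y then 1 else 0) = degIn R U x := by
    rw [← Finset.card_filter]
    unfold degIn
    congr 1
    ext z
    simp only [Finset.mem_filter, Finset.mem_erase]
    constructor
    · rintro ⟨⟨_, a⟩, b⟩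
      exact ⟨a, b⟩
    · rintro ⟨a, b⟩
      exact ⟨⟨by rintro rfl; exact hi _ b, a⟩, b⟩
  unfold edgesIn
  rw [← Finset.add_sum_erase _ _ hx, Finset.sum_congr rfl h1, Finset.sum_add_distrib, h2]
  ring

-- Contract a connected set `W` that is maximal among those whose contraction keeps the density.
-- Maximality forces large degrees inside the neighbourhood of `W`. This neighbourhood contains a
-- model with one branch set less, and `W` is adjacent to all of it.
open Classical in
theorem KModel.of_dense (hR : ∀ x y, R x y → R y x) (hi : ∀ x, ¬ R x x) (m : ℕ) :
    ∀ U : Finset α, U.Nonempty → 2 ^ m * U.card ≤ edgesIn R U → KModel R m (U : Set α) := by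
  induction m with
  | zero => exact fun U _ _ => ⟨fun a => a.elim0, fun a => a.elim0, fun a => a.elim0,
      fun a => a.elim0, fun a => a.elim0⟩
  | succ m ih =>
    intro U
    induction hN : U.card using Nat.strong_induction_on generalizing U with
    | _ N ihN =>
    subst hN
    intro hU hd
    let nb : Finset α → Finset α := fun W => (U \ W).filter fun y => ∃ w ∈ W, R w y
    -- The density bound for the graph with `W` contracted to one vertex: that vertex adds `1` to
    -- the order and `(nb W).card` edges, counted twice as in `edgesIn`.
    let good : Finset α → Prop := fun W => Conn R (W : Set α) ∧
      2 ^ (m + 1) * ((U \ W).card + 1) ≤ edgesIn R (U \ W) + 2 * (nb W).card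
    obtain ⟨u, hu⟩ := hU
    have hne : (U.powerset.filter good).Nonempty := by
      refine ⟨{u}, ?_⟩
      simp only [Finset.mem_filter, Finset.mem_powerset, Finset.singleton_subset_iff, hu, true_and]
      refine ⟨by simpa using Conn.singleton u, ?_⟩
      have e1 : U \ {u} = U.erase u := by ext; simp [and_comm]
      have e2 : nb {u} = U.filter (R u) := by
        ext y
        simp only [nb, Finset.mem_filter, Finset.mem_sdiff, Finset.mem_singleton, exists_eq_left]
        constructor
        · rintro ⟨⟨a, _⟩, b⟩; exact ⟨a, b⟩
        · rintro ⟨a, b⟩; exact ⟨⟨a, by rintro rfl; exact hi _ b⟩, b⟩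
      rw [e2, e1, Finset.card_erase_add_one hu]
      have := edgesIn_erase hR hi U hu
      unfold degIn at this
      omega
    obtain ⟨W, hW⟩ := Finset.exists_maximal hne
    have hWm := hW.1
    simp only [Finset.mem_filter, Finset.mem_powerset] at hWm
    obtain ⟨hWU, hWc, hWd⟩ := hWm
    -- Without neighbours of `W`, the contracted vertex is isolated and all the density sits in the
    -- smaller set `U \ W`.
    rcases (nb W).eq_empty_or_nonempty with hn | hn
    · rw [hn, Finset.card_empty] at hWd
      have hlt : (U \ W).card < U.card := by
        obtain ⟨w, hw⟩ := hWc.1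
        exact Finset.card_lt_card ⟨Finset.sdiff_subset, fun h =>
          (Finset.mem_sdiff.1 (h (hWU hw))).2 hw⟩
      have hpos : 0 < 2 ^ (m + 1) := by positivity
      have hne' : (U \ W).Nonempty := by
        rw [Finset.nonempty_iff_ne_empty]
        intro h
        rw [h] at hWd
        simp [edgesIn] at hWd
      obtain ⟨B, h1, h2⟩ := ihN _ hlt (U \ W) rfl hne' (by
        rw [mul_add] at hWd; omega)
      exact ⟨B, fun a => (h1 a).trans (by simp), h2⟩
    -- Moving `x` into `W` loses one vertex and `degIn R (nb W) x + 1` edges: the edges from `x` to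
    -- other neighbours of `W` become parallel, and the edge from `W` to `x` disappears. If the
    -- degree were below `2 ^ m`, the density would survive, against maximality.
    · have hdeg : ∀ x ∈ nb W, 2 ^ m ≤ degIn R (nb W) x := by
        intro x hx
        have hx' := hx
        simp only [nb, Finset.mem_filter, Finset.mem_sdiff] at hx'
        obtain ⟨⟨hxU, hxW⟩, w, hw, hwx⟩ := hx'
        by_contra hlt
        have hnot : ¬ good (insert x W) := by
          intro hg
          have := hW.2 (y := insert x W) (by
            simp only [Finset.mem_filter, Finset.mem_powerset]
            exact ⟨Finset.insert_subset hxU hWU, hg⟩) (Finset.subset_insert _ _)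
          exact hxW (this (Finset.mem_insert_self _ _))
        apply hnot
        refine ⟨by rw [Finset.coe_insert]; exact hWc.insert hR hw hwx, ?_⟩
        have hxY : x ∈ U \ W := by simp [hxU, hxW]
        have e1 : U \ insert x W = (U \ W).erase x := by
          ext y; simp only [Finset.mem_sdiff, Finset.mem_insert, Finset.mem_erase]; tauto
        have e2 : (U \ W).filter (R x) =
            (nb W).filter (R x) ∪ ((U \ W).filter (R x) \ nb W) := by
          ext y
          by_cases hy : y ∈ nb W
          · have : y ∈ U \ W := (Finset.mem_filter.1 hy).1
            simp [hy, this]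
          · simp [hy]
        have e3 : nb (insert x W) = (nb W).erase x ∪ ((U \ W).filter (R x) \ nb W) := by
          ext y
          simp only [nb, Finset.mem_filter, Finset.mem_union, Finset.mem_sdiff, Finset.mem_erase,
            Finset.mem_insert, exists_eq_or_imp]
          constructor
          · rintro ⟨⟨a, b⟩, c⟩
            push Not at b
            by_cases hy : ∃ w ∈ W, R w y
            · exact Or.inl ⟨b.1, ⟨a, b.2⟩, hy⟩
            · refine Or.inr ⟨⟨⟨a, b.2⟩, c.resolve_right hy⟩, fun h => hy h.2⟩
          · rintro (⟨a, ⟨b, c⟩, d⟩ | ⟨⟨⟨a, b⟩, c⟩, d⟩)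
            · exact ⟨⟨b, by push Not; exact ⟨a, c⟩⟩, Or.inr d⟩
            · refine ⟨⟨a, ?_⟩, Or.inl c⟩
              push Not
              exact ⟨by rintro rfl; exact hi _ c, b⟩
        have c2 := congrArg Finset.card e2
        rw [Finset.card_union_of_disjoint (by
          rw [Finset.disjoint_left]; intro y hy hy'
          exact (Finset.mem_sdiff.1 hy').2 (Finset.mem_filter.1 hy).1)] at c2
        have c3 := congrArg Finset.card e3
        rw [Finset.card_union_of_disjoint (by
          rw [Finset.disjoint_left]; intro y hy hy'
          exact (Finset.mem_sdiff.1 hy').2 (Finset.mem_erase.1 hy).2),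
          Finset.card_erase_of_mem hx] at c3
        have c4 := edgesIn_erase hR hi (U \ W) hxY
        have c5 : 0 < (nb W).card := Finset.card_pos.2 hn
        rw [c3, e1, Finset.card_erase_add_one hxY]
        unfold degIn at c4 hlt
        rw [mul_add, pow_succ] at hWd
        rw [pow_succ]
        omega
      obtain ⟨B, hB1, hB2, hB3, hB4⟩ := ih (nb W) hn (by
        unfold edgesIn
        rw [mul_comm, ← smul_eq_mul, ← Finset.sum_const]
        exact Finset.sum_le_sum hdeg)
      have hnbU : ((nb W : Finset α) : Set α) ⊆ U := by
        intro y hy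
        simp only [nb, Finset.coe_filter, Set.mem_ofPred_eq, Finset.mem_sdiff] at hy
        exact hy.1.1
      have hdisj : ∀ a, Disjoint (W : Set α) (B a) := by
        intro a
        rw [Set.disjoint_left]
        intro y hy hy'
        have := hB1 a hy'
        simp only [nb, Finset.coe_filter, Set.mem_ofPred_eq, Finset.mem_sdiff] at this
        exact this.1.2 hy
      have hWB : ∀ a, ∃ x ∈ (W : Set α), ∃ y ∈ B a, R x y := by
        intro a
        obtain ⟨y, hy⟩ := (hB2 a).1
        have := hB1 a hy
        simp only [nb, Finset.coe_filter, Set.mem_ofPred_eq, Finset.mem_sdiff] at this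
        obtain ⟨w, hw, hwy⟩ := this.2
        exact ⟨w, hw, y, hy, hwy⟩
      -- All the branch sets from the induction consist of neighbours of `W`, so `W` serves as the
      -- additional one.
      refine ⟨Fin.cons (W : Set α) B, ?_, ?_, ?_, ?_⟩
      · refine Fin.cases ?_ ?_
        · simpa using hWU
        · intro a; simpa using (hB1 a).trans hnbU
      · refine Fin.cases ?_ ?_
        · simpa using hWc
        · intro a; simpa using hB2 a
      · refine Fin.cases ?_ ?_
        · refine Fin.cases (by simp) ?_
          intro b _; simpa using hdisj b
        · intro a
          refine Fin.cases ?_ ?_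
          · intro _; simpa using (hdisj a).symm
          · intro b hab; simpa using hB3 a b (fun h => hab (by rw [h]))
      · refine Fin.cases ?_ ?_
        · refine Fin.cases (by simp) ?_
          intro b _; simpa using hWB b
        · intro a
          refine Fin.cases ?_ ?_
          · intro _
            obtain ⟨x, hx, y, hy, hxy⟩ := hWB a
            simpa using ⟨y, hy, x, hx, hR _ _ hxy⟩
          · intro b hab; simpa using hB4 a b (fun h => hab (by rw [h]))

end

/-! ### Graphs on `Fin n` viewed on the natural numbers -/

/-- The adjacency relation of `G` on natural numbers. -/
def natAdj {n : ℕ} (G : SimpleGraph (Fin n)) (u v : ℕ) : Prop :=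
  ∃ (hu : u < n) (hv : v < n), G.Adj ⟨u, hu⟩ ⟨v, hv⟩

theorem natAdj_symm {n : ℕ} (G : SimpleGraph (Fin n)) : ∀ u v, natAdj G u v → natAdj G v u :=
  fun _ _ ⟨hu, hv, h⟩ => ⟨hv, hu, h.symm⟩

theorem natAdj_irrefl {n : ℕ} (G : SimpleGraph (Fin n)) (u : ℕ) : ¬ natAdj G u u :=
  fun ⟨_, _, h⟩ => G.loopless.irrefl _ h

/-- The branch sets of a clique are pairwise joined, so they serve for every graph with the same
number of vertices. A minor-closed family that misses one graph on `m` vertices therefore has no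
member with such a model. -/
theorem KModel.isMinor {n m : ℕ} {G : SimpleGraph (Fin n)} (h : KModel (natAdj G) m {v | v < n})
    (H : SimpleGraph (Fin m)) : IsMinor H G := by
  obtain ⟨B, hU, hc, hd, ha⟩ := h
  refine ⟨fun a => Fin.val ⁻¹' B a, ?_, ?_, ?_⟩
  · intro a
    have hne : Nonempty (Fin.val ⁻¹' B a : Set (Fin n)) := by
      obtain ⟨x, hx⟩ := (hc a).1
      exact ⟨⟨⟨x, hU a hx⟩, hx⟩⟩
    refine { preconnected := ?_, nonempty := hne }
    rintro ⟨u, hu⟩ ⟨v, hv⟩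
    have key : ∀ z, Relation.ReflTransGen (fun x y => natAdj G x y ∧ x ∈ B a ∧ y ∈ B a) u z →
        ∀ (hz : z < n) (hz' : z ∈ B a),
          (G.induce (Fin.val ⁻¹' B a)).Reachable ⟨u, hu⟩ ⟨⟨z, hz⟩, hz'⟩ := by
      intro z hz
      induction hz with
      | refl => intro _ _; exact SimpleGraph.Reachable.refl _
      | tail h1 h2 ih =>
        intro hz hz'
        obtain ⟨⟨h3, h4, h5⟩, h6, h7⟩ := h2
        refine (ih h3 h6).trans (SimpleGraph.Adj.reachable ?_)
        exact h5
    exact key v ((hc a).2 u hu v hv) v.2 hv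
  · intro a b hab
    exact (hd a b hab).preimage _
  · intro a b hab
    obtain ⟨x, hx, y, hy, hu, hv, h⟩ := ha a b hab.ne
    exact ⟨⟨x, hu⟩, hx, ⟨y, hv⟩, hy, h⟩

/-! ### Families of paths with owners -/

/-- For every colouring `χ` of the vertices there is an assignment of owners such that all the
vertices of a path of the family that is coloured by `ls` are owned by the last vertex of the
path. -/
def Owned (L : ℕ) (df : ℕ → Prop) (pt : ℕ → ℕ → ℕ) (ls : ℕ → ℕ) : Prop :=
  ∀ χ : ℕ → ℕ, ∃ O : ℕ → ℕ, ∀ v, df v → (∀ i < L, χ (pt v i) = ls i) →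
    ∀ i < L, O (pt v i) = pt v (L - 1)

/-- A partial function `v ↦ pt v` to paths of `L` vertices below `n` that start in `v`, with
owners. -/
structure PathFam (adj : ℕ → ℕ → Prop) (n L : ℕ) (df : ℕ → Prop) (pt : ℕ → ℕ → ℕ) : Prop where
  pos : 0 < L
  lt : ∀ v, df v → ∀ i < L, pt v i < n
  head : ∀ v, df v → pt v 0 = v
  chain : ∀ v, df v → ∀ i, i + 1 < L → adj (pt v i) (pt v (i + 1))
  owned : ∃ ls : ℕ → ℕ, (∀ i < L, ls i < L) ∧ Owned L df pt ls

/-- `x` followed by `p`. -/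
def consPath (x : ℕ) (p : ℕ → ℕ) (i : ℕ) : ℕ := if i = 0 then x else p (i - 1)

/-- The first `L` entries of `p` in reverse order. -/
def revPath (L : ℕ) (p : ℕ → ℕ) (i : ℕ) : ℕ := p (L - 1 - i)

@[simp] theorem consPath_zero (x : ℕ) (p : ℕ → ℕ) : consPath x p 0 = x := rfl

@[simp] theorem consPath_succ (x : ℕ) (p : ℕ → ℕ) (i : ℕ) : consPath x p (i + 1) = p i := rfl

/-- Single vertices, each its own owner. This is where the search starts, and it also yields the
sparsity of the input graph itself. -/
theorem PathFam.trivial (adj : ℕ → ℕ → Prop) (n : ℕ) {pt : ℕ → ℕ → ℕ} {df : ℕ → Prop}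
    (hdf : ∀ v, df v → v < n) (h : ∀ v, df v → pt v 0 = v) : PathFam adj n 1 df pt where
  pos := one_pos
  lt v hv i hi := by
    obtain rfl : i = 0 := by omega
    rw [h v hv]; exact hdf v hv
  head := h
  chain v hv i hi := by omega
  owned := ⟨fun _ => 0, fun _ _ => one_pos, fun χ => ⟨id, fun v hv _ i hi => by
    obtain rfl : i = 0 := by omega
    rfl⟩⟩

section
variable {adj : ℕ → ℕ → Prop} {n L : ℕ} {df df' : ℕ → Prop} {pt pt' : ℕ → ℕ → ℕ}

/-- Prolong paths at their first vertex, as a partial function of the new vertex. -/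
theorem PathFam.prolong (h : PathFam adj n L df pt)
    (h' : ∀ x, df' x → x < n ∧ ∃ y, df y ∧ adj x y ∧ ∀ i < L + 1, pt' x i = consPath x (pt y) i) :
    PathFam adj n (L + 1) df' pt' where
  pos := Nat.succ_pos _
  lt x hx i hi := by
    obtain ⟨hxn, y, hy, hxy, e⟩ := h' x hx
    rw [e i hi]
    cases i with
    | zero => simpa
    | succ i => exact h.lt y hy i (by omega)
  head x hx := by
    obtain ⟨hxn, y, hy, hxy, e⟩ := h' x hx
    rw [e 0 (by omega)]; rfl
  chain x hx i hi := by
    obtain ⟨hxn, y, hy, hxy, e⟩ := h' x hx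
    rw [e i (by omega), e _ hi]
    cases i with
    | zero => simpa [h.head y hy] using hxy
    | succ i => exact h.chain y hy i (by omega)
  owned := by
    obtain ⟨ls, hls, ho⟩ := h.owned
    have hL := h.pos
    -- The new vertex is labelled `L`. The old labels are below `L`, so its colour tells it apart
    -- from all old vertices of well-coloured paths.
    refine ⟨consPath L ls, ?_, ?_⟩
    · intro i hi
      cases i with
      | zero => simp
      | succ i => have := hls i (by omega); simp only [consPath_succ]; omega
    · intro χ
      obtain ⟨O, hO⟩ := ho χ
      -- A vertex of colour `L` can only be the first vertex of its path, and that determines the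
      -- path. The others keep their owner because the last vertex does not change.
      refine ⟨fun w => if χ w = L then pt' w L else O w, ?_⟩
      intro x hx hχ i hi
      obtain ⟨hxn, y, hy, hxy, e⟩ := h' x hx
      have hχy : ∀ i < L, χ (pt y i) = ls i := fun j hj => by
        have := hχ (j + 1) (by omega)
        rwa [e _ (by omega)] at this
      rw [Nat.add_sub_cancel]
      cases i with
      | zero =>
        have h0 := hχ 0 (by omega)
        have : pt' x 0 = x := by rw [e 0 (by omega)]; rfl
        rw [this] at h0 ⊢
        simp only [consPath_zero] at h0
        simp [h0]
      | succ i =>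
        rw [e _ hi, e L (by omega), consPath_succ]
        have h1 := hχy i (by omega)
        have h2 := hls i (by omega)
        simp only [h1, h2.ne, if_false]
        rw [hO y hy hχy i (by omega)]
        simp [consPath, hL.ne']

/-- Prolong paths at their first vertex and reverse them, as a partial function of the old last
vertex. -/
theorem PathFam.prolong_reverse (hs : ∀ u v, adj u v → adj v u) (h : PathFam adj n L df pt)
    (h' : ∀ z, df' z → ∃ x < n, ∃ y, df y ∧ adj x y ∧ z = pt y (L - 1) ∧
      ∀ i < L + 1, pt' z i = revPath (L + 1) (consPath x (pt y)) i) :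
    PathFam adj n (L + 1) df' pt' where
  pos := Nat.succ_pos _
  lt z hz i hi := by
    obtain ⟨x, hxn, y, hy, hxy, hz, e⟩ := h' z hz
    rw [e i hi, revPath]
    rcases Nat.eq_zero_or_pos (L + 1 - 1 - i) with h0 | h0
    · rw [h0]; simpa
    · obtain ⟨j, hj⟩ := Nat.exists_eq_succ_of_ne_zero h0.ne'
      rw [hj]; exact h.lt y hy j (by omega)
  head z hz := by
    obtain ⟨x, hxn, y, hy, hxy, hz, e⟩ := h' z hz
    have := h.pos
    rw [e 0 (by omega), hz, revPath, consPath, if_neg (by omega)]; rfl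
  chain z hz i hi := by
    obtain ⟨x, hxn, y, hy, hxy, hz, e⟩ := h' z hz
    rw [e i (by omega), e _ hi, revPath, revPath]
    obtain ⟨j, hj⟩ : ∃ j, L = i + 1 + j := ⟨L - (i + 1), by omega⟩
    rw [show L + 1 - 1 - i = j + 1 by omega, show L + 1 - 1 - (i + 1) = j by omega]
    refine hs _ _ ?_
    cases j with
    | zero => simpa [h.head y hy] using hxy
    | succ j => exact h.chain y hy j (by omega)
  owned := by
    obtain ⟨ls, hls, ho⟩ := h.owned
    have hL := h.pos
    refine ⟨revPath (L + 1) (consPath L ls), ?_, ?_⟩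
    · intro i hi
      rw [revPath]
      rcases Nat.eq_zero_or_pos (L + 1 - 1 - i) with h0 | h0
      · rw [h0]; simp
      · obtain ⟨j, hj⟩ := Nat.exists_eq_succ_of_ne_zero h0.ne'
        rw [hj]
        have := hls j (by omega)
        show ls j < _
        omega
    · intro χ
      obtain ⟨O, hO⟩ := ho χ
      -- After the reversal the vertex of colour `L` comes last and owns itself. For the others, the
      -- old owner is the old last vertex; it is now the first one and determines the whole path.
      refine ⟨fun w => if χ w = L then w else pt' (O w) L, ?_⟩
      intro z hz hχ i hi
      obtain ⟨x, hxn, y, hy, hxy, hz, e⟩ := h' z hz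
      have hlast : pt' z L = x := by
        rw [e L (by omega), revPath, show L + 1 - 1 - L = 0 by omega]; rfl
      have hχ' : ∀ j < L + 1, χ (consPath x (pt y) j) = consPath L ls j := by
        intro j hj
        have := hχ (L - j) (by omega)
        rw [e _ (by omega), revPath, revPath, show L + 1 - 1 - (L - j) = j by omega] at this
        exact this
      have hχy : ∀ j < L, χ (pt y j) = ls j := fun j hj => hχ' (j + 1) (by omega)
      rw [Nat.add_sub_cancel, hlast, e i hi, revPath]
      rcases Nat.eq_zero_or_pos (L + 1 - 1 - i) with h0 | h0
      · have := hχ' 0 (by omega)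
        simp only [consPath_zero] at this
        rw [h0]
        simp [this]
      · obtain ⟨j, hj⟩ := Nat.exists_eq_succ_of_ne_zero h0.ne'
        rw [hj]
        show (if χ (pt y j) = L then pt y j else pt' (O (pt y j)) L) = x
        have h1 := hχy j (by omega)
        have h2 := hls j (by omega)
        rw [if_neg (by omega), hO y hy hχy j (by omega), ← hz, hlast]

/-! ### The pairs of ends of prolonged paths form a sparse graph -/

/-- A chain of adjacent vertices is connected. -/
theorem Conn.of_chains (hs : ∀ u v, adj u v → adj v u) {Y : Set ℕ} (hY : Y.Nonempty) {z : ℕ}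
    (hL : 0 < L)
    (hch : ∀ y ∈ Y, ∀ i, i + 1 < L → adj (pt y i) (pt y (i + 1)))
    (hz : ∀ y ∈ Y, pt y (L - 1) = z) :
    Conn adj {w | ∃ y ∈ Y, ∃ i < L, w = pt y i} := by
  set T : Set ℕ := {w | ∃ y ∈ Y, ∃ i < L, w = pt y i} with hT
  have hmem : ∀ y ∈ Y, ∀ i < L, pt y i ∈ T := fun y hy i hi => ⟨y, hy, i, hi, rfl⟩
  have to_z : ∀ y ∈ Y, ∀ j i, i + j + 1 = L →
      Relation.ReflTransGen (fun a b => adj a b ∧ a ∈ T ∧ b ∈ T) (pt y i) z ∧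
      Relation.ReflTransGen (fun a b => adj a b ∧ a ∈ T ∧ b ∈ T) z (pt y i) := by
    intro y hy j
    induction j with
    | zero =>
      intro i hi
      rw [← hz y hy, show L - 1 = i by omega]
      exact ⟨.refl, .refl⟩
    | succ j ih =>
      intro i hi
      obtain ⟨h1, h2⟩ := ih (i + 1) (by omega)
      have h3 := hch y hy i (by omega)
      have h4 := hmem y hy i (by omega)
      have h5 := hmem y hy (i + 1) (by omega)
      exact ⟨.head ⟨h3, h4, h5⟩ h1, .tail h2 ⟨hs _ _ h3, h5, h4⟩⟩
  obtain ⟨y₀, hy₀⟩ := hY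
  refine ⟨⟨_, hmem y₀ hy₀ 0 hL⟩, ?_⟩
  rintro u ⟨y, hy, i, hi, rfl⟩ v ⟨y', hy', i', hi', rfl⟩
  exact (to_z y hy (L - 1 - i) i (by omega)).1.trans (to_z y' hy' (L - 1 - i') i' (by omega)).2

open Classical in
/-- The number of well-coloured pairs. -/
theorem card_coloured_le (hs : ∀ u v, adj u v → adj v u)
    {m : ℕ} (hm : ¬ KModel adj m {v | v < n}) (h : PathFam adj n L df pt)
    {ls : ℕ → ℕ} (hls : ∀ i < L, ls i < L) (ho : Owned L df pt ls) (χ : ℕ → ℕ)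
    (S : Finset ℕ) (X Y : ℕ → ℕ)
    (hS : ∀ e ∈ S, X e < n ∧ df (Y e) ∧ adj (X e) (Y e))
    (hχ : ∀ e ∈ S, ∀ i < L + 1, χ (consPath (X e) (pt (Y e)) i) = consPath L ls i)
    (hinj : ∀ e ∈ S, ∀ e' ∈ S, X e = X e' → pt (Y e) (L - 1) = pt (Y e') (L - 1) → e = e') :
    S.card ≤ 2 ^ m * ((S.image X).card + (S.image fun e => pt (Y e) (L - 1)).card) := by
  rcases S.eq_empty_or_nonempty with rfl | hne
  · simp
  have hL := h.pos
  obtain ⟨O, hO⟩ := ho χ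
  set Z : ℕ → ℕ := fun e => pt (Y e) (L - 1) with hZ
  -- A disjoint sum, because the same vertex may occur both as a new first vertex and as a last
  -- vertex.
  let R : ℕ ⊕ ℕ → ℕ ⊕ ℕ → Prop := fun a b =>
    ∃ e ∈ S, (a = .inl (X e) ∧ b = .inr (Z e)) ∨ (b = .inl (X e) ∧ a = .inr (Z e))
  have hR : ∀ a b, R a b → R b a := fun a b ⟨e, he, h⟩ => ⟨e, he, h.symm⟩
  have hRi : ∀ a, ¬ R a a := by
    rintro a ⟨e, he, (⟨h1, h2⟩ | ⟨h1, h2⟩)⟩ <;> rw [h1] at h2 <;> cases h2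
  let U : Finset (ℕ ⊕ ℕ) := (S.image X).disjSum (S.image Z)
  have hχy : ∀ e ∈ S, ∀ i < L, χ (pt (Y e) i) = ls i := fun e he i hi =>
    hχ e he (i + 1) (by omega)
  have hχx : ∀ e ∈ S, χ (X e) = L := fun e he => hχ e he 0 (by omega)
  -- Counting at the left ends alone is enough; `hinj` makes an element of `S` with given left end
  -- recoverable from its right end.
  have hedges : S.card ≤ edgesIn R U := by
    have : S.card ≤ ∑ x ∈ S.image X, degIn R U (.inl x) := by
      rw [Finset.card_eq_sum_card_image X S]
      refine Finset.sum_le_sum fun x hx => ?_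
      unfold degIn
      refine Finset.card_le_card_of_injOn (fun e => .inr (Z e)) ?_ ?_
      · intro e he
        simp only [Finset.coe_filter, Set.mem_ofPred_eq] at he ⊢
        refine ⟨?_, e, he.1, Or.inl ⟨by rw [he.2], rfl⟩⟩
        simp only [U, Finset.mem_disjSum]
        exact Or.inr ⟨Z e, Finset.mem_image_of_mem _ he.1, rfl⟩
      · intro e he e' he' heq
        simp only [Finset.coe_filter, Set.mem_ofPred_eq] at he he'
        exact hinj e he.1 e' he'.1 (he.2.trans he'.2.symm) (Sum.inr.inj heq)
    refine this.trans ?_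
    unfold edgesIn
    simp only [U, Finset.sum_disjSum]
    exact Nat.le_add_right _ _
  by_contra hlt
  push Not at hlt
  apply hm
  have hU : U.Nonempty := by
    obtain ⟨e, he⟩ := hne
    exact ⟨.inl (X e), by
      simp only [U, Finset.mem_disjSum]
      exact Or.inl ⟨X e, Finset.mem_image_of_mem _ he, rfl⟩⟩
  have hmodel := KModel.of_dense hR hRi m U hU (by
    rw [show U.card = _ from Finset.card_disjSum _ _]
    exact hlt.le.trans hedges)
  -- A last vertex `z` is expanded to the union of all well-coloured paths that end in it; they hang
  -- together at `z`.
  let φ : ℕ ⊕ ℕ → Set ℕ := Sum.elim (fun x => {x})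
    fun z => {w | ∃ y ∈ {y | ∃ e ∈ S, Y e = y ∧ Z e = z}, ∃ i < L, w = pt y i}
  have hmemU : ∀ a ∈ (U : Set (ℕ ⊕ ℕ)), (∃ e ∈ S, a = .inl (X e)) ∨ ∃ e ∈ S, a = .inr (Z e) := by
    intro a ha
    simp only [U, Finset.mem_coe, Finset.mem_disjSum, Finset.mem_image] at ha
    rcases ha with ⟨_, ⟨e, he, rfl⟩, rfl⟩ | ⟨_, ⟨e, he, rfl⟩, rfl⟩
    · exact Or.inl ⟨e, he, rfl⟩
    · exact Or.inr ⟨e, he, rfl⟩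
  -- New first vertices have colour `L`, path vertices a smaller one.
  have hxz : ∀ e ∈ S, ∀ e' ∈ S, Disjoint (φ (.inl (X e))) (φ (.inr (Z e'))) := by
    intro e he e' he'
    rw [Set.disjoint_left]
    rintro w hw ⟨y, ⟨e'', he'', rfl, hz⟩, i, hi, rfl⟩
    have hw' : pt (Y e'') i = X e := hw
    have h1 := hχx e he
    rw [← hw', hχy e'' he'' i hi] at h1
    have := hls i hi
    omega
  refine hmodel.expand φ ?_ ?_ ?_ ?_
  · intro a ha
    rcases hmemU a ha with ⟨e, he, rfl⟩ | ⟨e, he, rfl⟩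
    · rintro w hw
      have hw' : w = X e := hw
      rw [hw']
      exact (hS e he).1
    · rintro w ⟨y, ⟨e', he', rfl, hz⟩, i, hi, rfl⟩
      exact h.lt _ (hS e' he').2.1 i hi
  · intro a ha
    rcases hmemU a ha with ⟨e, he, rfl⟩ | ⟨e, he, rfl⟩
    · exact Conn.singleton _
    · refine Conn.of_chains hs ⟨Y e, e, he, rfl, rfl⟩ (z := Z e) hL ?_ ?_
      · rintro y ⟨e', he', rfl, hz⟩ i hi
        exact h.chain _ (hS e' he').2.1 i hi
      · rintro y ⟨e', he', rfl, hz⟩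
        exact hz
  · intro a ha b hb hab
    rcases hmemU a ha with ⟨e, he, rfl⟩ | ⟨e, he, rfl⟩ <;>
    rcases hmemU b hb with ⟨e', he', rfl⟩ | ⟨e', he', rfl⟩
    · have : X e ≠ X e' := fun h => hab (by rw [h])
      show Disjoint ({X e} : Set ℕ) {X e'}
      simpa using this
    · exact hxz e he e' he'
    · exact (hxz e' he' e he).symm
    -- A vertex common to two of these unions has only one owner, which is the last vertex for both.
    · rw [Set.disjoint_left]
      rintro w ⟨y, ⟨e1, he1, rfl, hz1⟩, i, hi, rfl⟩ ⟨y', ⟨e2, he2, rfl, hz2⟩, i', hi', heq⟩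
      apply hab
      have h1 := hO (Y e1) (hS e1 he1).2.1 (hχy e1 he1) i hi
      have h2 := hO (Y e2) (hS e2 he2).2.1 (hχy e2 he2) i' hi'
      rw [heq, h2] at h1
      rw [← hz1, ← hz2]
      exact congrArg _ h1.symm
  · intro a ha b hb ⟨e, he, hab⟩
    have h0 : adj (X e) (pt (Y e) 0) := by
      rw [h.head _ (hS e he).2.1]; exact (hS e he).2.2
    have h1 : pt (Y e) 0 ∈ φ (.inr (Z e)) := ⟨Y e, ⟨e, he, rfl, rfl⟩, 0, hL, rfl⟩
    rcases hab with ⟨rfl, rfl⟩ | ⟨rfl, rfl⟩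
    · exact ⟨X e, rfl, _, h1, h0⟩
    · exact ⟨_, h1, X e, rfl, hs _ _ h0⟩

/-- Extension of a colouring of `Fin n`. -/
def extendColouring {K : ℕ} (χ : Fin n → Fin K) (v : ℕ) : ℕ :=
  if h : v < n then χ ⟨v, h⟩ else 0

open Classical in
/-- A positive fraction of the colourings has prescribed values at given distinct vertices. -/
theorem card_colourings {K : ℕ} (N : ℕ) (hN : N ≤ K) (c ls : ℕ → ℕ) (hc : ∀ i < N, c i < n)
    (hinj : ∀ i < N, ∀ j < N, c i = c j → i = j) (hls : ∀ i < N, ls i < K) :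
    Fintype.card (Fin n → Fin K) ≤ K ^ K *
      (Finset.univ.filter fun χ : Fin n → Fin K =>
        ∀ i < N, extendColouring χ (c i) = ls i).card := by
  rcases Nat.eq_zero_or_pos K with rfl | hK
  · obtain rfl : N = 0 := by omega
    simp
  · let good := Finset.univ.filter fun χ : Fin n → Fin K =>
        ∀ i < N, extendColouring χ (c i) = ls i
    -- Overwrite a good colouring at the prescribed vertices by arbitrary values. Every colouring
    -- arises in this way, and there are `K ^ K` choices of values.
    let g : (Fin n → Fin K) × (Fin K → Fin K) → (Fin n → Fin K) := fun p v =>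
      if h : ∃ i : Fin K, i < N ∧ c i = v then p.2 h.choose else p.1 v
    have hsurj : ∀ χ : Fin n → Fin K, ∃ p ∈ good ×ˢ (Finset.univ : Finset (Fin K → Fin K)),
        g p = χ := by
      intro χ
      refine ⟨(fun v => if h : ∃ i : Fin K, i < N ∧ c i = v then
        ⟨ls h.choose, hls _ h.choose_spec.1⟩ else χ v,
        fun i => if h : c i < n then χ ⟨c i, h⟩ else ⟨0, hK⟩), ?_, ?_⟩
      · simp only [Finset.mem_product, Finset.mem_univ, and_true, good, Finset.mem_filter, true_and]
        intro i hi
        have hex : ∃ j : Fin K, j < N ∧ c j = c i := ⟨⟨i, by omega⟩, hi, rfl⟩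
        rw [extendColouring, dif_pos (hc i hi), dif_pos hex]
        have hsp := hex.choose_spec
        exact congrArg ls (hinj _ hsp.1 _ hi hsp.2)
      · funext v
        by_cases h : ∃ i : Fin K, i < N ∧ c i = v
        · have hsp := h.choose_spec
          simp only [g, dif_pos h]
          rw [dif_pos (by rw [hsp.2]; exact v.2)]
          congr 1
          exact Fin.ext hsp.2
        · simp only [g, dif_neg h]
    calc Fintype.card (Fin n → Fin K) = (Finset.univ : Finset (Fin n → Fin K)).card := rfl
      _ ≤ (good ×ˢ (Finset.univ : Finset (Fin K → Fin K))).card :=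
        Finset.card_le_card_of_surjOn g (fun χ _ => hsurj χ)
      _ = K ^ K * good.card := by
        rw [Finset.card_product, Finset.card_univ, Fintype.card_fun, Fintype.card_fin, mul_comm]

open Classical in
/-- The pairs of ends of the prolonged paths form a sparse bipartite graph. -/
theorem PathFam.sparse (hs : ∀ u v, adj u v → adj v u)
    {m K : ℕ} (hm : ¬ KModel adj m {v | v < n}) (h : PathFam adj n L df pt) (hK : L + 1 ≤ K)
    (S : Finset ℕ) (X Y : ℕ → ℕ)
    (hS : ∀ e ∈ S, X e < n ∧ df (Y e) ∧ adj (X e) (Y e))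
    (hnd : ∀ e ∈ S, ∀ i < L + 1, ∀ j < L + 1,
      consPath (X e) (pt (Y e)) i = consPath (X e) (pt (Y e)) j → i = j)
    (hinj : ∀ e ∈ S, ∀ e' ∈ S, X e = X e' → pt (Y e) (L - 1) = pt (Y e') (L - 1) → e = e')
    (A C : Finset ℕ) (hA : ∀ e ∈ S, X e ∈ A) (hC : ∀ e ∈ S, pt (Y e) (L - 1) ∈ C) :
    S.card ≤ K ^ K * 2 ^ m * (A.card + C.card) := by
  obtain ⟨ls, hls, ho⟩ := h.owned
  let good : (Fin n → Fin K) → ℕ → Prop := fun χ e =>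
    ∀ i < L + 1, extendColouring χ (consPath (X e) (pt (Y e)) i) = consPath L ls i
  have h1 : ∀ χ : Fin n → Fin K, (S.filter (good χ)).card ≤ 2 ^ m * (A.card + C.card) := by
    intro χ
    refine (card_coloured_le hs hm h hls ho (extendColouring χ) (S.filter (good χ)) X Y
      ?_ ?_ ?_).trans ?_
    · exact fun e he => hS e (Finset.mem_filter.1 he).1
    · exact fun e he => (Finset.mem_filter.1 he).2
    · exact fun e he e' he' => hinj e (Finset.mem_filter.1 he).1 e' (Finset.mem_filter.1 he').1
    · gcongr
      · exact Finset.image_subset_iff.2 fun e he => hA e (Finset.mem_filter.1 he).1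
      · exact Finset.image_subset_iff.2 fun e he => hC e (Finset.mem_filter.1 he).1
  have h2 : ∀ e ∈ S, Fintype.card (Fin n → Fin K) ≤
      K ^ K * (Finset.univ.filter fun χ : Fin n → Fin K => good χ e).card := by
    intro e he
    refine card_colourings (L + 1) hK _ _ ?_ (hnd e he) ?_
    · intro i hi
      cases i with
      | zero => exact (hS e he).1
      | succ i => exact h.lt _ (hS e he).2.1 i (by omega)
    · intro i hi
      cases i with
      | zero => simp only [consPath_zero]; omega
      | succ i => have := hls i (by omega); simp only [consPath_succ]; omega
  have hpos : 0 < Fintype.card (Fin n → Fin K) := by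
    have : NeZero K := ⟨by omega⟩
    exact Fintype.card_pos
  -- Double counting of the pairs of a colouring and an edge that is well coloured by it;
  -- multiplying by the number of colourings replaces taking expectations.
  refine Nat.le_of_mul_le_mul_right ?_ hpos
  calc S.card * Fintype.card (Fin n → Fin K)
      = ∑ e ∈ S, Fintype.card (Fin n → Fin K) := by rw [Finset.sum_const, smul_eq_mul]
    _ ≤ ∑ e ∈ S, K ^ K * (Finset.univ.filter fun χ : Fin n → Fin K => good χ e).card :=
      Finset.sum_le_sum h2
    _ = K ^ K * ∑ χ : Fin n → Fin K, (S.filter (good χ)).card := by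
      rw [← Finset.mul_sum]
      congr 1
      simp only [Finset.card_filter]
      exact Finset.sum_comm
    _ ≤ K ^ K * ∑ χ : Fin n → Fin K, 2 ^ m * (A.card + C.card) := by
      gcongr with χ _
      exact h1 χ
    _ = K ^ K * 2 ^ m * (A.card + C.card) * Fintype.card (Fin n → Fin K) := by
      rw [Finset.sum_const, smul_eq_mul, Finset.card_univ]; ring

end

/-! ### Reasoning about programs: word size, running time, basic loops and expressions. -/

/-! ### Running programs on bounded memory -/

/-- The exponent `c` such that the values met in the evaluation are at most `B ^ c` if the memory
is bounded by `B`. -/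
def Expr.wt : Expr → ℕ
  | .lit c => c + 1
  | .reg _ => 1
  | .get _ i => i.wt + 1
  | .op _ e₁ e₂ => e₁.wt + e₂.wt

def Program.wt : Program → ℕ
  | .skip => 0
  | .assign _ e => e.wt
  | .store _ i e => i.wt + e.wt
  | .seq p q => p.wt + q.wt
  | .ite c p q => c.wt + p.wt + q.wt
  | .loop c p => c.wt + p.wt

/-- All contents of the memory are at most `B`. -/
structure Bdd (B : ℕ) (s : State) : Prop where
  two_le : 2 ≤ B
  reg : ∀ r, s.reg r ≤ B
  arr : ∀ a i, s.arr a i ≤ B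

theorem Expr.one_le_wt : ∀ e : Expr, 1 ≤ e.wt
  | .lit c => by simp [wt]
  | .reg r => le_rfl
  | .get a i => by simp [wt]
  | .op o e₁ e₂ => by have := e₁.one_le_wt; simp only [wt]; omega

/-- Both powers are at least `2`, so their product dominates their sum as well. This is why weights
may simply be added. -/
theorem BinOp.eval_le {B x y a b : ℕ} (hB : 2 ≤ B) (ha : 1 ≤ a) (hb : 1 ≤ b) (hx : x ≤ B ^ a)
    (hy : y ≤ B ^ b) (o : BinOp) : o.eval x y ≤ B ^ (a + b) := by
  have h1 : B ^ a ≤ B ^ (a + b) := Nat.pow_le_pow_right (by omega) (by omega)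
  have h2 : 2 ≤ B ^ a := hB.trans (Nat.le_self_pow (by omega) B)
  have h3 : 2 ≤ B ^ b := hB.trans (Nat.le_self_pow (by omega) B)
  cases o with
  | add =>
    show x + y ≤ _
    rw [pow_add]
    nlinarith
  | sub => exact (Nat.sub_le x y).trans (hx.trans h1)
  | mul => rw [pow_add]; exact Nat.mul_le_mul hx hy
  | div => exact (Nat.div_le_self x y).trans (hx.trans h1)
  | mod => exact (Nat.mod_le x y).trans (hx.trans h1)
  | lt => show (if x < y then 1 else 0) ≤ _; split_ifs <;> omega
  | eq => show (if x = y then 1 else 0) ≤ _; split_ifs <;> omega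

theorem Expr.eval_le {B : ℕ} {s : State} (hs : Bdd B s) : ∀ e : Expr, e.eval s ≤ B ^ e.wt
  | .lit c => by
    show c ≤ B ^ (c + 1)
    -- `c < 2 ^ c ≤ B ^ c`; the additional `1` in the weight keeps it positive when `c = 0`.
    exact (Nat.lt_two_pow_self.le.trans (Nat.pow_le_pow_left hs.two_le c)).trans
      (Nat.pow_le_pow_right (by have := hs.two_le; omega) (by omega))
  | .reg r => by simpa [wt, eval] using hs.reg r
  | .get a i => (hs.arr a _).trans (Nat.le_self_pow (by simp [wt]) B)
  | .op o e₁ e₂ => o.eval_le hs.two_le e₁.one_le_wt e₂.one_le_wt (e₁.eval_le hs) (e₂.eval_le hs)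

theorem Expr.fits {B w : ℕ} {s : State} (hs : Bdd B s) :
    ∀ e : Expr, B ^ e.wt < 2 ^ w → e.Fits w s
  | .lit c, h => ((Expr.lit c).eval_le hs).trans_lt h
  | .reg r, h => ((Expr.reg r).eval_le hs).trans_lt h
  | .get a i, h =>
    ⟨i.fits hs ((Nat.pow_le_pow_right (by have := hs.two_le; omega) (by simp [wt])).trans_lt h),
      ((Expr.get a i).eval_le hs).trans_lt h⟩
  | .op o e₁ e₂, h =>
    ⟨e₁.fits hs ((Nat.pow_le_pow_right (by have := hs.two_le; omega) (by simp [wt])).trans_lt h),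
      e₂.fits hs ((Nat.pow_le_pow_right (by have := hs.two_le; omega) (by simp [wt])).trans_lt h),
      ((Expr.op o e₁ e₂).eval_le hs).trans_lt h⟩

/-- `p` halts from `s` within time `t` in a memory that is bounded by `B` and satisfies `Q`. -/
def Run (B : ℕ) (p : Program) (s : State) (t : ℕ) (Q : State → Prop) : Prop :=
  ∀ w, B ^ p.wt < 2 ^ w → ∃ s' t', Exec w p s s' t' ∧ t' ≤ t ∧ Bdd B s' ∧ Q s'

section
variable {B : ℕ} {s : State} {t t' : ℕ} {Q Q' : State → Prop} {p q : Program}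

theorem Run.mono (h : Run B p s t Q) (ht : t ≤ t') (hQ : ∀ s', Bdd B s' → Q s' → Q' s') :
    Run B p s t' Q' := by
  intro w hw
  obtain ⟨s', t', h1, h2, h3, h4⟩ := h w hw
  exact ⟨s', t', h1, h2.trans ht, h3, hQ s' h3 h4⟩

theorem Bdd.setReg (hs : Bdd B s) (r : ℕ) {x : ℕ} (hx : x ≤ B) : Bdd B (s.setReg r x) where
  two_le := hs.two_le
  reg r' := by
    by_cases h : r' = r
    · subst h; simpa [State.setReg] using hx
    · simpa [State.setReg, h] using hs.reg r'
  arr := hs.arr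

theorem Bdd.setArr (hs : Bdd B s) (a i : ℕ) {x : ℕ} (hx : x ≤ B) : Bdd B (s.setArr a i x) where
  two_le := hs.two_le
  reg := hs.reg
  arr a' i' := by
    by_cases h : a' = a
    · subst h
      by_cases h' : i' = i
      · subst h'; simpa [State.setArr] using hx
      · simpa [State.setArr, h'] using hs.arr a' i'
    · simpa [State.setArr, h] using hs.arr a' i'

theorem Run.skip (hs : Bdd B s) (hQ : Q s) (ht : 1 ≤ t) : Run B .skip s t Q :=
  fun _ _ => ⟨s, 1, .skip s, ht, hs, hQ⟩

theorem Run.assign (hs : Bdd B s) {r : ℕ} {e : Expr} (hB : e.eval s ≤ B)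
    (hQ : Q (s.setReg r (e.eval s))) (ht : e.cost + 1 ≤ t) : Run B (.assign r e) s t Q :=
  fun _ hw => ⟨_, _, .assign s r e (e.fits hs hw), ht, hs.setReg r hB, hQ⟩

theorem Bdd.pow_mono (hs : Bdd B s) {a b w : ℕ} (h : B ^ b < 2 ^ w) (hab : a ≤ b) :
    B ^ a < 2 ^ w :=
  (Nat.pow_le_pow_right (by have := hs.two_le; omega) hab).trans_lt h

theorem Run.store (hs : Bdd B s) {a : ℕ} {i e : Expr} (hB : e.eval s ≤ B)
    (hQ : Q (s.setArr a (i.eval s) (e.eval s))) (ht : i.cost + e.cost + 1 ≤ t) :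
    Run B (.store a i e) s t Q :=
  fun _ hw => ⟨_, _, .store s a i e (i.fits hs (hs.pow_mono hw (Nat.le_add_right _ _)))
    (e.fits hs (hs.pow_mono hw (Nat.le_add_left _ _))), ht, hs.setArr a _ hB, hQ⟩

theorem Run.seq (hs : Bdd B s) (hp : Run B p s t Q)
    (hq : ∀ s', Bdd B s' → Q s' → Run B q s' t' Q') : Run B (.seq p q) s (t + t') Q' := by
  intro w hw
  obtain ⟨s₁, t₁, h1, h2, h3, h4⟩ := hp w (hs.pow_mono hw (Nat.le_add_right _ _))
  obtain ⟨s₂, t₂, h5, h6, h7, h8⟩ := hq s₁ h3 h4 w (hs.pow_mono hw (Nat.le_add_left _ _))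
  exact ⟨s₂, _, .seq _ _ _ _ _ _ _ h1 h5, by omega, h7, h8⟩

theorem Run.ite (hs : Bdd B s) {c : Expr} (hp : c.eval s ≠ 0 → Run B p s t Q)
    (hq : c.eval s = 0 → Run B q s t Q) (ht : c.cost + 1 + t ≤ t') :
    Run B (.ite c p q) s t' Q := by
  intro w hw
  have hc := c.fits hs (hs.pow_mono hw (by simp only [Program.wt]; omega))
  by_cases h : c.eval s = 0
  · obtain ⟨s₁, t₁, h1, h2, h3, h4⟩ := hq h w (hs.pow_mono hw (by simp only [Program.wt]; omega))
    exact ⟨s₁, _, .ite_false _ _ _ _ _ _ hc h h1, by omega, h3, h4⟩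
  · obtain ⟨s₁, t₁, h1, h2, h3, h4⟩ := hp h w (hs.pow_mono hw (by simp only [Program.wt]; omega))
    exact ⟨s₁, _, .ite_true _ _ _ _ _ _ hc h h1, by omega, h3, h4⟩

/-- Loops with an invariant that is indexed by the number of remaining iterations. -/
theorem Run.loop {c : Expr} (Inv : ℕ → State → Prop) (N : ℕ) (hs : Bdd B s) (h : Inv N s)
    (h0 : ∀ j s, Inv j s → c.eval s ≠ 0 → j ≠ 0)
    (hbody : ∀ j s, Bdd B s → Inv (j + 1) s → c.eval s ≠ 0 → Run B p s t (Inv j)) :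
    Run B (.loop c p) s ((N + 1) * (c.cost + 1 + t))
      (fun s' => c.eval s' = 0 ∧ ∃ j, Inv j s') := by
  intro w hw
  have hwp : B ^ p.wt < 2 ^ w := hs.pow_mono hw (by simp [Program.wt])
  have hwc : B ^ c.wt < 2 ^ w := hs.pow_mono hw (by simp [Program.wt])
  clear hw
  induction N generalizing s with
  | zero =>
    have hc : c.eval s = 0 := by
      by_contra hc
      exact h0 0 s h hc rfl
    exact ⟨s, _, .loop_false c p s (c.fits hs hwc) hc, by simp, hs, hc, 0, h⟩
  | succ N ih =>
    by_cases hc : c.eval s = 0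
    · exact ⟨s, _, .loop_false c p s (c.fits hs hwc) hc, by nlinarith, hs, hc, N + 1, h⟩
    · obtain ⟨s₁, t₁, h1, h2, h3, h4⟩ := hbody N s hs h hc w hwp
      obtain ⟨s₂, t₂, h5, h6, h7, h8⟩ := ih h3 h4
      exact ⟨s₂, _, .loop_true c p s s₁ s₂ t₁ t₂ (c.fits hs hwc) hc h1 h5, by nlinarith, h7, h8⟩

end

/-! ### Counting loops -/

theorem State.setReg_reg (s : State) (r x r' : ℕ) :
    (s.setReg r x).reg r' = if r' = r then x else s.reg r' := by
  simp [State.setReg, Function.update_apply]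

@[simp] theorem State.setReg_arr (s : State) (r x : ℕ) : (s.setReg r x).arr = s.arr := rfl

@[simp] theorem State.setArr_reg (s : State) (a i x : ℕ) : (s.setArr a i x).reg = s.reg := rfl

theorem State.setArr_arr (s : State) (a i x a' i' : ℕ) :
    (s.setArr a i x).arr a' i' = if a' = a ∧ i' = i then x else s.arr a' i' := by
  by_cases h : a' = a
  · subst h; simp [State.setArr, Function.update_apply]
  · simp [State.setArr, h]

/-- `for i in 0, …, N - 1` with `N` in register `rN` and the counter in register `3`. -/
def forP (rN : ℕ) (body : Program) : Program :=
  .seq (.assign 3 (.lit 0))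
    (.loop (.op .lt (.reg 3) (.reg rN)) (.seq body (.assign 3 (.op .add (.reg 3) (.lit 1)))))

/-- The body must leave the counter as it found it. The surplus of `10` per iteration pays for the
test, the increment and the initialisation. -/
theorem run_forP {B rN N c : ℕ} {s : State} {body : Program} (Inv : ℕ → State → Prop)
    (hs : Bdd B s) (hN : N ≤ B) (h0 : Inv 0 (s.setReg 3 0))
    (hrN : ∀ j s, Inv j s → s.reg rN = N)
    (hbody : ∀ j < N, ∀ s, Bdd B s → s.reg 3 = j → Inv j s →
      Run B body s c (fun s' => s'.reg 3 = j ∧ Inv (j + 1) (s'.setReg 3 (j + 1)))) :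
    Run B (forP rN body) s ((N + 1) * (c + 10)) (fun s' => s'.reg 3 = N ∧ Inv N s') := by
  have hloop : Run B (.loop (.op .lt (.reg 3) (.reg rN))
      (.seq body (.assign 3 (.op .add (.reg 3) (.lit 1))))) (s.setReg 3 0)
      ((N + 1) * (3 + 1 + (c + 4))) (fun s' => (Expr.op .lt (.reg 3) (.reg rN)).eval s' = 0 ∧
        ∃ j, (s'.reg 3 + j = N ∧ Inv (s'.reg 3) s')) := by
    refine Run.loop (fun j s' => s'.reg 3 + j = N ∧ Inv (s'.reg 3) s') N
      (hs.setReg 3 (Nat.zero_le _)) ⟨by simp [State.setReg], by simpa [State.setReg] using h0⟩ ?_ ?_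
    · rintro j s' ⟨h1, h2⟩ hc rfl
      apply hc
      simp [Expr.eval, BinOp.eval, hrN _ _ h2]
      omega
    · rintro j s' hs' ⟨h1, h2⟩ hc
      refine Run.seq hs' (hbody (s'.reg 3) (by omega) s' hs' rfl h2) ?_
      rintro s'' hs'' ⟨h4, h5⟩
      refine Run.assign hs'' ?_ ?_ le_rfl
      · simp [Expr.eval, BinOp.eval, h4]; omega
      · simp only [Expr.eval, BinOp.eval, h4]
        refine ⟨?_, ?_⟩
        · rw [State.setReg_reg, if_pos rfl]; omega
        · rw [State.setReg_reg, if_pos rfl]; exact h5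
  refine Run.mono (Run.seq hs (Run.assign hs (Q := (· = s.setReg 3 0)) (Nat.zero_le _) rfl le_rfl)
    (fun s' _ h => h ▸ hloop)) ?_ ?_
  · simp only [Expr.cost]; nlinarith
  · rintro s' hs' ⟨h1, j, h2, h4⟩
    have hr := hrN _ _ h4
    have : ¬ s'.reg 3 < N := by
      intro hlt
      simp [Expr.eval, BinOp.eval, hr, hlt] at h1
    have h5 : s'.reg 3 = N := by omega
    rw [h5] at h4
    exact ⟨h5, h4⟩

/-- The expression does not read the array `a`. -/
def Expr.avoids (a : ℕ) : Expr → Prop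
  | .lit _ => True
  | .reg _ => True
  | .get b i => b ≠ a ∧ i.avoids a
  | .op _ e₁ e₂ => e₁.avoids a ∧ e₂.avoids a

theorem Expr.eval_congr {s s' : State} {a : ℕ} (hr : s.reg = s'.reg)
    (ha : ∀ b, b ≠ a → s.arr b = s'.arr b) : ∀ (e : Expr) (_ : e.avoids a), e.eval s = e.eval s'
  | .lit c, _ => rfl
  | .reg r, _ => congrFun hr r
  | .get b i, h => by
    show s.arr b _ = s'.arr b _
    rw [ha b h.1, i.eval_congr hr ha h.2]
  | .op o e₁ e₂, h => by
    show o.eval _ _ = o.eval _ _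
    rw [e₁.eval_congr hr ha h.1, e₂.eval_congr hr ha h.2]

/-- Overwrite the first `N` entries of the array `a`, leaving the counter at `N`. -/
def State.put (s : State) (a N : ℕ) (g : ℕ → ℕ) : State where
  reg := Function.update s.reg 3 N
  arr := Function.update s.arr a fun j => if j < N then g j else s.arr a j

theorem State.put_reg (s : State) (a N : ℕ) (g : ℕ → ℕ) {r : ℕ} (hr : r ≠ 3) :
    (s.put a N g).reg r = s.reg r := by
  simp [State.put, hr]

theorem State.put_arr_same (s : State) (a : ℕ) {N : ℕ} (g : ℕ → ℕ) {j : ℕ} (hj : j < N) :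
    (s.put a N g).arr a j = g j := by
  simp [State.put, hj]

theorem State.put_arr_ne (s : State) {a b : ℕ} (N : ℕ) (g : ℕ → ℕ) (h : b ≠ a) :
    (s.put a N g).arr b = s.arr b := by
  simp [State.put, h]

/-- Fill the first entries of the array `a` by an expression in the counter. -/
def mapP (rN a : ℕ) (e : Expr) : Program := forP rN (.store a (.reg 3) e)

/-- Since `e` does not read the array that is being filled, every entry can be evaluated in the
initial memory. The final memory is then known exactly, not only up to a property. -/
theorem run_mapP {B rN N a : ℕ} {s : State} {e : Expr} (hs : Bdd B s) (hN : N ≤ B) (h3 : rN ≠ 3)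
    (hr : s.reg rN = N) (he : e.avoids a) (hB : ∀ j < N, e.eval (s.setReg 3 j) ≤ B) :
    Run B (mapP rN a e) s ((N + 1) * (e.cost + 12))
      (· = s.put a N fun j => e.eval (s.setReg 3 j)) := by
  refine Run.mono (run_forP (c := e.cost + 2) (fun j s' => s' =
    { reg := Function.update s.reg 3 j
      arr := Function.update s.arr a fun i =>
        if i < j then e.eval (s.setReg 3 i) else s.arr a i }) hs hN ?_ ?_ ?_) (by linarith) ?_
  · simp [State.setReg]
  · rintro j s' rfl
    simp [h3, hr]
  · rintro j hj s' hs' h3' rfl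
    have hev : e.eval { reg := Function.update s.reg 3 j
                        arr := Function.update s.arr a fun i =>
                          if i < j then e.eval (s.setReg 3 i) else s.arr a i } =
        e.eval (s.setReg 3 j) := by
      apply Expr.eval_congr (a := a) ?_ ?_ e he
      · rfl
      · intro b hb
        simp [State.setReg, hb]
    refine Run.store hs' (by rw [hev]; exact hB j hj) ?_ (by simp [Expr.cost]; omega)
    rw [hev]
    refine ⟨by simp [State.setArr], ?_⟩
    simp only [State.setArr, State.setReg, Expr.eval, Function.update_self, Function.update_idem]
    congr 2
    funext i
    rcases lt_trichotomy i j with h | h | h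
    · simp [h.ne, h, h.trans (Nat.lt_succ_self j)]
    · subst h; simp
    · simp only [Function.update_apply, h.ne', if_false]
      rw [if_neg (by omega), if_neg (by omega)]
  · rintro s' _ ⟨_, rfl⟩
    rfl

/-! ### Boolean expressions -/

/-- Conjunction of conditions. -/
def allE : List Expr → Expr
  | [] => .lit 1
  | e :: l => .op .mul (.op .lt (.lit 0) e) (allE l)

/-- Disjunction of conditions. -/
def anyE : List Expr → Expr
  | [] => .lit 0
  | e :: l => .op .lt (.lit 0) (.op .add e (anyE l))

def notE (e : Expr) : Expr := .op .eq e (.lit 0)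

def eqE (e e' : Expr) : Expr := .op .eq e e'

section
variable {s : State} {l : List Expr} {e e' : Expr}

theorem eval_allE : ∀ l : List Expr, (allE l).eval s ≤ 1 ∧
    ((allE l).eval s ≠ 0 ↔ ∀ e ∈ l, e.eval s ≠ 0)
  | [] => by simp [allE, Expr.eval]
  | e :: l => by
    have ih := eval_allE l
    have : (allE (e :: l)).eval s = (if 0 < e.eval s then 1 else 0) * (allE l).eval s := rfl
    rw [this, List.forall_mem_cons, ← ih.2]
    split_ifs with h
    · simp [ih.1, h.ne']
    · simp only [zero_mul, zero_le, true_and]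
      omega

theorem allE_le : (allE l).eval s ≤ 1 := (eval_allE l).1

theorem allE_ne_zero : (allE l).eval s ≠ 0 ↔ ∀ e ∈ l, e.eval s ≠ 0 := (eval_allE l).2

theorem anyE_ne_zero : ∀ {l : List Expr}, (anyE l).eval s ≠ 0 ↔ ∃ e ∈ l, e.eval s ≠ 0
  | [] => by simp [anyE, Expr.eval]
  | e :: l => by
    have : (anyE (e :: l)).eval s = if 0 < e.eval s + (anyE l).eval s then 1 else 0 := rfl
    rw [this, List.exists_mem_cons_iff, ← anyE_ne_zero]
    split_ifs with h <;> simp <;> omega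

theorem notE_ne_zero : (notE e).eval s ≠ 0 ↔ e.eval s = 0 := by
  show (if e.eval s = 0 then 1 else 0) ≠ 0 ↔ _
  split_ifs with h <;> simp [h]

theorem eqE_ne_zero : (eqE e e').eval s ≠ 0 ↔ e.eval s = e'.eval s := by
  show (if e.eval s = e'.eval s then 1 else 0) ≠ 0 ↔ _
  split_ifs with h <;> simp [h]

theorem avoids_allE {a : ℕ} : ∀ {l : List Expr}, (∀ e ∈ l, e.avoids a) → (allE l).avoids a
  | [], _ => True.intro
  | e :: l, h => ⟨⟨True.intro, h e (by simp)⟩, avoids_allE fun e' he' => h e' (by simp [he'])⟩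

theorem avoids_anyE {a : ℕ} : ∀ {l : List Expr}, (∀ e ∈ l, e.avoids a) → (anyE l).avoids a
  | [], _ => True.intro
  | e :: l, h => ⟨True.intro, h e (by simp), avoids_anyE fun e' he' => h e' (by simp [he'])⟩

theorem avoids_notE {a : ℕ} (h : e.avoids a) : (notE e).avoids a := ⟨h, True.intro⟩

theorem avoids_eqE {a : ℕ} (h : e.avoids a) (h' : e'.avoids a) : (eqE e e').avoids a := ⟨h, h'⟩

end

/-! ### Sequences of programs -/

/-- Run the programs of a list one after the other. -/
def seqP : List Program → Program
  | [] => .skip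
  | p :: l => .seq p (seqP l)

/-- A sequence of programs with a common invariant, each of which achieves a goal that the others
preserve. -/
theorem run_seqP {ι : Type*} {B c : ℕ} (f : ι → Program) (Inv : State → Prop)
    (Goal : ι → State → Prop) :
    ∀ (l : List ι)
      (_ : ∀ i ∈ l, ∀ s, Bdd B s → Inv s → Run B (f i) s c fun s' => Inv s' ∧ Goal i s' ∧
        ∀ j, Goal j s → Goal j s') (s : State), Bdd B s → Inv s →
      Run B (seqP (l.map f)) s (c * l.length + 1) fun s' => Inv s' ∧ (∀ i ∈ l, Goal i s') ∧
        ∀ j, Goal j s → Goal j s'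
  | [], _, s, hs, h => Run.skip hs ⟨h, by simp, fun _ h => h⟩ (by simp)
  | i :: l, hl, s, hs, h => by
    refine Run.mono (Run.seq hs (hl i (by simp) s hs h) (fun s' hs' h' =>
      run_seqP f Inv Goal l (fun j hj => hl j (by simp [hj])) s' hs' h'.1 |>.mono le_rfl
        (Q' := fun s'' => Inv s'' ∧ (∀ i' ∈ i :: l, Goal i' s'') ∧ ∀ j, Goal j s → Goal j s'')
        ?_)) ?_ (fun _ _ h => h)
    · rintro s'' _ ⟨h1, h2, h3⟩
      exact ⟨h1, List.forall_mem_cons.2 ⟨h3 i h'.2.1, h2⟩, fun j hj => h3 j (h'.2.2 j hj)⟩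
    · simp only [List.length_cons]; nlinarith

/-! ### Subroutines: low-degree orientation in `O(n log n)` and grouping in linear time. -/

/-! ### Orienting sparse graphs: counting and scattering -/

/-- The array with tag `t` at depth `d`. -/
def nm (d t : ℕ) : ℕ := Nat.pair d t

@[simp] theorem nm_inj {d t d' t' : ℕ} : nm d t = nm d' t' ↔ d = d' ∧ t = t' := Nat.pair_eq_pair

/-- Count in `dg` how often each value occurs among the entries `i < M` of `aU` with `own i = 0`,
and record in `rk` how often the value occurred before. -/
def countP (own aU dg rk : ℕ) : Program :=
  .seq (mapP 0 dg (.lit 0))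
    (forP 1 (.ite (notE (.get own (.reg 3)))
      (.seq (.store rk (.reg 3) (.get dg (.get aU (.reg 3))))
        (.store dg (.get aU (.reg 3)) (.op .add (.get dg (.get aU (.reg 3))) (.lit 1))))
      .skip))

/-- The counter of a value, read just before it grows, is the rank of the entry among those with
this value. Entries with an owner are left out and keep the rank they got in an earlier round. -/
theorem run_countP {B n M own aU dg rk : ℕ} {s : State} {U : ℕ → ℕ} (hs : Bdd B s)
    (hn : s.reg 0 = n) (hM : s.reg 1 = M) (hnB : n ≤ B) (hMB : M ≤ B)
    (hU : ∀ e < M, s.arr aU e = U e) (hUn : ∀ e < M, U e < n)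
    (h1 : own ≠ dg) (h2 : own ≠ rk) (h3 : aU ≠ dg) (h4 : aU ≠ rk) (h5 : dg ≠ rk) :
    Run B (countP own aU dg rk) s (100 * B) fun s' =>
      (∀ r ≠ 3, s'.reg r = s.reg r) ∧ (∀ a, a ≠ dg → a ≠ rk → s'.arr a = s.arr a) ∧
      (∀ x < n, s'.arr dg x = Nat.count (fun e => s.arr own e = 0 ∧ U e = x) M) ∧
      (∀ e < M, s.arr own e = 0 →
        s'.arr rk e = Nat.count (fun e' => s.arr own e' = 0 ∧ U e' = U e) e) ∧
      (∀ e < M, s.arr own e ≠ 0 → s'.arr rk e = s.arr rk e) := by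
  have h2B := hs.two_le
  have hfor : ∀ s₁, Bdd B s₁ → s₁ = s.put dg n (fun j => (Expr.lit 0).eval (s.setReg 3 j)) → _ :=
    fun s₁ hs₁ e₁ => run_forP (B := B) (rN := 1) (N := M) (c := 30) (s := s₁) (body :=
      (.ite (notE (.get own (.reg 3)))
      (.seq (.store rk (.reg 3) (.get dg (.get aU (.reg 3))))
        (.store dg (.get aU (.reg 3)) (.op .add (.get dg (.get aU (.reg 3))) (.lit 1))))
      .skip))
      (fun j s' => (∀ r ≠ 3, s'.reg r = s.reg r) ∧
        (∀ a, a ≠ dg → a ≠ rk → s'.arr a = s.arr a) ∧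
        (∀ x < n, s'.arr dg x = Nat.count (fun e => s.arr own e = 0 ∧ U e = x) j) ∧
        (∀ e < j, s.arr own e = 0 →
          s'.arr rk e = Nat.count (fun e' => s.arr own e' = 0 ∧ U e' = U e) e) ∧
        (∀ e, (s.arr own e ≠ 0 ∨ j ≤ e) → s'.arr rk e = s.arr rk e)) hs₁ hMB (by
          subst e₁
          refine ⟨?_, ?_, ?_, ?_, ?_⟩
          · intro r hr; simp [State.setReg_reg, hr, State.put_reg]
          · intro a ha _; rw [State.setReg_arr, State.put_arr_ne _ _ _ ha]
          · intro x hx; rw [State.setReg_arr, State.put_arr_same _ _ _ hx]; simp [Expr.eval]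
          · intro e he; omega
          · intro e _; rw [State.setReg_arr, State.put_arr_ne _ _ _ h5.symm])
        (fun j s' h => by rw [h.1 1 (by norm_num), hM]) (by
          rintro j hj s' hs' hr ⟨i1, i2, i3, i4, i5⟩
          have eU : s'.arr aU j = U j := by rw [i2 aU h3 h4, hU j hj]
          have eO : s'.arr own j = s.arr own j := by rw [i2 own h1 h2]
          have hcnt : ∀ x < n, s'.arr dg x < B := by
            intro x hx
            rw [i3 x hx]
            have := Nat.count_le (p := fun e => s.arr own e = 0 ∧ U e = x) (n := j)
            omega
          refine Run.ite hs' (t := 20) ?_ ?_ (by simp [Expr.cost, notE])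
          · intro hc
            rw [notE_ne_zero] at hc
            simp only [Expr.eval, hr, eO] at hc
            refine Run.mono (Run.seq hs' (Run.store hs' (Q := (· = s'.setArr rk j (s'.arr dg (U j))))
              (hs'.arr _ _) (by simp [Expr.eval, hr, eU]) le_rfl) (t' := 11) (fun s'' hs'' e'' =>
                Run.store hs'' ?_ ?_ ?_)) (by simp [Expr.cost]) (fun _ _ h => h)
            · subst e''
              simp [Expr.eval, BinOp.eval, State.setArr_arr, h4, hr, eU, h5]
              exact hcnt _ (hUn j hj)
            · subst e''
              have ev1 : Expr.eval (s'.setArr rk j (s'.arr dg (U j))) (.get aU (.reg 3)) = U j := by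
                simp [Expr.eval, State.setArr_arr, h4, hr, eU]
              have ev2 : Expr.eval (s'.setArr rk j (s'.arr dg (U j)))
                  (.op .add (.get dg (.get aU (.reg 3))) (.lit 1)) = s'.arr dg (U j) + 1 := by
                simp [Expr.eval, BinOp.eval, State.setArr_arr, h4, hr, eU, h5]
              rw [ev1, ev2]
              refine ⟨by simpa using hr, ?_, ?_, ?_, ?_, ?_⟩
              · intro r hr'; simp [State.setReg_reg, hr', i1 r hr']
              · intro a ha ha'
                funext i
                simp [State.setArr_arr, ha, ha', i2 a ha ha']
              · intro x hx
                simp only [State.setReg_arr, State.setArr_arr, true_and, h5, false_and, if_false,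
                  Nat.count_succ, hc]
                by_cases h : x = U j
                · subst h; simp [i3 _ hx]
                · simp [h, i3 x hx, Ne.symm h]
              · intro e he hoe
                simp only [State.setReg_arr, State.setArr_arr, true_and, h5.symm, false_and,
                  if_false]
                by_cases h : e = j
                · subst h; simp [i3 _ (hUn e hj)]
                · simp only [h, if_false]; exact i4 e (by omega) hoe
              · intro e he
                have : e ≠ j := by
                  rintro rfl
                  rcases he with he | he
                  · exact he hc
                  · omega
                simp only [State.setReg_arr, State.setArr_arr, true_and, h5.symm, false_and,
                  if_false, this]
                exact i5 e (by omega)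
            · simp [Expr.cost]
          · intro hc
            have hc' : s.arr own j ≠ 0 := by
              intro h
              have := (notE_ne_zero (s := s') (e := .get own (.reg 3))).2 (by simp [Expr.eval, hr, eO, h])
              exact this hc
            refine Run.skip hs' ⟨hr, ?_, ?_, ?_, ?_, ?_⟩ (by norm_num)
            · intro r hr'; simp [State.setReg_reg, hr', i1 r hr']
            · intro a ha ha'; exact i2 a ha ha'
            · intro x hx
              rw [State.setReg_arr, i3 x hx, Nat.count_succ, if_neg (fun h => hc' h.1), add_zero]
            · intro e he hoe
              have : e ≠ j := by rintro rfl; exact hc' hoe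
              exact i4 e (by omega) hoe
            · intro e he
              exact i5 e (by omega))
  refine Run.mono (Run.seq hs (run_mapP hs hnB (by norm_num) hn True.intro
    (fun j _ => Nat.zero_le _)) (fun s' hs' h => hfor s' hs' h)) ?_ ?_
  · simp only [Expr.cost]; omega
  · rintro s' _ ⟨_, i1, i2, i3, i4, i5⟩
    exact ⟨i1, i2, i3, i4, fun e _ he => i5 e (Or.inl he)⟩

/-- For all `i < M` with `own i = v` write `i + 1` into the entry `aU i * D + rk i` of `arc`. -/
def scatterP (D own v aU rk arc : ℕ) : Program :=
  .seq (mapP 5 arc (.lit 0))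
    (forP 1 (.ite (eqE (.get own (.reg 3)) (.lit v))
      (.store arc (.op .add (.op .mul (.get aU (.reg 3)) (.lit D)) (.get rk (.reg 3)))
        (.op .add (.reg 3) (.lit 1)))
      .skip))

/-- Every vertex has a block of `D` slots. Ranks below `D` that differ among the edges of one owner
give different slots, so nothing is overwritten. Numbers are stored increased by one because `0`
marks an empty slot. -/
theorem run_scatterP {B n M D own v aU rk arc : ℕ} {s : State} {U : ℕ → ℕ} (hs : Bdd B s)
    (hn : s.reg 5 = n * D) (hM : s.reg 1 = M) (hnB : n * D ≤ B) (hMB : M ≤ B)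
    (hU : ∀ e < M, s.arr aU e = U e)
    (h1 : own ≠ arc) (h2 : aU ≠ arc) (h3 : rk ≠ arc)
    (hrk : ∀ e < M, s.arr own e = v → s.arr rk e < D)
    (hinj : ∀ e < M, ∀ e' < M, s.arr own e = v → s.arr own e' = v → U e = U e' →
      s.arr rk e = s.arr rk e' → e = e') :
    Run B (scatterP D own v aU rk arc) s (100 * B) fun s' =>
      (∀ r ≠ 3, s'.reg r = s.reg r) ∧ (∀ a, a ≠ arc → s'.arr a = s.arr a) ∧
      (∀ e < M, s.arr own e = v → ∃ j < D, s'.arr arc (U e * D + j) = e + 1) ∧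
      (∀ x < n, ∀ j < D, ∀ e, s'.arr arc (x * D + j) = e + 1 →
        e < M ∧ s.arr own e = v ∧ U e = x) := by
  have h2B := hs.two_le
  have hfor : ∀ s₁, Bdd B s₁ →
      s₁ = s.put arc (n * D) (fun j => (Expr.lit 0).eval (s.setReg 3 j)) → _ :=
    fun s₁ hs₁ e₁ => run_forP (B := B) (rN := 1) (N := M) (c := 20) (s := s₁) (body :=
      (.ite (eqE (.get own (.reg 3)) (.lit v))
      (.store arc (.op .add (.op .mul (.get aU (.reg 3)) (.lit D)) (.get rk (.reg 3)))
        (.op .add (.reg 3) (.lit 1)))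
      .skip))
      (fun j s' => (∀ r ≠ 3, s'.reg r = s.reg r) ∧
        (∀ a, a ≠ arc → s'.arr a = s.arr a) ∧
        (∀ e < M, e < j → s.arr own e = v → s'.arr arc (U e * D + s.arr rk e) = e + 1) ∧
        (∀ i < n * D, ∀ e, s'.arr arc i = e + 1 →
          e < M ∧ s.arr own e = v ∧ i = U e * D + s.arr rk e)) hs₁ hMB (by
          subst e₁
          refine ⟨?_, ?_, ?_, ?_⟩
          · intro r hr; simp [State.setReg_reg, hr, State.put_reg]
          · intro a ha; rw [State.setReg_arr, State.put_arr_ne _ _ _ ha]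
          · intro e _ he; omega
          · intro i hi e
            rw [State.setReg_arr, State.put_arr_same _ _ _ hi]; simp [Expr.eval])
        (fun j s' h => by rw [h.1 1 (by norm_num), hM]) (by
          rintro j hj s' hs' hr ⟨i1, i2, i3, i4⟩
          have eU : s'.arr aU j = U j := by rw [i2 aU h2, hU j hj]
          have eO : s'.arr own j = s.arr own j := by rw [i2 own h1]
          have eR : s'.arr rk j = s.arr rk j := by rw [i2 rk h3]
          refine Run.ite hs' (t := 11) ?_ ?_ (by simp [Expr.cost, eqE])
          · intro hc
            rw [eqE_ne_zero] at hc
            simp only [Expr.eval, hr, eO] at hc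
            refine Run.store hs' ?_ ?_ (by simp [Expr.cost])
            · simp [Expr.eval, BinOp.eval, hr]; omega
            · have ev1 : Expr.eval s' (.op .add (.op .mul (.get aU (.reg 3)) (.lit D))
                  (.get rk (.reg 3))) = U j * D + s.arr rk j := by
                simp [Expr.eval, BinOp.eval, hr, eU, eR]
              have ev2 : Expr.eval s' (.op .add (.reg 3) (.lit 1)) = j + 1 := by
                simp [Expr.eval, BinOp.eval, hr]
              rw [ev1, ev2]
              refine ⟨by simpa using hr, ?_, ?_, ?_, ?_⟩
              · intro r hr'; simp [State.setReg_reg, hr', i1 r hr']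
              · intro a ha
                funext i
                simp [State.setArr_arr, ha, i2 a ha]
              · intro e heM he hoe
                simp only [State.setReg_arr, State.setArr_arr, true_and]
                split_ifs with h
                · have hr1 := hrk e heM hoe
                  have hr2 := hrk j hj hc
                  have hD : 0 < D := by omega
                  have d1 := congrArg (· / D) h
                  have d2 := congrArg (· % D) h
                  simp only [Nat.mul_add_mod', Nat.mod_eq_of_lt hr1, Nat.mod_eq_of_lt hr2] at d2
                  simp only [mul_comm _ D, Nat.mul_add_div hD, Nat.div_eq_of_lt hr1,
                    Nat.div_eq_of_lt hr2, add_zero] at d1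
                  rw [hinj e heM j hj hoe hc d1 d2]
                · refine i3 e heM ?_ hoe
                  have : e ≠ j := by rintro rfl; exact h rfl
                  omega
              · intro i hi e
                simp only [State.setReg_arr, State.setArr_arr, true_and]
                split_ifs with h
                · intro he
                  obtain rfl : j = e := by omega
                  exact ⟨hj, hc, h⟩
                · exact i4 i hi e
          · intro hc
            have hc' : s.arr own j ≠ v := by
              intro h
              exact (eqE_ne_zero (s := s') (e := .get own (.reg 3)) (e' := .lit v)).2
                (by simp [Expr.eval, hr, eO, h]) hc
            refine Run.skip hs' ⟨hr, ?_, ?_, ?_, ?_⟩ (by norm_num)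
            · intro r hr'; simp [State.setReg_reg, hr', i1 r hr']
            · intro a ha; exact i2 a ha
            · intro e heM he hoe
              have : e ≠ j := by rintro rfl; exact hc' hoe
              exact i3 e heM (by omega) hoe
            · intro i hi e
              exact i4 i hi e)
  refine Run.mono (Run.seq hs (run_mapP hs hnB (by norm_num) hn True.intro
    (fun j _ => Nat.zero_le _)) (fun s' hs' h => hfor s' hs' h)) ?_ ?_
  · simp only [Expr.cost]; omega
  · rintro s' _ ⟨_, i1, i2, i3, i4⟩
    refine ⟨i1, i2, fun e he ho => ⟨_, hrk e he ho, i3 e he he ho⟩, ?_⟩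
    intro x hx j hj e he
    have hlt : x * D + j < n * D := by nlinarith
    obtain ⟨a, b, c⟩ := i4 _ hlt e he
    refine ⟨a, b, ?_⟩
    have hr1 := hrk e a b
    have hD : 0 < D := by omega
    have d1 := congrArg (· / D) c
    simp only [mul_comm _ D, Nat.mul_add_div hD, Nat.div_eq_of_lt hr1,
      Nat.div_eq_of_lt hj, add_zero] at d1
    exact d1.symm

/-! ### Orienting sparse graphs: the rounds -/

def iteE (c e e' : Expr) : Expr := .op .add (.op .mul (.op .lt (.lit 0) c) e) (.op .mul (notE c) e')

theorem eval_iteE (s : State) (c e e' : Expr) :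
    (iteE c e e').eval s = if c.eval s ≠ 0 then e.eval s else e'.eval s := by
  show (if 0 < c.eval s then 1 else 0) * e.eval s + (if c.eval s = 0 then 1 else 0) * e'.eval s = _
  by_cases h : c.eval s = 0 <;> simp [h, Nat.pos_of_ne_zero]

theorem avoids_iteE {a : ℕ} {c e e' : Expr} (h : c.avoids a) (h' : e.avoids a) (h'' : e'.avoids a) :
    (iteE c e e').avoids a := ⟨⟨⟨True.intro, h⟩, h'⟩, ⟨h, True.intro⟩, h''⟩

/-- Every edge `e` with `own e = 0` that has an end of degree at most `D` becomes owned by such an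
end. -/
def newOwn (D M : ℕ) (U V own : ℕ → ℕ) (e : ℕ) : ℕ :=
  if own e ≠ 0 then own e
  else if Nat.count (fun e' => own e' = 0 ∧ U e' = U e) M < D + 1 then 1
  else if Nat.count (fun e' => own e' = 0 ∧ V e' = V e) M < D + 1 then 2 else 0

/-- The state of the orientation between two rounds: `own e` is `0` for the edges that have no
owner, `1` and `2` for those that are owned by their left and right end, and `3` for those that are
absent. -/
structure Oriented (D M : ℕ) (live : ℕ → Prop) (U V own rkL rkR : ℕ → ℕ) : Prop where
  absent : ∀ e < M, own e = 3 ↔ ¬ live e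
  le : ∀ e < M, own e ≤ 3
  left : ∀ e < M, own e = 1 → rkL e < D ∧ (∀ e' < M, own e' = 0 → U e' ≠ U e) ∧
    ∀ e' < M, own e' = 1 → U e = U e' → rkL e = rkL e' → e = e'
  right : ∀ e < M, own e = 2 → rkR e < D ∧ (∀ e' < M, own e' = 0 → V e' ≠ V e) ∧
    ∀ e' < M, own e' = 2 → V e = V e' → rkR e = rkR e' → e = e'

section
variable {D M : ℕ} {live : ℕ → Prop} {U V own rkL rkR rkL' rkR' : ℕ → ℕ}

theorem count_lt_count {p : ℕ → Prop} [DecidablePred p] {e M : ℕ} (he : e < M) (h : p e) :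
    Nat.count p e < Nat.count p M := Nat.count_strict_mono h he

/-- One argument for both sides. Once an end takes an edge, no ownerless edge remains at this end,
so all edges it owns come from a single round. Their ranks in that round are different, and they are
below `D` because at most `D` edges were left there. -/
theorem Oriented.side {D M v : ℕ} {U own own' rk rk' : ℕ → ℕ}
    (h : ∀ e < M, own e = v → rk e < D ∧ (∀ e' < M, own e' = 0 → U e' ≠ U e) ∧
      ∀ e' < M, own e' = v → U e = U e' → rk e = rk e' → e = e')
    (hold : ∀ e, own e ≠ 0 → own' e = own e)
    (hnew : ∀ e < M, own e = 0 → own' e = v →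
      Nat.count (fun e' => own e' = 0 ∧ U e' = U e) M < D + 1 ∧
      ∀ e' < M, own e' = 0 → U e' = U e → own' e' ≠ 0)
    (hrk : ∀ e < M, own e = 0 → rk' e = Nat.count (fun e' => own e' = 0 ∧ U e' = U e) e)
    (hrk' : ∀ e < M, own e ≠ 0 → rk' e = rk e) :
    ∀ e < M, own' e = v → rk' e < D ∧ (∀ e' < M, own' e' = 0 → U e' ≠ U e) ∧
      ∀ e' < M, own' e' = v → U e = U e' → rk' e = rk' e' → e = e' := by
  intro e he ho
  have hzero : ∀ e', own' e' = 0 → own e' = 0 := fun e' h' => by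
    by_contra h''; rw [hold e' h''] at h'; exact h'' h'
  by_cases h0 : own e = 0
  · obtain ⟨hn1, hn2⟩ := hnew e he h0 ho
    refine ⟨?_, ?_, ?_⟩
    · rw [hrk e he h0]
      have := count_lt_count (p := fun e' => own e' = 0 ∧ U e' = U e) he ⟨h0, rfl⟩
      omega
    · intro e' he' ho' hU
      exact hn2 e' he' (hzero e' ho') hU ho'
    · intro e' he' ho' hU hr
      by_cases h0' : own e' = 0
      · rw [hrk e he h0, hrk e' he' h0', ← hU] at hr
        exact Nat.count_injective (p := fun x => own x = 0 ∧ U x = U e) ⟨h0, rfl⟩ ⟨h0', hU.symm⟩ hr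
      · rw [hold e' h0'] at ho'
        exact absurd hU ((h e' he' ho').2.1 e he h0)
  · have ho1 := ho
    rw [hold e h0] at ho1
    obtain ⟨h1, h2, h3⟩ := h e he ho1
    refine ⟨by rwa [hrk' e he h0], fun e' he' ho' => h2 e' he' (hzero e' ho'), ?_⟩
    intro e' he' ho' hU hr
    by_cases h0' : own e' = 0
    · exact absurd hU.symm (h2 e' he' h0')
    · rw [hrk' e he h0, hrk' e' he' h0'] at hr
      rw [hold e' h0'] at ho'
      exact h3 e' he' ho' hU hr

theorem Oriented.step (h : Oriented D M live U V own rkL rkR)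
    (hL : ∀ e < M, own e = 0 → rkL' e = Nat.count (fun e' => own e' = 0 ∧ U e' = U e) e)
    (hL' : ∀ e < M, own e ≠ 0 → rkL' e = rkL e)
    (hR : ∀ e < M, own e = 0 → rkR' e = Nat.count (fun e' => own e' = 0 ∧ V e' = V e) e)
    (hR' : ∀ e < M, own e ≠ 0 → rkR' e = rkR e) :
    Oriented D M live U V (newOwn D M U V own) rkL' rkR' where
  absent e he := by
    rw [← h.absent e he]
    by_cases h0 : own e = 0
    · simp only [newOwn, h0, ne_eq, not_true_eq_false, if_false]
      split_ifs <;> simp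
    · simp [newOwn, h0]
  le e he := by
    have := h.le e he
    by_cases h0 : own e = 0
    · simp only [newOwn, h0, ne_eq, not_true_eq_false, if_false]
      split_ifs <;> omega
    · simpa [newOwn, h0] using this
  left := by
    refine Oriented.side h.left (fun e he => by simp [newOwn, he]) ?_ hL hL'
    intro e he h0 h1
    have hc : Nat.count (fun e' => own e' = 0 ∧ U e' = U e) M < D + 1 := by
      by_contra hc
      rw [newOwn, if_neg (by simpa using h0), if_neg hc] at h1
      split_ifs at h1 <;> omega
    refine ⟨hc, fun e' he' h0' hU => ?_⟩
    rw [newOwn, if_neg (by simpa using h0'), hU, if_pos hc]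
    exact one_ne_zero
  right := by
    refine Oriented.side h.right (fun e he => by simp [newOwn, he]) ?_ hR hR'
    intro e he h0 h1
    have hc : Nat.count (fun e' => own e' = 0 ∧ V e' = V e) M < D + 1 := by
      by_contra hc
      rw [newOwn, if_neg (by simpa using h0), if_neg hc] at h1
      split_ifs at h1 <;> omega
    refine ⟨hc, fun e' he' h0' hU => ?_⟩
    rw [newOwn, if_neg (by simpa using h0'), hU, if_pos hc]
    split_ifs <;> omega

/-- The edges without owner. -/
def ownerless (M : ℕ) (own : ℕ → ℕ) : Finset ℕ := (Finset.range M).filter fun e => own e = 0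

/-- Each value in the image is met by at least `D + 1` ownerless edges, and different values are met
by different edges. -/
theorem mul_card_image_le {D M : ℕ} {own U : ℕ → ℕ} {S : Finset ℕ} (hS : S ⊆ ownerless M own)
    (h : ∀ e ∈ S, D < Nat.count (fun e' => own e' = 0 ∧ U e' = U e) M) :
    (S.image U).card * (D + 1) ≤ (ownerless M own).card := by
  calc (S.image U).card * (D + 1) = ∑ x ∈ S.image U, (D + 1) := by
        rw [Finset.sum_const, smul_eq_mul]
    _ ≤ ∑ x ∈ S.image U, ((ownerless M own).filter fun e => U e = x).card := by
        refine Finset.sum_le_sum fun x hx => ?_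
        obtain ⟨e, he, rfl⟩ := Finset.mem_image.1 hx
        have := h e he
        rw [Nat.count_eq_card_filter_range] at this
        rw [ownerless, Finset.filter_filter]
        exact this
    _ ≤ (ownerless M own).card := by
        rw [Finset.card_eq_sum_card_image U (ownerless M own)]
        exact Finset.sum_le_sum_of_subset (Finset.image_subset_image hS)

/-- Half of the edges get an owner in each round. -/
theorem two_mul_ownerless_le {c : ℕ} (h : Oriented D M live U V own rkL rkR) (hD : 4 * c ≤ D)
    (hsp : ∀ S : Finset ℕ, (∀ e ∈ S, e < M ∧ live e) →
      S.card ≤ c * ((S.image U).card + (S.image V).card)) :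
    2 * (ownerless M (newOwn D M U V own)).card ≤ (ownerless M own).card := by
  set S := ownerless M (newOwn D M U V own) with hSdef
  have hmem : ∀ e ∈ S, e < M ∧ own e = 0 ∧
      D < Nat.count (fun e' => own e' = 0 ∧ U e' = U e) M ∧
      D < Nat.count (fun e' => own e' = 0 ∧ V e' = V e) M := by
    intro e he
    rw [hSdef, ownerless, Finset.mem_filter, Finset.mem_range] at he
    obtain ⟨he, h0⟩ := he
    rw [newOwn] at h0
    split_ifs at h0 with h1 h2 h3
    · exact absurd h0 h1
    · exact ⟨he, by simpa using h1, by omega, by omega⟩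
  have hsub : S ⊆ ownerless M own := by
    intro e he
    obtain ⟨h1, h2, _⟩ := hmem e he
    simp [ownerless, h1, h2]
  have a1 := mul_card_image_le hsub fun e he => (hmem e he).2.2.1
  have a2 := mul_card_image_le hsub fun e he => (hmem e he).2.2.2
  have a3 := hsp S fun e he => by
    obtain ⟨h1, h2, _⟩ := hmem e he
    refine ⟨h1, ?_⟩
    by_contra hl
    have := (h.absent e h1).2 hl
    omega
  -- With `a` and `b` the numbers of left and right ends of `S`: `4 * S.card ≤ 4 * c * (a + b) ≤ D *
  -- (a + b)`, which is at most twice the number of ownerless edges.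
  nlinarith [Nat.mul_le_mul_left (S.image U).card hD, Nat.mul_le_mul_left (S.image V).card hD]

end

/-- One round of the orientation at depth `d`. -/
def roundP (D d aU aV : ℕ) : Program :=
  .seq (countP (nm d 4) aU (nm d 0) (nm d 2))
  (.seq (countP (nm d 4) aV (nm d 1) (nm d 3))
  (.seq (mapP 1 (nm d 5) (iteE (.get (nm d 4) (.reg 3)) (.get (nm d 4) (.reg 3))
    (iteE (.op .lt (.get (nm d 0) (.get aU (.reg 3))) (.lit (D + 1))) (.lit 1)
      (iteE (.op .lt (.get (nm d 1) (.get aV (.reg 3))) (.lit (D + 1))) (.lit 2) (.lit 0)))))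
  (mapP 1 (nm d 4) (.get (nm d 5) (.reg 3)))))

/-- Registers below `3` and arrays of depth other than `d` are the same. -/
def KeepDepth (d : ℕ) (s s' : State) : Prop :=
  (∀ r < 3, s'.reg r = s.reg r) ∧ ∀ d' t, d' ≠ d → s'.arr (nm d' t) = s.arr (nm d' t)

theorem KeepDepth.trans {d : ℕ} {s s' s'' : State} (h : KeepDepth d s s') (h' : KeepDepth d s' s'') :
    KeepDepth d s s'' :=
  ⟨fun r hr => (h'.1 r hr).trans (h.1 r hr), fun d' t ht => (h'.2 d' t ht).trans (h.2 d' t ht)⟩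

/-- Both degree counts refer to the owners at the start of the round. The new owners pass through
the array with tag `5`, because `mapP` may not read the array it fills. -/
theorem run_roundP {B n M D d dU tU dV tV : ℕ} {s : State} {U V : ℕ → ℕ} (hs : Bdd B s)
    (hn : s.reg 0 = n) (hM : s.reg 1 = M) (hnB : n ≤ B) (hMB : M ≤ B)
    (hU : ∀ e < M, s.arr (nm dU tU) e = U e) (hUn : ∀ e < M, U e < n)
    (hV : ∀ e < M, s.arr (nm dV tV) e = V e) (hVn : ∀ e < M, V e < n)
    (hdU : dU ≠ d) (hdV : dV ≠ d) :
    Run B (roundP D d (nm dU tU) (nm dV tV)) s (500 * B) fun s' =>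
      (∀ r ≠ 3, s'.reg r = s.reg r) ∧ KeepDepth d s s' ∧
      (∀ e < M, s'.arr (nm d 4) e = newOwn D M U V (s.arr (nm d 4)) e) ∧
      (∀ e < M, s.arr (nm d 4) e = 0 →
        s'.arr (nm d 2) e = Nat.count (fun e' => s.arr (nm d 4) e' = 0 ∧ U e' = U e) e) ∧
      (∀ e < M, s.arr (nm d 4) e ≠ 0 → s'.arr (nm d 2) e = s.arr (nm d 2) e) ∧
      (∀ e < M, s.arr (nm d 4) e = 0 →
        s'.arr (nm d 3) e = Nat.count (fun e' => s.arr (nm d 4) e' = 0 ∧ V e' = V e) e) ∧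
      (∀ e < M, s.arr (nm d 4) e ≠ 0 → s'.arr (nm d 3) e = s.arr (nm d 3) e) := by
  have h2B := hs.two_le
  refine Run.mono (Run.seq hs (run_countP hs hn hM hnB hMB hU hUn (by simp) (by simp) (by simp [hdU])
    (by simp [hdU]) (by simp)) (t' := 400 * B) ?_) (by omega) (fun _ _ h => h)
  rintro s₁ hs₁ ⟨r1, a1, c1, k1, l1⟩
  have o1 : s₁.arr (nm d 4) = s.arr (nm d 4) := a1 _ (by simp) (by simp)
  refine Run.mono (Run.seq hs₁ (run_countP hs₁ (by rw [r1 0 (by norm_num), hn])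
    (by rw [r1 1 (by norm_num), hM]) hnB hMB (U := V)
    (fun e he => by rw [a1 _ (by simp [hdV]) (by simp [hdV]), hV e he]) hVn (by simp) (by simp)
    (by simp [hdV]) (by simp [hdV]) (by simp)) (t' := 300 * B) ?_) (by omega) (fun _ _ h => h)
  rintro s₂ hs₂ ⟨r2, a2, c2, k2, l2⟩
  have o2 : s₂.arr (nm d 4) = s.arr (nm d 4) := by rw [a2 _ (by simp) (by simp), o1]
  rw [o1] at c2 k2 l2
  have hev : ∀ e < M, (iteE (.get (nm d 4) (.reg 3)) (.get (nm d 4) (.reg 3))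
    (iteE (.op .lt (.get (nm d 0) (.get (nm dU tU) (.reg 3))) (.lit (D + 1))) (.lit 1)
      (iteE (.op .lt (.get (nm d 1) (.get (nm dV tV) (.reg 3))) (.lit (D + 1))) (.lit 2)
        (.lit 0)))).eval (s₂.setReg 3 e) = newOwn D M U V (s.arr (nm d 4)) e := by
    intro e he
    have q1 : s₂.arr (nm d 0) (s₂.arr (nm dU tU) e) =
        Nat.count (fun e' => s.arr (nm d 4) e' = 0 ∧ U e' = U e) M := by
      rw [a2 (nm dU tU) (by simp [hdU]) (by simp [hdU]), a1 (nm dU tU) (by simp [hdU])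
        (by simp [hdU]), hU e he, a2 _ (by simp) (by simp), c1 _ (hUn e he)]
    have q2 : s₂.arr (nm d 1) (s₂.arr (nm dV tV) e) =
        Nat.count (fun e' => s.arr (nm d 4) e' = 0 ∧ V e' = V e) M := by
      rw [a2 (nm dV tV) (by simp [hdV]) (by simp [hdV]), a1 (nm dV tV) (by simp [hdV])
        (by simp [hdV]), hV e he, c2 _ (hVn e he)]
    simp only [eval_iteE, Expr.eval, BinOp.eval, State.setReg_reg, State.setReg_arr, if_true, q1, q2,
      o2, newOwn]
    by_cases h0 : s.arr (nm d 4) e = 0 <;> simp [h0]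
  have hevB : ∀ e < M, newOwn D M U V (s.arr (nm d 4)) e ≤ B := by
    intro e he
    have := hs.arr (nm d 4) e
    rw [newOwn]
    split_ifs <;> omega
  refine Run.mono (Run.seq hs₂ (run_mapP hs₂ hMB (by norm_num)
    (by rw [r2 1 (by norm_num), r1 1 (by norm_num), hM])
    (avoids_iteE ⟨by simp, True.intro⟩ ⟨by simp, True.intro⟩ (avoids_iteE
      ⟨⟨by simp, by simp [hdU], True.intro⟩, True.intro⟩ True.intro (avoids_iteE
      ⟨⟨by simp, by simp [hdV], True.intro⟩, True.intro⟩ True.intro True.intro)))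
    (fun e he => by rw [hev e he]; exact hevB e he)) (t' := 100 * B) ?_)
    (by simp only [iteE, notE, Expr.cost]; omega) (fun _ _ h => h)
  rintro s₃ hs₃ rfl
  refine Run.mono (run_mapP hs₃ hMB (by norm_num)
    (by rw [State.put_reg _ _ _ _ (by norm_num), r2 1 (by norm_num), r1 1 (by norm_num), hM])
    ⟨by simp, True.intro⟩ (fun e he => hs₃.arr _ _)) (by simp only [Expr.cost]; omega) ?_
  rintro s₄ hs₄ rfl
  refine ⟨?_, ⟨?_, ?_⟩, ?_, ?_, ?_, ?_, ?_⟩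
  · intro r hr; rw [State.put_reg _ _ _ _ hr, State.put_reg _ _ _ _ hr, r2 r hr, r1 r hr]
  · intro r hr
    have hr : r ≠ 3 := by omega
    rw [State.put_reg _ _ _ _ hr, State.put_reg _ _ _ _ hr, r2 r hr, r1 r hr]
  · intro d' t hd
    rw [State.put_arr_ne _ _ _ (by simp [hd]), State.put_arr_ne _ _ _ (by simp [hd]),
      a2 _ (by simp [hd]) (by simp [hd]), a1 _ (by simp [hd]) (by simp [hd])]
  · intro e he
    rw [State.put_arr_same _ _ _ he]
    simp only [Expr.eval, State.setReg_reg, State.setReg_arr, if_true]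
    rw [State.put_arr_same _ _ _ he, hev e he]
  · intro e he h0
    rw [State.put_arr_ne _ _ _ (by simp), State.put_arr_ne _ _ _ (by simp),
      a2 _ (by simp) (by simp), k1 e he h0]
  · intro e he h0
    rw [State.put_arr_ne _ _ _ (by simp), State.put_arr_ne _ _ _ (by simp),
      a2 _ (by simp) (by simp), l1 e he h0]
  · intro e he h0
    rw [State.put_arr_ne _ _ _ (by simp), State.put_arr_ne _ _ _ (by simp), k2 e he h0]
  · intro e he h0
    rw [State.put_arr_ne _ _ _ (by simp), State.put_arr_ne _ _ _ (by simp), l2 e he h0,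
      a1 _ (by simp) (by simp)]

/-- Orient the bipartite graph with the edges `i < M` with `aL i ≠ 0` and ends `aU i` and `aV i`. -/
def peelP (D d aU aV aL : ℕ) : Program :=
  .seq (mapP 1 (nm d 4) (iteE (.get aL (.reg 3)) (.lit 0) (.lit 3)))
  (.seq (.assign 4 (.lit 1))
  (.seq (.loop (.op .lt (.reg 4) (.op .add (.reg 1) (.lit 1)))
    (.seq (roundP D d aU aV) (.assign 4 (.op .add (.reg 4) (.reg 4)))))
  (.seq (.assign 5 (.op .mul (.reg 0) (.lit D)))
  (.seq (scatterP D (nm d 4) 1 aU (nm d 2) (nm d 6))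
    (scatterP D (nm d 4) 2 aV (nm d 3) (nm d 7))))))

/-- The unit in which running times are measured. -/
def timeUnit (B : ℕ) : ℕ := B * (Nat.log 2 B + 2)

/-- Sparsity is assumed for all sets of live edges, hence holds for the ownerless ones in every
round. Each round takes `O(B)` time and halves their number, so logarithmically many rounds leave
none. -/
theorem run_peelP {B n M D c d dU tU dV tV dL tL : ℕ} {s : State} {U V : ℕ → ℕ} (hs : Bdd B s)
    (hn : s.reg 0 = n) (hM : s.reg 1 = M) (hnB : n * (D + 1) ≤ B) (hMB : 2 * M + 3 ≤ B)
    (hU : ∀ e < M, s.arr (nm dU tU) e = U e) (hUn : ∀ e < M, U e < n)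
    (hV : ∀ e < M, s.arr (nm dV tV) e = V e) (hVn : ∀ e < M, V e < n)
    (hdU : dU ≠ d) (hdV : dV ≠ d) (hdL : dL ≠ d) (hD : 4 * c ≤ D)
    (hsp : ∀ S : Finset ℕ, (∀ e ∈ S, e < M ∧ s.arr (nm dL tL) e ≠ 0) →
      S.card ≤ c * ((S.image U).card + (S.image V).card)) :
    Run B (peelP D d (nm dU tU) (nm dV tV) (nm dL tL)) s (1000 * timeUnit B) fun s' =>
      KeepDepth d s s' ∧
      (∀ e < M, s.arr (nm dL tL) e ≠ 0 →
        (∃ j < D, s'.arr (nm d 6) (U e * D + j) = e + 1) ∨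
        ∃ j < D, s'.arr (nm d 7) (V e * D + j) = e + 1) ∧
      (∀ x < n, ∀ j < D, ∀ e, s'.arr (nm d 6) (x * D + j) = e + 1 →
        e < M ∧ s.arr (nm dL tL) e ≠ 0 ∧ U e = x) ∧
      (∀ x < n, ∀ j < D, ∀ e, s'.arr (nm d 7) (x * D + j) = e + 1 →
        e < M ∧ s.arr (nm dL tL) e ≠ 0 ∧ V e = x) := by
  have h2B := hs.two_le
  have hnB' : n ≤ B := by nlinarith
  have hnDB : n * D ≤ B := by nlinarith
  have hlog : Nat.log 2 M + 2 ≤ Nat.log 2 B + 2 := by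
    have : Nat.log 2 M ≤ Nat.log 2 B := Nat.log_mono_right (by omega)
    omega
  have hBt : 2 * B ≤ timeUnit B := by unfold timeUnit; nlinarith
  set live : ℕ → Prop := fun e => s.arr (nm dL tL) e ≠ 0 with hlive
  refine Run.mono (Run.seq hs (run_mapP hs (by omega) (by norm_num) hM
    (avoids_iteE ⟨by simp [hdL], True.intro⟩ True.intro True.intro) (fun e he => by
      rw [eval_iteE]
      show (if _ then 0 else 3) ≤ B
      split_ifs
      exacts [Nat.zero_le _, by omega])) (t' := 900 * timeUnit B) ?_)
    (by simp only [iteE, notE, Expr.cost]; omega) (fun _ _ h => h)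
  rintro s₁ hs₁ e₁
  have own₁ : ∀ e < M, s₁.arr (nm d 4) e = if live e then 0 else 3 := by
    intro e he
    rw [e₁, State.put_arr_same _ _ _ he]
    simp only [eval_iteE, Expr.eval, State.setReg_reg, if_true, State.setReg_arr, hlive]
  have keep₁ : KeepDepth d s s₁ := by
    subst e₁
    exact ⟨fun r hr => State.put_reg _ _ _ _ (by omega), fun d' t hd =>
      State.put_arr_ne _ _ _ (by simp [hd])⟩
  refine Run.mono (Run.seq hs₁ (Run.assign hs₁ (Q := (· = s₁.setReg 4 1)) (by simp [Expr.eval]; omega)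
    rfl le_rfl) (t' := 800 * timeUnit B) ?_)
    (by simp only [Expr.cost]; omega) (fun _ _ h => h)
  rintro s₂ hs₂ e₂
  have hloop := Run.loop (B := B) (s := s₂) (t := 500 * B + 4)
    (c := .op .lt (.reg 4) (.op .add (.reg 1) (.lit 1)))
    (p := .seq (roundP D d (nm dU tU) (nm dV tV)) (.assign 4 (.op .add (.reg 4) (.reg 4))))
    -- Register `4` doubles in each round. Its product with the number of ownerless edges stays at
    -- most `M`, so none is left once it exceeds `M`; the bound with `2 ^ j` limits the rounds still
    -- to come.
    (fun j s' => KeepDepth d s s' ∧ M < 2 ^ j * s'.reg 4 ∧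
      Oriented D M live U V (s'.arr (nm d 4)) (s'.arr (nm d 2)) (s'.arr (nm d 3)) ∧
      s'.reg 4 * (ownerless M (s'.arr (nm d 4))).card ≤ M ∧ 1 ≤ s'.reg 4)
    (Nat.log 2 M + 1) hs₂ ?_ ?_ ?_
  rotate_left
  · subst e₂
    refine ⟨⟨fun r hr => ?_, fun d' t hd => keep₁.2 d' t hd⟩, ?_, ?_, ?_, ?_⟩
    · rw [State.setReg_reg, if_neg (by omega)]; exact keep₁.1 r hr
    · rw [State.setReg_reg, if_pos rfl, mul_one]
      exact Nat.lt_pow_succ_log_self (by norm_num) M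
    · refine ⟨?_, ?_, ?_, ?_⟩ <;> intro e he <;> rw [State.setReg_arr, own₁ e he] <;>
        by_cases h : live e <;> simp [h]
    · rw [State.setReg_reg, if_pos rfl, one_mul]
      exact (Finset.card_filter_le _ _).trans (by simp)
    · rw [State.setReg_reg, if_pos rfl]
  · rintro j s' ⟨k, h1, -⟩ hc rfl
    apply hc
    simp only [Expr.eval, BinOp.eval, k.1 1 (by norm_num), hM]
    rw [if_neg (by omega)]
  · rintro j s' hs' ⟨k, h1, h2, h3, h4⟩ hc
    have hp : s'.reg 4 ≤ M := by
      by_contra hlt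
      apply hc
      simp only [Expr.eval, BinOp.eval, k.1 1 (by norm_num), hM]
      rw [if_neg (by omega)]
    refine Run.seq hs' (run_roundP hs' (by rw [k.1 0 (by norm_num), hn])
      (by rw [k.1 1 (by norm_num), hM]) hnB' (by omega)
      (fun e he => by rw [k.2 _ _ hdU, hU e he]) hUn
      (fun e he => by rw [k.2 _ _ hdV, hV e he]) hVn hdU hdV) ?_
    rintro s'' hs'' ⟨r1, k1, o1, a1, a2, a3, a4⟩
    have e4 : s''.reg 4 = s'.reg 4 := r1 4 (by norm_num)
    refine Run.assign hs'' ?_ ?_ le_rfl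
    · simp only [Expr.eval, BinOp.eval, e4]; omega
    · have kk := k.trans k1
      have hor := h2.step a1 a2 a3 a4
      have hcard := two_mul_ownerless_le h2 hD hsp
      have hown : ownerless M (s''.arr (nm d 4)) =
          ownerless M (newOwn D M U V (s'.arr (nm d 4))) := by
        unfold ownerless
        exact Finset.filter_congr fun e he => by rw [o1 e (Finset.mem_range.1 he)]
      simp only [Expr.eval, BinOp.eval, e4]
      refine ⟨⟨fun r hr => ?_, fun d' t hd => kk.2 d' t hd⟩, ?_, ?_, ?_, ?_⟩
      · rw [State.setReg_reg, if_neg (by omega)]; exact kk.1 r hr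
      · rw [State.setReg_reg, if_pos rfl]
        rw [pow_succ] at h1
        linarith
      · rw [State.setReg_arr]
        refine ⟨fun e he => ?_, fun e he => ?_, fun e he => ?_, fun e he => ?_⟩
        · rw [o1 e he]; exact hor.absent e he
        · rw [o1 e he]; exact hor.le e he
        · rw [o1 e he]
          intro h
          obtain ⟨q1, q2, q3⟩ := hor.left e he h
          exact ⟨q1, fun e' he' h' => q2 e' he' (by rwa [o1 e' he'] at h'),
            fun e' he' h' => q3 e' he' (by rwa [o1 e' he'] at h')⟩
        · rw [o1 e he]
          intro h
          obtain ⟨q1, q2, q3⟩ := hor.right e he h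
          exact ⟨q1, fun e' he' h' => q2 e' he' (by rwa [o1 e' he'] at h'),
            fun e' he' h' => q3 e' he' (by rwa [o1 e' he'] at h')⟩
      · rw [State.setReg_reg, if_pos rfl, State.setReg_arr, hown]
        nlinarith
      · rw [State.setReg_reg, if_pos rfl]; omega
  refine Run.mono (Run.seq hs₂ hloop (t' := 200 * timeUnit B) ?_) ?_ (fun _ _ h => h)
  rotate_left
  · simp only [Expr.cost]
    have : (Nat.log 2 M + 1 + 1) * (3 + 1 + 1 + 1 + (500 * B + 4)) ≤ 600 * timeUnit B := by
      unfold timeUnit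
      calc _ ≤ (Nat.log 2 B + 2) * (600 * B) := Nat.mul_le_mul hlog (by omega)
        _ = _ := by ring
    refine le_trans (Nat.add_le_add_right (le_trans (Nat.mul_le_mul_left _ ?_) this) _) ?_ <;> omega
  rintro s₃ hs₃ ⟨hc, j, k, h1, h2, h3, h4⟩
  have hM3 : s₃.reg 1 = M := by rw [k.1 1 (by norm_num), hM]
  have hno : ∀ e < M, s₃.arr (nm d 4) e ≠ 0 := by
    have hp : M < s₃.reg 4 := by
      by_contra hlt
      simp only [Expr.eval, BinOp.eval, hM3] at hc
      rw [if_pos (by omega)] at hc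
      exact one_ne_zero hc
    intro e he h0
    have : 0 < (ownerless M (s₃.arr (nm d 4))).card := Finset.card_pos.2 ⟨e, by
      simp [ownerless, he, h0]⟩
    nlinarith
  refine Run.mono (Run.seq hs₃ (Run.assign hs₃ (Q := (· = s₃.setReg 5 (n * D))) ?_ ?_ le_rfl)
    (t' := 150 * timeUnit B) ?_) (by simp only [Expr.cost]; omega) (fun _ _ h => h)
  · simp only [Expr.eval, BinOp.eval, k.1 0 (by norm_num), hn]; exact hnDB
  · simp only [Expr.eval, BinOp.eval, k.1 0 (by norm_num), hn]
  rintro s₄ hs₄ e₄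
  have k4 : KeepDepth d s s₄ := by
    subst e₄
    refine ⟨fun r hr => ?_, fun d' t hd => k.2 d' t hd⟩
    rw [State.setReg_reg, if_neg (by omega)]; exact k.1 r hr
  have ea4 : s₄.arr = s₃.arr := by rw [e₄]; rfl
  refine Run.mono (Run.seq hs₄ (run_scatterP (n := n) hs₄ (by rw [e₄, State.setReg_reg, if_pos rfl])
    (by rw [k4.1 1 (by norm_num), hM]) hnDB (by omega) (U := U)
    (fun e he => by rw [k4.2 _ _ hdU, hU e he]) (by simp) (by simp [hdU]) (by simp)
    (fun e he h => by rw [ea4] at h ⊢; exact (h2.left e he h).1)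
    (fun e he e' he' h h' => by
      rw [ea4] at h h' ⊢; exact (h2.left e he h).2.2 e' he' h'))
    (t' := 100 * timeUnit B) ?_) (by omega) (fun _ _ h => h)
  rintro s₅ hs₅ ⟨r5, a5, b5, c5⟩
  rw [ea4] at b5 c5
  refine Run.mono (run_scatterP (n := n) hs₅ (by
      rw [r5 5 (by norm_num), e₄, State.setReg_reg, if_pos rfl])
    (by rw [r5 1 (by norm_num), k4.1 1 (by norm_num), hM]) hnDB (by omega) (U := V)
    (fun e he => by rw [a5 _ (by simp [hdV]), k4.2 _ _ hdV, hV e he])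
    (by simp) (by simp [hdV]) (by simp)
    (fun e he h => by
      rw [a5 _ (by simp), ea4] at h ⊢; exact (h2.right e he h).1)
    (fun e he e' he' h h' => by
      rw [a5 _ (by simp), ea4] at h h' ⊢; exact (h2.right e he h).2.2 e' he' h'))
    (by omega) ?_
  rintro s₆ hs₆ ⟨r6, a6, b6, c6⟩
  rw [a5 _ (by simp), ea4] at b6 c6
  have hl : ∀ e < M, s₃.arr (nm d 4) e ≠ 3 → live e := by
    exact fun e he h => not_not.1 fun hl => h ((h2.absent e he).2 hl)
  refine ⟨⟨fun r hr => ?_, fun d' t hd => ?_⟩, ?_, ?_, ?_⟩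
  · rw [r6 r (by omega), r5 r (by omega), k4.1 r hr]
  · rw [a6 _ (by simp [hd]), a5 _ (by simp [hd]), k4.2 d' t hd]
  · intro e he hle
    have q0 := hno e he
    have q1 := h2.le e he
    have q2 : s₃.arr (nm d 4) e ≠ 3 := fun h => (h2.absent e he).1 h hle
    rcases (by omega : s₃.arr (nm d 4) e = 1 ∨ s₃.arr (nm d 4) e = 2) with h | h
    · left
      rw [a6 _ (by simp)]
      exact b5 e he h
    · right
      exact b6 e he h
  · intro x hx j hj e he
    rw [a6 _ (by simp)] at he
    obtain ⟨q1, q2, q3⟩ := c5 x hx j hj e he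
    exact ⟨q1, hl e q1 (by omega), q3⟩
  · intro x hx j hj e he
    obtain ⟨q1, q2, q3⟩ := c6 x hx j hj e he
    exact ⟨q1, hl e q1 (by omega), q3⟩

/-! ### Leaders of groups of equal pairs -/

/-- Among the `i < M` with `aW i ≠ 0` find the first one for each pair of values of `nm 0 2` and
`aV`: its number is written to `nm d 1`, and `nm d 2` marks the numbers that are first. -/
def groupP (d aV aW : ℕ) : Program :=
  .seq (mapP 0 (nm d 0) (.lit 0))
    (forP 1 (.ite (.get aW (.reg 3))
      (.ite (allE [.get (nm d 0) (.get aV (.reg 3)),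
          eqE (.get (nm 0 2) (.op .sub (.get (nm d 0) (.get aV (.reg 3))) (.lit 1)))
            (.get (nm 0 2) (.reg 3))])
        (.seq (.store (nm d 1) (.reg 3) (.op .sub (.get (nm d 0) (.get aV (.reg 3))) (.lit 1)))
          (.store (nm d 2) (.reg 3) (.lit 0)))
        (.seq (.store (nm d 0) (.get aV (.reg 3)) (.op .add (.reg 3) (.lit 1)))
          (.seq (.store (nm d 1) (.reg 3) (.reg 3))
            (.store (nm d 2) (.reg 3) (.lit 1)))))
      (.store (nm d 2) (.reg 3) (.lit 0))))

/-- Invariant of the grouping loop. -/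
structure Grouped (n : ℕ) (X Z : ℕ → ℕ) (val : ℕ → Prop) (j : ℕ) (mk ld lv : ℕ → ℕ) : Prop where
  mark : ∀ z < n, ∀ m, mk z = m + 1 → m < j ∧ Z m = z ∧ lv m ≠ 0
  live : ∀ e < j, lv e ≠ 0 → val e ∧ e < mk (Z e)
  ldr : ∀ e < j, val e → ld e < j ∧ lv (ld e) ≠ 0 ∧ X (ld e) = X e ∧ Z (ld e) = Z e
  inj : ∀ e < j, ∀ e' < j, lv e ≠ 0 → lv e' ≠ 0 → X e = X e' → Z e = Z e' → e = e'

theorem Grouped.congr {n j : ℕ} {X Z mark ldr live mark' ldr' live' : ℕ → ℕ} {val : ℕ → Prop}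
    (h : Grouped n X Z val j mark ldr live) (h1 : ∀ z, mark' z = mark z)
    (h2 : ∀ e < j, ldr' e = ldr e) (h3 : ∀ e < j, live' e = live e) :
    Grouped n X Z val j mark' ldr' live' where
  mark z hz m hm := by
    rw [h1] at hm
    obtain ⟨a, b, c⟩ := h.mark z hz m hm
    exact ⟨a, b, by rwa [h3 m a]⟩
  live e he hl := by rw [h1]; rw [h3 e he] at hl; exact h.live e he hl
  ldr e he hv := by
    obtain ⟨a, b, c⟩ := h.ldr e he hv
    rw [h2 e he]
    exact ⟨a, by rwa [h3 _ a], c⟩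
  inj e he e' he' hl hl' := by
    rw [h3 e he] at hl
    rw [h3 e' he'] at hl'
    exact h.inj e he e' he' hl hl'

theorem Grouped.skip {n j : ℕ} {X Z mark ldr live : ℕ → ℕ} {val : ℕ → Prop}
    (h : Grouped n X Z val j mark ldr live) (hv : ¬ val j) (hl : live j = 0) :
    Grouped n X Z val (j + 1) mark ldr live where
  mark z hz m hm := by
    obtain ⟨a, b⟩ := h.mark z hz m hm
    exact ⟨by omega, b⟩
  live e he hle := by
    have : e ≠ j := by rintro rfl; exact hle hl
    exact h.live e (by omega) hle
  ldr e he hve := by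
    have : e ≠ j := by rintro rfl; exact hv hve
    obtain ⟨a, b⟩ := h.ldr e (by omega) hve
    exact ⟨by omega, b⟩
  inj e he e' he' hle hle' := by
    have : e ≠ j := by rintro rfl; exact hle hl
    have : e' ≠ j := by rintro rfl; exact hle' hl
    exact h.inj e (by omega) e' (by omega) hle hle'

theorem Grouped.join {n j m : ℕ} {X Z mark ldr live : ℕ → ℕ} {val : ℕ → Prop}
    (h : Grouped n X Z val j mark ldr live) (hl : live j = 0) (hZ : Z j < n)
    (hm : mark (Z j) = m + 1) (hX : X m = X j) (hld : ldr j = m) :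
    Grouped n X Z val (j + 1) mark ldr live where
  mark z hz m hm := by
    obtain ⟨a, b⟩ := h.mark z hz m hm
    exact ⟨by omega, b⟩
  live e he hle := by
    have : e ≠ j := by rintro rfl; exact hle hl
    exact h.live e (by omega) hle
  ldr e he hve := by
    by_cases hej : e = j
    · subst hej
      obtain ⟨a, b, c⟩ := h.mark _ hZ m hm
      rw [hld]
      exact ⟨by omega, c, hX, b⟩
    · obtain ⟨a, b⟩ := h.ldr e (by omega) hve
      exact ⟨by omega, b⟩
  inj e he e' he' hle hle' := by
    have : e ≠ j := by rintro rfl; exact hle hl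
    have : e' ≠ j := by rintro rfl; exact hle' hl
    exact h.inj e (by omega) e' (by omega) hle hle'

theorem Grouped.new {n j M : ℕ} {X Z mark mark' ldr live : ℕ → ℕ} {val : ℕ → Prop}
    (h : Grouped n X Z val j mark ldr live) (hj : j < M) (hl : live j ≠ 0) (hv : val j)
    (hZ : ∀ e < M, Z e < n) (hX : ∀ e e', e ≤ e' → e' < M → X e ≤ X e')
    (hm : ∀ m, mark (Z j) = m + 1 → X m ≠ X j) (hld : ldr j = j)
    (hmark : ∀ z, mark' z = if z = Z j then j + 1 else mark z) :
    Grouped n X Z val (j + 1) mark' ldr live := by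
  -- An earlier leader of the same pair comes no later than the marked leader `m` of `Z j`. As `X`
  -- is monotone, `X m` is squeezed between equal values, against `hm`.
  have key : ∀ e < j, live e ≠ 0 → X e = X j → Z e = Z j → False := by
    intro e he hle hXe hZe
    obtain ⟨_, h2⟩ := h.live e he hle
    rw [hZe] at h2
    obtain ⟨m, hm'⟩ := Nat.exists_eq_succ_of_ne_zero (by omega : mark (Z j) ≠ 0)
    obtain ⟨h3, _⟩ := h.mark _ (hZ j hj) m hm'
    have a := hX e m (by omega) (by omega)
    have b := hX m j (by omega) hj
    exact hm m hm' (by omega)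
  refine ⟨?_, ?_, ?_, ?_⟩
  · intro z hz m hm'
    rw [hmark] at hm'
    split_ifs at hm' with hz'
    · obtain rfl : j = m := by omega
      exact ⟨by omega, hz'.symm, hl⟩
    · obtain ⟨a, b⟩ := h.mark z hz m hm'
      exact ⟨by omega, b⟩
  · intro e he hle
    rw [hmark]
    by_cases hej : e = j
    · subst hej
      rw [if_pos rfl]
      exact ⟨hv, by omega⟩
    · obtain ⟨a, b⟩ := h.live e (by omega) hle
      refine ⟨a, ?_⟩
      split_ifs <;> omega
  · intro e he hve
    by_cases hej : e = j
    · subst hej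
      rw [hld]
      exact ⟨by omega, hl, rfl, rfl⟩
    · obtain ⟨a, b⟩ := h.ldr e (by omega) hve
      exact ⟨by omega, b⟩
  · intro e he e' he' hle hle' hXe hZe
    by_cases hej : e = j <;> by_cases hej' : e' = j
    · rw [hej, hej']
    · subst hej; exact (key e' (by omega) hle' hXe.symm hZe.symm).elim
    · subst hej'; exact (key e (by omega) hle hXe hZe).elim
    · exact h.inj e (by omega) e' (by omega) hle hle' hXe hZe

/-- The edges are sorted by first end, so for a fixed last vertex equal pairs are not interrupted by
other pairs. It is enough to remember the latest leader for each last vertex, and no sorting is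
needed. -/
theorem run_groupP {B n M d dV tV dW tW : ℕ} {s : State} {X Z : ℕ → ℕ} (hs : Bdd B s)
    (hn : s.reg 0 = n) (hM : s.reg 1 = M) (hnB : n ≤ B) (hMB : M ≤ B)
    (hX : ∀ e < M, s.arr (nm 0 2) e = X e) (hXm : ∀ e e', e ≤ e' → e' < M → X e ≤ X e')
    (hZ : ∀ e < M, s.arr (nm dV tV) e = Z e) (hZn : ∀ e < M, Z e < n)
    (h0 : d ≠ 0) (hdV : dV ≠ d) (hdW : dW ≠ d) :
    Run B (groupP d (nm dV tV) (nm dW tW)) s (200 * B) fun s' => KeepDepth d s s' ∧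
      (∀ e < M, s'.arr (nm d 2) e ≠ 0 → s.arr (nm dW tW) e ≠ 0) ∧
      (∀ e < M, s.arr (nm dW tW) e ≠ 0 → s'.arr (nm d 1) e < M ∧
        s'.arr (nm d 2) (s'.arr (nm d 1) e) ≠ 0 ∧
        X (s'.arr (nm d 1) e) = X e ∧ Z (s'.arr (nm d 1) e) = Z e) ∧
      (∀ e < M, ∀ e' < M, s'.arr (nm d 2) e ≠ 0 → s'.arr (nm d 2) e' ≠ 0 → X e = X e' →
        Z e = Z e' → e = e') := by
  have h2B := hs.two_le
  set val : ℕ → Prop := fun e => s.arr (nm dW tW) e ≠ 0 with hval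
  refine Run.mono (Run.seq hs (run_mapP hs hnB (by norm_num) hn True.intro
    (fun j _ => Nat.zero_le _)) (t' := 170 * B) (Q' := fun s' => s'.reg 3 = M ∧
      (KeepDepth d s s' ∧ Grouped n X Z val M (s'.arr (nm d 0)) (s'.arr (nm d 1))
        (s'.arr (nm d 2)))) ?_) (by simp only [Expr.cost]; omega) ?_
  · rintro s₁ hs₁ e₁
    refine Run.mono (run_forP (c := 60) (fun j s' => KeepDepth d s s' ∧
      Grouped n X Z val j (s'.arr (nm d 0)) (s'.arr (nm d 1)) (s'.arr (nm d 2)))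
      hs₁ hMB ?_ ?_ ?_) (by omega) (fun _ _ h => h)
    · subst e₁
      refine ⟨⟨fun r hr => ?_, fun d' t hd => ?_⟩, ?_⟩
      · rw [State.setReg_reg, if_neg (by omega), State.put_reg _ _ _ _ (by omega)]
      · rw [State.setReg_arr, State.put_arr_ne _ _ _ (by simp [hd])]
      · refine ⟨?_, fun e he => by omega, fun e he => by omega, fun e he => by omega⟩
        intro z hz m hm
        rw [State.setReg_arr, State.put_arr_same _ _ _ hz] at hm
        simp [Expr.eval] at hm
    · rintro j s' ⟨k, -⟩
      rw [k.1 1 (by norm_num), hM]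
    · rintro j hj s' hs' hr ⟨k, g⟩
      have hr' : ∀ r < 3, s'.reg r = s.reg r := k.1
      have eW : s'.arr (nm dW tW) j = s.arr (nm dW tW) j := by rw [k.2 _ _ hdW]
      have eZ : s'.arr (nm dV tV) j = Z j := by rw [k.2 _ _ hdV, hZ j hj]
      have eX : ∀ e < M, s'.arr (nm 0 2) e = X e := fun e he => by rw [k.2 _ _ h0.symm, hX e he]
      refine Run.ite hs' (t := 50) ?_ ?_ (by simp [Expr.cost])
      · intro hc
        have hv : val j := by
          simpa [Expr.eval, hr, eW] using hc
        refine Run.ite hs' (t := 20) ?_ ?_ (by simp [Expr.cost, allE, eqE])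
        · intro hc2
          rw [allE_ne_zero] at hc2
          simp only [List.mem_cons, List.not_mem_nil, or_false, forall_eq_or_imp, forall_eq,
            eqE_ne_zero] at hc2
          simp only [Expr.eval, BinOp.eval, hr, eZ] at hc2
          obtain ⟨m, hm⟩ := Nat.exists_eq_succ_of_ne_zero hc2.1
          have hmj := (g.mark _ (hZn j hj) m hm).1
          rw [hm, Nat.succ_eq_add_one, Nat.add_sub_cancel, eX m (by omega), eX j hj] at hc2
          refine Run.mono (Run.seq hs' (Run.store hs' (Q := (· = s'.setArr (nm d 1) j m)) ?_ ?_ le_rfl)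
            (t' := 10) (fun s'' hs'' e'' => Run.store hs'' (by simp [Expr.eval]) ?_
              (by simp [Expr.cost]))) (by simp [Expr.cost]) (fun _ _ h => h)
          · simp [Expr.eval, BinOp.eval, hr, eZ, hm]; omega
          · simp [Expr.eval, BinOp.eval, hr, eZ, hm]
          · subst e''
            simp only [Expr.eval, State.setArr_reg, hr]
            refine ⟨trivial, ⟨fun r hr3 => ?_, fun d' t hd => ?_⟩, ?_⟩
            · rw [State.setReg_reg, if_neg (by omega)]; exact k.1 r hr3
            · funext i
              simp [State.setArr_arr, hd, k.2 d' t hd]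
            · refine Grouped.join (m := m) (g.congr ?_ ?_ ?_) ?_ (hZn j hj) ?_ hc2.2 ?_
              · intro z; simp [State.setArr_arr]
              · intro e he; simp [State.setArr_arr, he.ne]
              · intro e he; simp [State.setArr_arr, he.ne]
              · simp [State.setArr_arr]
              · simp [State.setArr_arr, hm]
              · simp [State.setArr_arr]
        · intro hc2
          have hc3 : ∀ m, s'.arr (nm d 0) (Z j) = m + 1 → X m ≠ X j := by
            intro m hm hXm'
            have hmj := (g.mark _ (hZn j hj) m hm).1
            refine (allE_ne_zero (s := s')).2 ?_ hc2
            simp only [List.mem_cons, List.not_mem_nil, or_false, forall_eq_or_imp, forall_eq,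
              eqE_ne_zero]
            simp only [Expr.eval, BinOp.eval, hr, eZ, hm, Nat.add_sub_cancel]
            exact ⟨by omega, by rw [eX m (by omega), eX j hj, hXm']⟩
          refine Run.mono (Run.seq hs' (Run.store hs' (Q := (· = s'.setArr (nm d 0) (Z j) (j + 1)))
            ?_ ?_ le_rfl) (t' := 10) (fun s'' hs'' e'' => Run.mono (Run.seq hs'' (Run.store hs''
              (Q := (· = s''.setArr (nm d 1) j j)) ?_ ?_ le_rfl) (t' := 5)
              (fun s₃ hs₃ e₃ => Run.store hs₃ (by simp [Expr.eval]; omega) ?_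
              (by simp [Expr.cost]))) (by simp [Expr.cost]) (fun _ _ h => h)))
            (by simp [Expr.cost]) (fun _ _ h => h)
          · simp [Expr.eval, BinOp.eval, hr]; omega
          · simp [Expr.eval, BinOp.eval, hr, eZ]
          · subst e''; simp [Expr.eval, hr]; omega
          · subst e''; simp [Expr.eval, hr]
          · subst e₃ e''
            simp only [Expr.eval, State.setArr_reg, hr]
            refine ⟨trivial, ⟨fun r hr3 => ?_, fun d' t hd => ?_⟩, ?_⟩
            · rw [State.setReg_reg, if_neg (by omega)]; exact k.1 r hr3
            · funext i
              simp [State.setArr_arr, hd, k.2 d' t hd]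
            · refine Grouped.new (mark := s'.arr (nm d 0)) (M := M) (g.congr ?_ ?_ ?_) hj ?_ hv hZn
                hXm hc3 ?_ ?_
              · intro z; rfl
              · intro e he; simp [State.setArr_arr, he.ne]
              · intro e he; simp [State.setArr_arr, he.ne]
              · simp [State.setArr_arr]
              · simp [State.setArr_arr]
              · intro z; simp [State.setArr_arr]
      · intro hc
        have hv : ¬ val j := by
          simpa [Expr.eval, hr, eW, hval] using hc
        refine Run.store hs' (by simp [Expr.eval]) ?_ (by simp [Expr.cost])
        simp only [Expr.eval, State.setArr_reg, hr]
        refine ⟨trivial, ⟨fun r hr3 => ?_, fun d' t hd => ?_⟩, ?_⟩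
        · rw [State.setReg_reg, if_neg (by omega)]; exact k.1 r hr3
        · funext i
          simp [State.setArr_arr, hd, k.2 d' t hd]
        · refine Grouped.skip (g.congr ?_ ?_ ?_) hv ?_
          · intro z; simp [State.setArr_arr]
          · intro e he; simp [State.setArr_arr]
          · intro e he; simp [State.setArr_arr, he.ne]
          · simp [State.setArr_arr]
  · rintro s' hs' ⟨_, k, g⟩
    refine ⟨k, fun e he hl => (g.live e he hl).1, g.ldr, g.inj⟩

/-! ### The search: prolonging segments, rerouting cycles, branching on conflicts. -/

/-! ### Induced cycles as sequences of vertices -/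

/-- `i` and `j` are consecutive on the cycle `0, …, k - 1`. -/
def CycAdj (k i j : ℕ) : Prop := j = i + 1 ∨ i = j + 1 ∨ (i = 0 ∧ j + 1 = k) ∨ (j = 0 ∧ i + 1 = k)

instance (k i j : ℕ) : Decidable (CycAdj k i j) := by unfold CycAdj; infer_instance

/-- `u` and `v` can be the vertices number `i` and `j` of an induced cycle of size `k`. -/
def Fit (adj : ℕ → ℕ → Prop) (k i j u v : ℕ) : Prop := u ≠ v ∧ (adj u v ↔ CycAdj k i j)

/-- `q 0, …, q (k - 1)` is an induced cycle. -/
def IsCyc (adj : ℕ → ℕ → Prop) (k : ℕ) (q : ℕ → ℕ) : Prop :=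
  ∀ i < k, ∀ j < k, i ≠ j → Fit adj k i j (q i) (q j)

/-- `q 0, …, q (L - 1)` can be the beginning of an induced cycle of size `k`. -/
def IsSeg (adj : ℕ → ℕ → Prop) (k L : ℕ) (q : ℕ → ℕ) : Prop :=
  ∀ j < L, ∀ i < j, Fit adj k i j (q i) (q j)

section
variable {adj : ℕ → ℕ → Prop} {k L : ℕ} {q c : ℕ → ℕ}

theorem CycAdj.symm {i j : ℕ} : CycAdj k i j ↔ CycAdj k j i := by
  unfold CycAdj; tauto

theorem Fit.symm (hs : ∀ u v, adj u v → adj v u) {i j u v : ℕ} (h : Fit adj k i j u v) :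
    Fit adj k j i v u :=
  ⟨h.1.symm, by rw [CycAdj.symm, ← h.2]; exact ⟨hs _ _, hs _ _⟩⟩

theorem IsCyc.comp (h : IsCyc adj k q) (σ : ℕ → ℕ) (hσ : ∀ i < k, σ i < k)
    (hinj : ∀ i < k, ∀ j < k, i ≠ j → σ i ≠ σ j)
    (hc : ∀ i < k, ∀ j < k, i ≠ j → (CycAdj k (σ i) (σ j) ↔ CycAdj k i j)) :
    IsCyc adj k (fun i => q (σ i)) := by
  intro i hi j hj hij
  obtain ⟨h1, h2⟩ := h _ (hσ i hi) _ (hσ j hj) (hinj i hi j hj hij)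
  exact ⟨h1, h2.trans (hc i hi j hj hij)⟩

/-- Corresponds to prolonging a path at its first vertex: the predecessor of `q 0` on the cycle
comes to the front. -/
theorem IsCyc.rotate (h : IsCyc adj k q) : IsCyc adj k (consPath (q (k - 1)) q) := by
  have := h.comp (fun i => if i = 0 then k - 1 else i - 1) (fun i hi => by split_ifs <;> omega)
    (fun i hi j hj hij => by split_ifs <;> omega)
    (fun i hi j hj hij => by unfold CycAdj; split_ifs <;> omega)
  intro i hi j hj hij
  have h' := this i hi j hj hij
  simp only [consPath]
  split_ifs <;> simp_all

/-- The cycle is read backwards from `q (L - 1)`, so its initial segment is reversed in place. This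
matches paths that are stored from their other end. -/
theorem IsCyc.reverse (h : IsCyc adj k q) (hL : L ≤ k) :
    IsCyc adj k (fun i => if i < L then q (L - 1 - i) else q (k - 1 + L - i)) := by
  have := h.comp (fun i => if i < L then L - 1 - i else k - 1 + L - i)
    (fun i hi => by split_ifs <;> omega)
    (fun i hi j hj hij => by split_ifs <;> omega)
    (fun i hi j hj hij => by unfold CycAdj; split_ifs <;> omega)
  intro i hi j hj hij
  have h' := this i hi j hj hij
  dsimp only at h' ⊢
  rwa [apply_ite q, apply_ite q] at h'

theorem IsCyc.isSeg (h : IsCyc adj k q) (hL : L ≤ k) (hc : ∀ i < L, q i = c i) :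
    IsSeg adj k L c := by
  intro j hj i hi
  rw [← hc i (by omega), ← hc j hj]
  exact h i (by omega) j (by omega) (by omega)

theorem IsSeg.isCyc (hs : ∀ u v, adj u v → adj v u) (h : IsSeg adj k k q) : IsCyc adj k q := by
  intro i hi j hj hij
  rcases Nat.lt_or_gt_of_ne hij with hlt | hlt
  · exact h j hj i hlt
  · exact (h i hi j hlt).symm hs

/-- Replace a segment of an induced cycle. -/
theorem IsCyc.replace (hs : ∀ u v, adj u v → adj v u) (h : IsCyc adj k q)
    (hseg : IsSeg adj k L c) (h0 : c 0 = q 0) (hL : c (L - 1) = q (L - 1))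
    (hin : ∀ i, 0 < i → i + 1 < L → ∀ j < k, L ≤ j → c i ≠ q j ∧ ¬ adj (c i) (q j)) :
    IsCyc adj k (fun i => if i < L then c i else q i) := by
  have key : ∀ i < L, ∀ j < k, L ≤ j → Fit adj k i j (c i) (q j) := by
    intro i hi j hj hLj
    by_cases hi0 : i = 0
    · subst hi0; rw [h0]; exact h _ (by omega) _ hj (by omega)
    by_cases hiL : i = L - 1
    · rw [hiL, hL]; exact h _ (by omega) _ hj (by omega)
    obtain ⟨h1, h2⟩ := hin i (by omega) (by omega) j hj hLj
    -- An inner position of the segment is consecutive to no position from `L` on, not even across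
    -- the wrap-around.
    refine ⟨h1, iff_of_false h2 ?_⟩
    unfold CycAdj; omega
  intro i hi j hj hij
  dsimp only
  split_ifs with h1 h2 h2
  · rcases Nat.lt_or_gt_of_ne hij with hlt | hlt
    · exact hseg j h2 i hlt
    · exact (hseg i h1 j hlt).symm hs
  · exact key i h1 j hj (by omega)
  · exact (key j h2 i hi (by omega)).symm hs
  · exact h i hi j hj hij

end

/-! ### Instances -/

/-- The list of all ordered pairs of adjacent vertices, sorted by the first vertex. -/
structure EdgeList (adj : ℕ → ℕ → Prop) (n M : ℕ) (X Y : ℕ → ℕ) : Prop where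
  symm : ∀ u v, adj u v → adj v u
  irrefl : ∀ u, ¬ adj u u
  lt : ∀ e < M, X e < n ∧ Y e < n
  edge : ∀ e < M, adj (X e) (Y e)
  surj : ∀ u v, adj u v → ∃ e < M, X e = u ∧ Y e = v
  mono : ∀ e e', e ≤ e' → e' < M → X e ≤ X e'
  inj : ∀ e < M, ∀ e' < M, X e = X e' → Y e = Y e' → e = e'

/-- Adjacency is expressed by `T` functions. -/
structure OutNb (adj : ℕ → ℕ → Prop) (n T : ℕ) (NB : ℕ → ℕ → ℕ) : Prop where
  lt : ∀ t < T, ∀ v < n, NB t v < n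
  adj_iff : ∀ u < n, ∀ v < n, adj u v ↔ u ≠ v ∧ ∃ t < T, NB t u = v ∨ NB t v = u

/-- The density of the graphs that are oriented. -/
def density (k m : ℕ) : ℕ := k ^ k * 2 ^ m

/-- An input of the search. -/
structure Inst (k m D T B n M : ℕ) (adj : ℕ → ℕ → Prop) (X Y : ℕ → ℕ) (NB : ℕ → ℕ → ℕ) : Prop where
  edges : EdgeList adj n M X Y
  nb : OutNb adj n T NB
  noModel : ¬ KModel adj m {v | v < n}
  degree : 4 * density k m ≤ D
  n_le : n * (D + 1) ≤ B
  M_le : 2 * M + 3 ≤ B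

/-- The memory describes the input. -/
structure Env (T n M : ℕ) (X Y : ℕ → ℕ) (NB : ℕ → ℕ → ℕ) (s : State) : Prop where
  reg0 : s.reg 0 = n
  reg1 : s.reg 1 = M
  src : ∀ e < M, s.arr (nm 0 2) e = X e
  tgt : ∀ e < M, s.arr (nm 0 1) e = Y e
  nb : ∀ t < T, ∀ v < n, s.arr (nm 0 (4 + t)) v = NB t v

/-- Arrays of depth at most `d` are the same, apart from the output array. -/
def KeepBelow (d : ℕ) (s s' : State) : Prop :=
  (∀ r < 2, s'.reg r = s.reg r) ∧
    ∀ d' ≤ d, ∀ t, ¬ (d' = 0 ∧ t = 3) → s'.arr (nm d' t) = s.arr (nm d' t)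

theorem KeepBelow.refl (d : ℕ) (s : State) : KeepBelow d s s := ⟨fun _ _ => rfl, fun _ _ _ _ => rfl⟩

theorem KeepBelow.trans {d : ℕ} {s s' s'' : State} (h : KeepBelow d s s') (h' : KeepBelow d s' s'') :
    KeepBelow d s s'' :=
  ⟨fun r hr => (h'.1 r hr).trans (h.1 r hr),
    fun d' hd t ht => (h'.2 d' hd t ht).trans (h.2 d' hd t ht)⟩

theorem KeepBelow.le {d d' : ℕ} {s s' : State} (h : KeepBelow d s s') (hd : d' ≤ d) :
    KeepBelow d' s s' := ⟨h.1, fun d'' hd' => h.2 d'' (hd'.trans hd)⟩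

/-- Depths act as a stack: what is computed at one depth leaves the arrays of all smaller depths
intact for the enclosing levels of the search. -/
theorem KeepDepth.keepBelow {d d' : ℕ} {s s' : State} (h : KeepDepth d s s') (hd : d' < d) :
    KeepBelow d' s s' := ⟨fun r hr => h.1 r (by omega), fun d'' hd' t _ => h.2 d'' t (by omega)⟩

theorem Env.keep {T n M d : ℕ} {X Y : ℕ → ℕ} {NB : ℕ → ℕ → ℕ} {s s' : State}
    (h : Env T n M X Y NB s) (hk : KeepBelow d s s') : Env T n M X Y NB s' where
  reg0 := by rw [hk.1 0 (by norm_num), h.reg0]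
  reg1 := by rw [hk.1 1 (by norm_num), h.reg1]
  src e he := by rw [hk.2 0 (Nat.zero_le _) _ (by simp), h.src e he]
  tgt e he := by rw [hk.2 0 (Nat.zero_le _) _ (by simp), h.tgt e he]
  nb t ht v hv := by rw [hk.2 0 (Nat.zero_le _) _ (by simp; omega), h.nb t ht v hv]

/-- Register `2` tells whether the output array holds an induced cycle. -/
def FoundInv (adj : ℕ → ℕ → Prop) (k n : ℕ) (s : State) : Prop :=
  s.reg 2 = 0 ∨ (s.reg 2 = 1 ∧ IsCyc adj k (s.arr (nm 0 3)) ∧ ∀ i < k, s.arr (nm 0 3) i < n)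

/-- What all parts of the search guarantee. -/
structure Progress (adj : ℕ → ℕ → Prop) (k n d : ℕ) (s s' : State) : Prop where
  keep : KeepBelow d s s'
  inv : FoundInv adj k n s'
  found : s.reg 2 ≠ 0 → s'.reg 2 ≠ 0

theorem Progress.refl {adj : ℕ → ℕ → Prop} {k n : ℕ} (d : ℕ) {s : State} (h : FoundInv adj k n s) :
    Progress adj k n d s s := ⟨.refl _ _, h, id⟩

theorem Progress.trans {adj : ℕ → ℕ → Prop} {k n d : ℕ} {s s' s'' : State}
    (h : Progress adj k n d s s') (h' : Progress adj k n d s' s'') : Progress adj k n d s s'' :=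
  ⟨h.keep.trans h'.keep, h'.inv, fun hf => h'.found (h.found hf)⟩

theorem Progress.le {adj : ℕ → ℕ → Prop} {k n d d' : ℕ} {s s' : State}
    (h : Progress adj k n d s s') (hd : d' ≤ d) : Progress adj k n d' s s' :=
  ⟨h.keep.le hd, h.inv, h.found⟩

theorem KeepDepth.progress {adj : ℕ → ℕ → Prop} {k n d d' : ℕ} {s s' : State}
    (h : KeepDepth d s s') (hd : d' < d) (hf : FoundInv adj k n s) : Progress adj k n d' s s' := by
  refine ⟨h.keepBelow hd, ?_, fun hf => by rwa [h.1 2 (by norm_num)]⟩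
  unfold FoundInv
  rwa [h.1 2 (by norm_num), h.2 0 3 (by omega)]

/-- The domain of the paths stored at depth `d`. -/
def pathDf (n d : ℕ) (s : State) (v : ℕ) : Prop := v < n ∧ s.arr (nm d 9) v ≠ 0

/-- The paths stored at depth `d`. -/
def pathPt (d : ℕ) (s : State) (v i : ℕ) : ℕ := s.arr (nm d (10 + i)) v

theorem KeepBelow.paths {n d d' : ℕ} {s s' : State} (h : KeepBelow d s s') (hd : d' ≤ d) :
    pathDf n d' s' = pathDf n d' s ∧ pathPt d' s' = pathPt d' s := by
  constructor
  · funext v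
    rw [pathDf, pathDf, h.2 d' hd _ (by simp)]
  · funext v i
    rw [pathPt, pathPt, h.2 d' hd _ (by omega)]

/-! ### Expressions for candidates -/

/-- Vertex number `i` of the prolongation by the edge `ie` of the path at its second end. -/
def candE (pd : ℕ) (ie : Expr) (i : ℕ) : Expr :=
  if i = 0 then .get (nm 0 2) ie else .get (nm pd (10 + (i - 1))) (.get (nm 0 1) ie)

theorem eval_candE {T n M : ℕ} {X Y : ℕ → ℕ} {NB : ℕ → ℕ → ℕ} {s s' : State}
    (h : Env T n M X Y NB s) (hs' : s'.arr = s.arr) (pd : ℕ) (ie : Expr) {e : ℕ}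
    (he : ie.eval s' = e) (heM : e < M) (i : ℕ) :
    (candE pd ie i).eval s' = consPath (X e) (pathPt pd s (Y e)) i := by
  unfold candE consPath
  split_ifs with hi
  · simp only [Expr.eval, he, hs', h.src e heM]
  · simp only [Expr.eval, he, hs', h.tgt e heM, pathPt]

theorem avoids_candE {pd a : ℕ} {ie : Expr} (h : ie.avoids a) (h0 : a.unpair.1 ≠ 0)
    (hp : a.unpair.1 ≠ pd) (i : ℕ) : (candE pd ie i).avoids a := by
  have h1 : ∀ d t, d ≠ a.unpair.1 → nm d t ≠ a := by
    rintro d t hd rfl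
    simp [nm] at hd
  unfold candE
  split_ifs
  · exact ⟨h1 _ _ h0.symm, h⟩
  · exact ⟨h1 _ _ hp.symm, h1 _ _ h0.symm, h⟩

/-- The values of `u` and `v` are adjacent, provided that they are distinct. -/
def adjE (T : ℕ) (u v : Expr) : Expr :=
  anyE ((List.range T).flatMap fun t =>
    [eqE (.get (nm 0 (4 + t)) u) v, eqE (.get (nm 0 (4 + t)) v) u])

def fitE (k T i j : ℕ) (u v : Expr) : Expr :=
  allE [notE (eqE u v), if CycAdj k i j then adjE T u v else notE (adjE T u v)]

/-- Adjacency is tested in constant time by looking up the out-neighbours in both directions. The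
test is meaningful only for distinct vertices, so distinctness is a separate condition. -/
theorem eval_fitE {adj : ℕ → ℕ → Prop} {T n M : ℕ} {X Y : ℕ → ℕ} {NB : ℕ → ℕ → ℕ} {s s' : State}
    (h : Env T n M X Y NB s) (hs' : s'.arr = s.arr) (hnb : OutNb adj n T NB) (k i j : ℕ)
    {u v : Expr} (hu : u.eval s' < n) (hv : v.eval s' < n) :
    (fitE k T i j u v).eval s' ≠ 0 ↔ Fit adj k i j (u.eval s') (v.eval s') := by
  have hadj : (adjE T u v).eval s' ≠ 0 ↔
      ∃ t < T, NB t (u.eval s') = v.eval s' ∨ NB t (v.eval s') = u.eval s' := by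
    rw [adjE, anyE_ne_zero]
    simp only [List.mem_flatMap, List.mem_range, List.mem_cons, List.not_mem_nil, or_false]
    constructor
    · rintro ⟨e, ⟨t, ht, (rfl | rfl)⟩, he⟩ <;> rw [eqE_ne_zero] at he <;>
        simp only [Expr.eval, hs'] at he
      · rw [h.nb t ht _ hu] at he; exact ⟨t, ht, Or.inl he⟩
      · rw [h.nb t ht _ hv] at he; exact ⟨t, ht, Or.inr he⟩
    · rintro ⟨t, ht, (he | he)⟩
      · refine ⟨_, ⟨t, ht, Or.inl rfl⟩, ?_⟩
        rw [eqE_ne_zero]; simp only [Expr.eval, hs']; rw [h.nb t ht _ hu, he]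
      · refine ⟨_, ⟨t, ht, Or.inr rfl⟩, ?_⟩
        rw [eqE_ne_zero]; simp only [Expr.eval, hs']; rw [h.nb t ht _ hv, he]
  rw [fitE, allE_ne_zero]
  simp only [List.mem_cons, List.not_mem_nil, or_false, forall_eq_or_imp, forall_eq]
  have hne : (notE (eqE u v)).eval s' ≠ 0 ↔ u.eval s' ≠ v.eval s' := by
    rw [notE_ne_zero, ← not_iff_not, ← ne_eq, eqE_ne_zero, ne_eq, not_not]
  rw [hne, Fit, hnb.adj_iff _ hu _ hv]
  refine and_congr_right fun huv => ?_
  split_ifs with hc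
  · rw [hadj]; simp [huv, hc]
  · have h0 : (adjE T u v).eval s' = 0 ↔
        ¬ ∃ t < T, NB t (u.eval s') = v.eval s' ∨ NB t (v.eval s') = u.eval s' := by
      rw [← hadj]; exact not_ne_iff.symm
    rw [notE_ne_zero, h0]
    exact ⟨fun hE => iff_of_false (fun h => hE h.2) hc, fun hi hE => hc (hi.1 ⟨huv, hE⟩)⟩

theorem avoids_adjE {a T : ℕ} {u v : Expr} (hu : u.avoids a) (hv : v.avoids a)
    (h0 : a.unpair.1 ≠ 0) : (adjE T u v).avoids a := by
  have h1 : ∀ d t, d ≠ a.unpair.1 → nm d t ≠ a := by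
    rintro d t hd rfl
    simp [nm] at hd
  refine avoids_anyE fun e he => ?_
  simp only [List.mem_flatMap, List.mem_range, List.mem_cons, List.not_mem_nil, or_false] at he
  obtain ⟨t, ht, (rfl | rfl)⟩ := he
  · exact avoids_eqE ⟨h1 _ _ h0.symm, hu⟩ hv
  · exact avoids_eqE ⟨h1 _ _ h0.symm, hv⟩ hu

theorem avoids_fitE {a k T i j : ℕ} {u v : Expr} (hu : u.avoids a) (hv : v.avoids a)
    (h0 : a.unpair.1 ≠ 0) : (fitE k T i j u v).avoids a := by
  refine avoids_allE fun e he => ?_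
  simp only [List.mem_cons, List.not_mem_nil, or_false] at he
  rcases he with rfl | rfl
  · exact avoids_notE (avoids_eqE hu hv)
  · split_ifs
    · exact avoids_adjE hu hv h0
    · exact avoids_notE (avoids_adjE hu hv h0)

/-- The prolongation by the edge in the counter is a segment of length `L + 1`. -/
def validE (k T L pd : ℕ) : Expr :=
  allE (.get (nm pd 9) (.get (nm 0 1) (.reg 3)) ::
    (List.range (L + 1)).flatMap fun j => (List.range j).map fun i =>
      fitE k T i j (candE pd (.reg 3) i) (candE pd (.reg 3) j))

theorem avoids_validE {a k T L pd : ℕ} (h0 : a.unpair.1 ≠ 0) (hp : a.unpair.1 ≠ pd) :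
    (validE k T L pd).avoids a := by
  have h1 : ∀ d t, d ≠ a.unpair.1 → nm d t ≠ a := by
    rintro d t hd rfl
    simp [nm] at hd
  refine avoids_allE fun e he => ?_
  simp only [List.mem_cons, List.mem_flatMap, List.mem_range, List.mem_map] at he
  rcases he with rfl | ⟨j, hj, i, hi, rfl⟩
  · exact ⟨h1 _ _ hp.symm, h1 _ _ h0.symm, True.intro⟩
  · exact avoids_fitE (avoids_candE (ie := .reg 3) True.intro h0 hp _)
      (avoids_candE (ie := .reg 3) True.intro h0 hp _) h0

theorem eval_validE {k m D T B n M L pd : ℕ} {adj : ℕ → ℕ → Prop} {X Y : ℕ → ℕ} {NB : ℕ → ℕ → ℕ}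
    (hi : Inst k m D T B n M adj X Y NB) {s : State} (h : Env T n M X Y NB s)
    (hp : PathFam adj n L (pathDf n pd s) (pathPt pd s)) {e : ℕ} (he : e < M) {s' : State}
    (hs' : s'.arr = s.arr) (hr : s'.reg 3 = e) :
    (validE k T L pd).eval s' ≠ 0 ↔ pathDf n pd s (Y e) ∧
      IsSeg adj k (L + 1) (consPath (X e) (pathPt pd s (Y e))) := by
  rw [validE, allE_ne_zero]
  simp only [List.mem_cons, List.mem_flatMap, List.mem_range, List.mem_map, forall_eq_or_imp]
  have h1 : (Expr.get (nm pd 9) (.get (nm 0 1) (.reg 3))).eval s' ≠ 0 ↔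
      pathDf n pd s (Y e) := by
    simp only [Expr.eval, hr, hs', h.tgt e he, pathDf, (hi.edges.lt e he).2, true_and]
  rw [h1]
  refine and_congr_right fun hdf => ?_
  have hlt : ∀ i < L + 1, consPath (X e) (pathPt pd s (Y e)) i < n := by
    intro i hi'
    cases i with
    | zero => exact (hi.edges.lt e he).1
    | succ i => exact hp.lt _ hdf i (by omega)
  have hc := fun i => eval_candE h hs' pd (.reg 3) (e := e) (by simp [Expr.eval, hr]) he i
  constructor
  · intro hall j hj i hij
    have := hall _ ⟨j, hj, i, hij, rfl⟩
    rw [eval_fitE h hs' hi.nb _ _ _ (by rw [hc]; exact hlt i (by omega))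
      (by rw [hc]; exact hlt j hj), hc, hc] at this
    exact this
  · rintro hseg _ ⟨j, hj, i, hij, rfl⟩
    rw [eval_fitE h hs' hi.nb _ _ _ (by rw [hc]; exact hlt i (by omega))
      (by rw [hc]; exact hlt j hj), hc, hc]
    exact hseg j hj i hij

/-! ### Conflicts between a segment and the rest of a cycle -/

/-- The elements by which the inner vertices of a prolonged path can conflict with other
vertices. -/
def elems (n T L : ℕ) (NB : ℕ → ℕ → ℕ) (p : ℕ → ℕ) : List ℕ :=
  (List.range (L - 1)).flatMap fun i => (n + p i) :: p i :: (List.range T).map fun t => NB t (p i)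

def elemsE (T L pd : ℕ) (ie : Expr) : List Expr :=
  (List.range (L - 1)).flatMap fun i =>
    .op .add (.reg 0) (.get (nm pd (10 + i)) (.get (nm 0 1) ie)) ::
    .get (nm pd (10 + i)) (.get (nm 0 1) ie) ::
    (List.range T).map fun t => .get (nm 0 (4 + t)) (.get (nm pd (10 + i)) (.get (nm 0 1) ie))

theorem eval_elemsE {T n M L pd : ℕ} {X Y : ℕ → ℕ} {NB : ℕ → ℕ → ℕ} {s s' : State}
    (h : Env T n M X Y NB s) (hs' : s'.arr = s.arr) (hr : s'.reg 0 = n) {ie : Expr} {e : ℕ}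
    (he : ie.eval s' = e) (heM : e < M) (hlt : ∀ i < L - 1, pathPt pd s (Y e) i < n) :
    (elemsE T L pd ie).map (Expr.eval s') = elems n T L NB (pathPt pd s (Y e)) := by
  unfold elemsE elems
  rw [List.map_flatMap]
  refine List.flatMap_congr fun i hi => ?_
  rw [List.mem_range] at hi
  have hv : s.arr (nm pd (10 + i)) (Y e) = pathPt pd s (Y e) i := rfl
  simp only [List.map_cons, Expr.eval, BinOp.eval, he, hs', hr, h.tgt e heM, hv, List.map_map]
  congr 2
  refine List.map_congr_left fun t ht => ?_
  rw [List.mem_range] at ht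
  simp only [Function.comp, Expr.eval, he, hs', h.tgt e heM, hv, h.nb t ht _ (hlt i hi)]

theorem avoids_elemsE {a T L pd : ℕ} {ie : Expr} (h : ie.avoids a) (h0 : a.unpair.1 ≠ 0)
    (hp : a.unpair.1 ≠ pd) : ∀ e ∈ elemsE T L pd ie, e.avoids a := by
  have h1 : ∀ d t, d ≠ a.unpair.1 → nm d t ≠ a := by
    rintro d t hd rfl
    simp [nm] at hd
  intro e he
  simp only [elemsE, List.mem_flatMap, List.mem_range, List.mem_cons, List.mem_map] at he
  obtain ⟨i, hi, (rfl | rfl | ⟨t, ht, rfl⟩)⟩ := he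
  · exact ⟨True.intro, h1 _ _ hp.symm, h1 _ _ h0.symm, h⟩
  · exact ⟨h1 _ _ hp.symm, h1 _ _ h0.symm, h⟩
  · exact ⟨h1 _ _ h0.symm, h1 _ _ hp.symm, h1 _ _ h0.symm, h⟩

theorem mem_elems {n T L : ℕ} {NB : ℕ → ℕ → ℕ} {p : ℕ → ℕ} {a : ℕ} : a ∈ elems n T L NB p ↔
    ∃ i < L - 1, a = n + p i ∨ a = p i ∨ ∃ t < T, NB t (p i) = a := by
  simp [elems]

theorem length_elems {n T L : ℕ} {NB : ℕ → ℕ → ℕ} {p : ℕ → ℕ} :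
    (elems n T L NB p).length = (L - 1) * (T + 2) := by
  simp [elems, List.length_flatMap]

/-- The elements by which the vertices `q L, …, q (k - 1)` can conflict with a segment. -/
def restSet (n T k L : ℕ) (NB : ℕ → ℕ → ℕ) (q : ℕ → ℕ) : Finset ℕ :=
  (Finset.Ico L k).biUnion fun j => insert (q j) ((Finset.range T).image fun t => n + NB t (q j))

/-- Independent of `n`; this is the number of levels of branching that are needed. -/
theorem card_restSet_le {n T k L : ℕ} {NB : ℕ → ℕ → ℕ} {q : ℕ → ℕ} :
    (restSet n T k L NB q).card ≤ k * (T + 1) := by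
  refine (Finset.card_biUnion_le_card_mul _ _ (T + 1) fun j _ => ?_).trans ?_
  · refine (Finset.card_insert_le _ _).trans ?_
    exact Nat.succ_le_succ (Finset.card_image_le.trans (by simp))
  · exact Nat.mul_le_mul_right _ (by simp)

theorem mem_restSet {n T k L : ℕ} {NB : ℕ → ℕ → ℕ} {q : ℕ → ℕ} {a : ℕ} :
    a ∈ restSet n T k L NB q ↔ ∃ j, L ≤ j ∧ j < k ∧ (a = q j ∨ ∃ t < T, n + NB t (q j) = a) := by
  simp [restSet, and_assoc]

/-- A path vertex conflicts with a cycle vertex if they are equal, if an arc leads from the path to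
the cycle, or if one leads back. These cases show as the common elements `p i`, `NB t (p i)` and `n
+ p i`; the shift by `n` separates the last case from the others. -/
theorem disjoint_restSet_iff {adj : ℕ → ℕ → Prop} {n T k L : ℕ} {NB : ℕ → ℕ → ℕ} {p q : ℕ → ℕ}
    (h : OutNb adj n T NB) (hp : ∀ i < L - 1, p i < n) (hq : ∀ j < k, q j < n) {L' : ℕ} :
    (∀ a ∈ elems n T L NB p, a ∉ restSet n T k L' NB q) ↔
      ∀ i < L - 1, ∀ j < k, L' ≤ j → p i ≠ q j ∧ ¬ adj (p i) (q j) := by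
  constructor
  · intro hd i hi j hj hLj
    have h1 : p i ≠ q j := fun heq =>
      hd (p i) (mem_elems.2 ⟨i, hi, Or.inr (Or.inl rfl)⟩) (mem_restSet.2 ⟨j, hLj, hj, Or.inl heq⟩)
    refine ⟨h1, fun ha => ?_⟩
    obtain ⟨_, t, ht, (hb | hb)⟩ := (h.adj_iff _ (hp i hi) _ (hq j hj)).1 ha
    · exact hd (q j) (mem_elems.2 ⟨i, hi, Or.inr (Or.inr ⟨t, ht, hb⟩)⟩)
        (mem_restSet.2 ⟨j, hLj, hj, Or.inl rfl⟩)
    · exact hd (n + p i) (mem_elems.2 ⟨i, hi, Or.inl rfl⟩)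
        (mem_restSet.2 ⟨j, hLj, hj, Or.inr ⟨t, ht, by rw [hb]⟩⟩)
  · intro hall a ha hr
    obtain ⟨i, hi, ha⟩ := mem_elems.1 ha
    obtain ⟨j, hLj, hj, hr⟩ := mem_restSet.1 hr
    obtain ⟨h1, h2⟩ := hall i hi j hj hLj
    rw [h.adj_iff _ (hp i hi) _ (hq j hj)] at h2
    have hpn := hp i hi
    have hqn := hq j hj
    rcases ha with rfl | rfl | ⟨t, ht, rfl⟩ <;> rcases hr with hr | ⟨t', ht', hr⟩
    · omega
    · exact h2 ⟨h1, t', ht', Or.inr (by omega)⟩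
    · exact h1 hr
    · omega
    · exact h2 ⟨h1, t, ht, Or.inl hr⟩
    · have := h.lt t ht _ hpn
      omega

section
variable {adj : ℕ → ℕ → Prop} {k m D T B n M L : ℕ} {X Y : ℕ → ℕ} {NB : ℕ → ℕ → ℕ}

theorem Inst.timeUnit_le (hi : Inst k m D T B n M adj X Y NB) : 2 * B ≤ timeUnit B := by
  have := hi.M_le
  unfold timeUnit; nlinarith

theorem Inst.n_le_B (hi : Inst k m D T B n M adj X Y NB) : n ≤ B :=
  (Nat.le_mul_of_pos_right n (Nat.succ_pos D)).trans hi.n_le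

theorem EdgeList.lt_of_adj (h : EdgeList adj n M X Y) {u v : ℕ} (huv : adj u v) : u < n := by
  obtain ⟨e, he, rfl, rfl⟩ := h.surj u v huv
  exact (h.lt e he).1

theorem IsCyc.lt (hk : 3 ≤ k) (h : EdgeList adj n M X Y) {q : ℕ → ℕ} (hq : IsCyc adj k q) :
    ∀ i < k, q i < n := by
  intro i hi
  by_cases hik : i + 1 < k
  · exact h.lt_of_adj ((hq i hi (i + 1) hik (by omega)).2.2 (Or.inl rfl))
  · exact h.lt_of_adj ((hq i hi 0 (by omega) (by omega)).2.2 (by unfold CycAdj; omega))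

/-- Every path on an induced cycle has a prolongation on the same cycle. -/
theorem exists_candidate (hk : 3 ≤ k) (h : EdgeList adj n M X Y) {df : ℕ → Prop}
    {pt : ℕ → ℕ → ℕ} (hp : PathFam adj n L df pt) {q : ℕ → ℕ} (hq : IsCyc adj k q)
    {v : ℕ} (hv : df v) (hqv : ∀ i < L, q i = pt v i) :
    ∃ e < M, ∃ q', df (Y e) ∧ IsCyc adj k q' ∧ ∀ i < L + 1, q' i = consPath (X e) (pt (Y e)) i := by
  have hL := hp.pos
  have h0 : q 0 = v := by rw [hqv 0 hL, hp.head v hv]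
  obtain ⟨e, he, h1, h2⟩ := h.surj (q (k - 1)) (q 0)
    ((hq (k - 1) (by omega) 0 (by omega) (by omega)).2.2 (by unfold CycAdj; omega))
  rw [h0] at h2
  refine ⟨e, he, _, by rwa [h2], hq.rotate, ?_⟩
  intro i hi
  rw [h1, h2]
  cases i with
  | zero => rfl
  | succ i => exact hqv i (by omega)

end

/-! ### The last stage of the search -/

/-- Test all candidates of size `k`. -/
def finalP (k T L pd : ℕ) : Program :=
  forP 1 (.ite (validE k T L pd)
    (.seq (.assign 2 (.lit 1))
      (seqP ((List.range k).map fun i => .store (nm 0 3) (.lit i) (candE pd (.reg 3) i))))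
    .skip)

/-- What the search does for one input. -/
def SearchRun (adj : ℕ → ℕ → Prop) (k T B n M L d t : ℕ) (X Y : ℕ → ℕ) (NB : ℕ → ℕ → ℕ)
    (p : Program) : Prop :=
  ∀ s, Bdd B s → Env T n M X Y NB s →
    PathFam adj n L (pathDf n d s) (pathPt d s) → FoundInv adj k n s →
    Run B p s t fun s' => Progress adj k n d s s' ∧
      ∀ v q, pathDf n d s v → IsCyc adj k q → (∀ i < L, q i = pathPt d s v i) → s'.reg 2 ≠ 0

/-- The search for cycles that prolong the paths of length `L` stored at depth `d`. -/
def SearchSpec (k m D T L d : ℕ) (p : Program) : Prop :=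
  ∃ C, ∀ (B n M : ℕ) (adj : ℕ → ℕ → Prop) (X Y : ℕ → ℕ) (NB : ℕ → ℕ → ℕ),
    Inst k m D T B n M adj X Y NB → SearchRun adj k T B n M L d (C * timeUnit B) X Y NB p

theorem candE_le {B pd i : ℕ} {ie : Expr} {s s' : State} (hs : Bdd B s) (h : s'.arr = s.arr) :
    (candE pd ie i).eval s' ≤ B := by
  unfold candE
  split_ifs <;> simp only [Expr.eval, h] <;> exact hs.arr _ _

theorem cost_candE_le (pd i : ℕ) (ie : Expr) : (candE pd ie i).cost ≤ ie.cost + 2 := by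
  unfold candE
  split_ifs <;> simp [Expr.cost]

/-- For `L + 1 = k` a valid candidate is already a whole induced cycle, so neither orientation nor
branching is needed. -/
theorem finalP_spec {k m D T L d : ℕ} (hk : 3 ≤ k) (hL : L + 1 = k) :
    SearchSpec k m D T L d (finalP k T L d) := by
  set c : ℕ := (validE k T L d).cost + 1 + (2 + (10 * k + 1)) with hc
  refine ⟨c + 10, fun B n M adj X Y NB hi s hs henv hp hf => ?_⟩
  have hMB := hi.M_le
  refine Run.mono (run_forP (c := c) (N := M) (fun j s' => Progress adj k n d s s' ∧
    ∀ e < j, pathDf n d s (Y e) → IsSeg adj k (L + 1) (consPath (X e) (pathPt d s (Y e))) →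
      s'.reg 2 ≠ 0) hs (by omega) ?_ ?_ ?_) ?_ ?_
  · refine ⟨⟨⟨fun r hr => ?_, fun _ _ _ _ => rfl⟩, ?_, fun h => ?_⟩, fun e he => by omega⟩
    · rw [State.setReg_reg, if_neg (by omega)]
    · simpa [FoundInv, State.setReg_reg] using hf
    · simpa [State.setReg_reg] using h
  · rintro j s' ⟨h, -⟩
    rw [h.keep.1 1 (by norm_num), henv.reg1]
  · rintro j hj s' hs' hr ⟨hpr, hall⟩
    have henv' := henv.keep hpr.keep
    obtain ⟨hdf, hpt⟩ := hpr.keep.paths (n := n) le_rfl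
    have hval := eval_validE hi henv' (by rw [hdf, hpt]; exact hp) hj rfl hr
    rw [hdf, hpt] at hval
    refine Run.ite hs' (t := 2 + (10 * k + 1)) ?_ ?_ (by omega)
    · intro hv
      obtain ⟨hv1, hv2⟩ := hval.1 hv
      -- Writing the output array does not disturb the arrays from which the candidate is read, so
      -- it can be copied vertex by vertex.
      have hcand : ∀ s'' : State, s''.reg = (s'.setReg 2 1).reg →
          (∀ a ≠ nm 0 3, s''.arr a = s'.arr a) → ∀ i,
          (candE d (.reg 3) i).eval s'' = consPath (X j) (pathPt d s (Y j)) i := by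
        intro s'' hr'' ha'' i
        have k' : KeepBelow d s s'' := by
          refine ⟨fun r hr3 => ?_, fun d' hd t ht => ?_⟩
          · rw [hr'', State.setReg_reg, if_neg (by omega)]; exact hpr.keep.1 r hr3
          · rw [ha'' _ (by simpa using ht)]; exact hpr.keep.2 d' hd t ht
        rw [eval_candE (henv.keep k') rfl d (.reg 3) (e := j)
          (by simp [Expr.eval, hr'', State.setReg_reg, hr]) hj, (k'.paths (n := n) le_rfl).2]
      have hlt : ∀ i < k, consPath (X j) (pathPt d s (Y j)) i < n := by
        intro i hik
        cases i with
        | zero => exact (hi.edges.lt j hj).1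
        | succ i => exact hp.lt _ hv1 i (by omega)
      refine Run.seq hs' (Run.assign hs' (Q := (· = s'.setReg 2 1)) (by
        simp only [Expr.eval]; have := hs'.two_le; omega) rfl le_rfl) ?_
      rintro s₁ hs₁ rfl
      refine Run.mono (run_seqP (c := 10) _ (fun s'' => s''.reg = (s'.setReg 2 1).reg ∧
        ∀ a ≠ nm 0 3, s''.arr a = s'.arr a)
        (fun i s'' => s''.arr (nm 0 3) i = consPath (X j) (pathPt d s (Y j)) i) (List.range k)
        ?_ _ hs₁ ⟨rfl, fun _ _ => rfl⟩) (by simp) ?_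
      · rintro i - s'' hs'' ⟨hr'', ha''⟩
        have hev := hcand s'' hr'' ha''
        refine Run.store hs'' (candE_le hs'' rfl) ?_ ?_
        · rw [hev]
          refine ⟨⟨by rw [State.setArr_reg, hr''], fun a ha => ?_⟩, ?_, ?_⟩
          · funext x; simp [State.setArr_arr, ha, ha'' a ha]
          · simp [State.setArr_arr, Expr.eval]
          · intro i' hi'
            simp only [State.setArr_arr, Expr.eval, true_and]
            split_ifs with h
            · rw [h]
            · exact hi'
        · have := cost_candE_le d i (.reg 3)
          simp only [Expr.cost] at this ⊢; omega
      · rintro s'' hs'' ⟨⟨hr'', ha''⟩, hg, -⟩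
        have hr2 : s''.reg 2 = 1 := by rw [hr'', State.setReg_reg, if_pos rfl]
        have hout : ∀ i < k, s''.arr (nm 0 3) i = consPath (X j) (pathPt d s (Y j)) i :=
          fun i hik => hg i (List.mem_range.2 hik)
        refine ⟨by rw [hr'', State.setReg_reg, if_neg (by norm_num), hr], ⟨⟨?_, ?_⟩, ?_, ?_⟩, ?_⟩
        · intro r hr3
          rw [State.setReg_reg, if_neg (by omega), hr'', State.setReg_reg, if_neg (by omega)]
          exact hpr.keep.1 r hr3
        · intro d' hd t ht
          rw [State.setReg_arr, ha'' _ (by simpa using ht)]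
          exact hpr.keep.2 d' hd t ht
        · refine Or.inr ⟨by rw [State.setReg_reg, if_neg (by norm_num), hr2], ?_, ?_⟩
          · have hcyc : IsCyc adj k (consPath (X j) (pathPt d s (Y j))) :=
              IsSeg.isCyc hi.edges.symm (by rw [hL] at hv2; exact hv2)
            intro i hi' i' hi'' hne
            rw [State.setReg_arr, hout i hi', hout i' hi'']
            exact hcyc i hi' i' hi'' hne
          · intro i hi'
            rw [State.setReg_arr, hout i hi']
            exact hlt i hi'
        · intro _
          rw [State.setReg_reg, if_neg (by norm_num), hr2]; exact one_ne_zero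
        · intro e _ _ _
          rw [State.setReg_reg, if_neg (by norm_num), hr2]; exact one_ne_zero
    · intro hv
      refine Run.skip hs' ⟨hr, ⟨⟨?_, ?_⟩, ?_, ?_⟩, ?_⟩ (by omega)
      · intro r hr3
        rw [State.setReg_reg, if_neg (by omega)]; exact hpr.keep.1 r hr3
      · exact hpr.keep.2
      · have := hpr.inv
        simpa [FoundInv, State.setReg_reg] using this
      · simpa [State.setReg_reg] using hpr.found
      · intro e he hdfe hseg
        rw [State.setReg_reg, if_neg (by norm_num)]
        have : e ≠ j := by
          rintro rfl
          exact hval.2 ⟨hdfe, hseg⟩ hv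
        exact hall e (by omega) hdfe hseg
  · have := hi.timeUnit_le
    calc (M + 1) * (c + 10) ≤ timeUnit B * (c + 10) := Nat.mul_le_mul_right _ (by omega)
      _ = _ := mul_comm _ _
  · rintro s' hs' ⟨_, hpr, hall⟩
    refine ⟨hpr, fun v q hv hq hqv => ?_⟩
    obtain ⟨e, he, q', h1, h2, h3⟩ := exists_candidate hk hi.edges hp hq hv hqv
    exact hall e he h1 (h2.isSeg hL.le h3)

/-! ### Prolonging paths along the arcs of an orientation -/

/-- Store at depth `d` the prolongations along the arcs number `j`, with vertices permuted by
`σ`. -/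
def extendP (D arc j d L pd : ℕ) (σ : ℕ → ℕ) : Program :=
  .seq (mapP 0 (nm d 9) (.get arc (.op .add (.op .mul (.reg 3) (.lit D)) (.lit j))))
    (seqP ((List.range (L + 1)).map fun i => mapP 0 (nm d (10 + i))
      (candE pd (.op .sub (.get arc (.op .add (.op .mul (.reg 3) (.lit D)) (.lit j))) (.lit 1))
        (σ i))))

/-- A slot with content `e + 1` is itself a valid mark for the domain, and decreased by one it is
the number of the edge whose prolongation is copied. -/
theorem run_extendP {T D B n M j d L pd da ta : ℕ} {X Y : ℕ → ℕ} {NB : ℕ → ℕ → ℕ}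
    {s : State} (hnB : n ≤ B) (hs : Bdd B s) (henv : Env T n M X Y NB s)
    (hd : 1 ≤ d) (hpd : pd ≠ d) (hda : da ≠ d) (σ : ℕ → ℕ) :
    Run B (extendP D (nm da ta) j d L pd σ) s (100 * (L + 2) * B) fun s' => KeepDepth d s s' ∧
      (∀ x < n, s'.arr (nm d 9) x = s.arr (nm da ta) (x * D + j)) ∧
      ∀ x < n, ∀ e < M, s.arr (nm da ta) (x * D + j) = e + 1 → ∀ i < L + 1,
        pathPt d s' x i = consPath (X e) (pathPt pd s (Y e)) (σ i) := by
  have h2B := hs.two_le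
  refine Run.mono (Run.seq hs (run_mapP hs hnB (by norm_num) henv.reg0
    ⟨by simp [hda], ⟨True.intro, True.intro⟩, True.intro⟩ (fun x _ => hs.arr _ _))
    (t' := 50 * B * (L + 1) + 1) ?_) ?_ (fun _ _ h => h)
  · rintro s₁ hs₁ e₁
    have hdf₁ : ∀ x < n, s₁.arr (nm d 9) x = s.arr (nm da ta) (x * D + j) := by
      intro x hx
      rw [e₁, State.put_arr_same _ _ _ hx]
      simp [Expr.eval, BinOp.eval, State.setReg_reg]
    have hk₁ : KeepDepth d s s₁ := by
      subst e₁
      exact ⟨fun r hr => State.put_reg _ _ _ _ (by omega), fun d' t hd' =>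
        State.put_arr_ne _ _ _ (by simp [hd'])⟩
    refine Run.mono (run_seqP (c := 50 * B) _ (fun s' => KeepDepth d s s' ∧
      ∀ x < n, s'.arr (nm d 9) x = s.arr (nm da ta) (x * D + j))
      (fun i s' => ∀ x < n, ∀ e < M, s.arr (nm da ta) (x * D + j) = e + 1 →
        pathPt d s' x i = consPath (X e) (pathPt pd s (Y e)) (σ i)) (List.range (L + 1)) ?_ s₁ hs₁
        ⟨hk₁, hdf₁⟩) (by simp) ?_
    · rintro i - s₂ hs₂ ⟨hk₂, hdf₂⟩
      refine Run.mono (run_mapP hs₂ hnB (by norm_num) (by rw [hk₂.1 0 (by norm_num), henv.reg0])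
        (avoids_candE (ie := .op .sub (.get (nm da ta)
          (.op .add (.op .mul (.reg 3) (.lit D)) (.lit j))) (.lit 1))
          ⟨⟨by simp [hda], ⟨True.intro, True.intro⟩, True.intro⟩, True.intro⟩
          (by simp [nm]; omega) (by simp [nm]; omega) _) (fun x _ => candE_le hs₂ rfl)) ?_ ?_
      · have := cost_candE_le pd (σ i) (.op .sub (.get (nm da ta)
          (.op .add (.op .mul (.reg 3) (.lit D)) (.lit j))) (.lit 1))
        simp only [Expr.cost] at this
        calc _ ≤ (2 * B) * 24 := Nat.mul_le_mul (by omega) (by omega)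
          _ ≤ _ := by omega
      · rintro s₃ hs₃ rfl
        refine ⟨⟨⟨fun r hr => ?_, fun d' t hd' => ?_⟩, fun x hx => ?_⟩, ?_, ?_⟩
        · rw [State.put_reg _ _ _ _ (by omega)]; exact hk₂.1 r hr
        · rw [State.put_arr_ne _ _ _ (by simp [hd'])]; exact hk₂.2 d' t hd'
        · rw [State.put_arr_ne _ _ _ (by simp; omega)]; exact hdf₂ x hx
        · intro x hx e he harc
          rw [pathPt, State.put_arr_same _ _ _ hx]
          have kb : KeepBelow 0 s s₂ := hk₂.keepBelow (by omega)
          rw [eval_candE (s' := s₂.setReg 3 x) (henv.keep kb) rfl pd _ (e := e) ?_ he]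
          · congr 1
            funext i'
            rw [pathPt, pathPt, hk₂.2 _ _ hpd]
          · simp only [Expr.eval, BinOp.eval, State.setReg_reg, State.setReg_arr, if_true]
            rw [hk₂.2 _ _ hda, harc, Nat.add_sub_cancel]
        · intro i' hi' x hx e he harc
          by_cases h : i' = i
          · subst h
            rw [pathPt, State.put_arr_same _ _ _ hx]
            have kb : KeepBelow 0 s s₂ := hk₂.keepBelow (by omega)
            rw [eval_candE (s' := s₂.setReg 3 x) (henv.keep kb) rfl pd _ (e := e) ?_ he]
            · congr 1
              funext i'
              rw [pathPt, pathPt, hk₂.2 _ _ hpd]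
            · simp only [Expr.eval, BinOp.eval, State.setReg_reg, State.setReg_arr, if_true]
              rw [hk₂.2 _ _ hda, harc, Nat.add_sub_cancel]
          · rw [pathPt, State.put_arr_ne _ _ _ (by simp [h])]
            exact hi' x hx e he harc
    · rintro s' hs' ⟨⟨hk', hdf'⟩, hg, -⟩
      exact ⟨hk', hdf', fun x hx e he harc i hi => hg i (List.mem_range.2 hi) x hx e he harc⟩
  · simp only [Expr.cost]
    have : 50 * B * (L + 1) + 1 ≤ 100 * (L + 1) * B := by nlinarith
    nlinarith

/-! ### The nodes of the search -/

/-- The paths stored at depth `pd`, and their last vertices stored at depth `zd`. -/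
structure Frame (adj : ℕ → ℕ → Prop) (n M L pd zd : ℕ) (Y : ℕ → ℕ) (df : ℕ → Prop)
    (pt : ℕ → ℕ → ℕ) (Z : ℕ → ℕ) (s : State) : Prop where
  fam : PathFam adj n L df pt
  df_eq : pathDf n pd s = df
  pt_eq : pathPt pd s = pt
  z : ∀ e < M, s.arr (nm zd 1) e = Z e
  z_lt : ∀ e < M, Z e < n
  z_eq : ∀ e < M, df (Y e) → Z e = pt (Y e) (L - 1)

theorem Frame.keep {adj : ℕ → ℕ → Prop} {n M L pd zd d : ℕ} {Y : ℕ → ℕ} {df : ℕ → Prop}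
    {pt : ℕ → ℕ → ℕ} {Z : ℕ → ℕ} {s s' : State} (h : Frame adj n M L pd zd Y df pt Z s)
    (hk : KeepBelow d s s') (hp : pd ≤ d) (hz : zd ≤ d) : Frame adj n M L pd zd Y df pt Z s' where
  fam := h.fam
  df_eq := by rw [(hk.paths hp).1, h.df_eq]
  pt_eq := by rw [(hk.paths (n := n) hp).2, h.pt_eq]
  z e he := by rw [hk.2 zd hz _ (by simp), h.z e he]
  z_lt := h.z_lt
  z_eq := h.z_eq

/-- The candidates in `val` are segments. -/
def Valid (adj : ℕ → ℕ → Prop) (k M L : ℕ) (X Y : ℕ → ℕ) (df : ℕ → Prop) (pt : ℕ → ℕ → ℕ)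
    (val : ℕ → Prop) : Prop :=
  ∀ e < M, val e → df (Y e) ∧ IsSeg adj k (L + 1) (consPath (X e) (pt (Y e)))

/-- Search for cycles that prolong the candidates recorded as arcs number `j`. -/
theorem run_side {adj : ℕ → ℕ → Prop} {k m D T B n M L pd da ta j d t : ℕ} {X Y : ℕ → ℕ}
    {NB : ℕ → ℕ → ℕ} {next : Program}
    (hnext : SearchRun adj k T B n M (L + 1) (d + 1) t X Y NB next) {s : State} (hs : Bdd B s)
    (hi : Inst k m D T B n M adj X Y NB) (henv : Env T n M X Y NB s) (hf : FoundInv adj k n s)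
    (hpd : pd ≤ d) (hda : da ≤ d) (σ : ℕ → ℕ) {arc : ℕ → ℕ}
    (harc : ∀ x < n, s.arr (nm da ta) (x * D + j) = arc x)
    (harcM : ∀ x < n, ∀ g, arc x = g + 1 → g < M)
    (hfam : ∀ pt', (∀ x < n, ∀ g, arc x = g + 1 → ∀ i < L + 1,
      pt' x i = consPath (X g) (pathPt pd s (Y g)) (σ i)) →
      PathFam adj n (L + 1) (fun x => x < n ∧ arc x ≠ 0) pt')
    (hcyc : ∀ x < n, ∀ g, arc x = g + 1 → ∀ q, IsCyc adj k q →
      (∀ i < L + 1, q i = consPath (X g) (pathPt pd s (Y g)) i) → ∃ q', IsCyc adj k q' ∧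
        ∀ i < L + 1, q' i = consPath (X g) (pathPt pd s (Y g)) (σ i)) :
    Run B (.seq (extendP D (nm da ta) j (d + 1) L pd σ) next) s (100 * (L + 2) * B + t)
      fun s' => Progress adj k n d s s' ∧ ∀ x < n, ∀ g, arc x = g + 1 → ∀ q, IsCyc adj k q →
        (∀ i < L + 1, q i = consPath (X g) (pathPt pd s (Y g)) i) → s'.reg 2 ≠ 0 := by
  refine Run.seq hs (run_extendP hi.n_le_B hs henv (by omega) (by omega) (by omega) σ) ?_
  rintro s₁ hs₁ ⟨hk₁, hdf₁, hpt₁⟩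
  have hp₁ : Progress adj k n d s s₁ := hk₁.progress (by omega) hf
  have hpt : ∀ x < n, ∀ g, arc x = g + 1 → ∀ i < L + 1,
      pathPt (d + 1) s₁ x i = consPath (X g) (pathPt pd s (Y g)) (σ i) := fun x hx g hg =>
    hpt₁ x hx g (harcM x hx g hg) (by rw [harc x hx, hg])
  have hdf : pathDf n (d + 1) s₁ = fun x => x < n ∧ arc x ≠ 0 := by
    funext x
    by_cases hx : x < n
    · rw [pathDf, hdf₁ x hx, harc x hx]
    · simp [pathDf, hx]
  refine Run.mono (hnext s₁ hs₁ (henv.keep hp₁.keep) (by rw [hdf]; exact hfam _ hpt) hp₁.inv)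
    le_rfl ?_
  rintro s₂ - ⟨hp₂, hfound⟩
  refine ⟨hp₁.trans (hp₂.le (by omega)), fun x hx g hg q hq hqc => ?_⟩
  obtain ⟨q', hq', hqc'⟩ := hcyc x hx g hg q hq hqc
  refine hfound x q' (by rw [hdf]; exact ⟨hx, by omega⟩) hq' fun i hi' => ?_
  rw [hqc' i hi', hpt x hx g hg i hi']

/-- Group the candidates, orient the graph of the groups, and search along the arcs. -/
def coreP (D L pd zd vd : ℕ) (next : ℕ → Program) : Program :=
  .seq (groupP (vd + 1) (nm zd 1) (nm vd 0))
    (.seq (peelP D (vd + 2) (nm 0 2) (nm zd 1) (nm (vd + 1) 2))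
      (.seq
        (seqP ((List.range D).map fun j =>
          .seq (extendP D (nm (vd + 2) 6) j (vd + 3) L pd id) (next (vd + 3))))
        (seqP ((List.range D).map fun j =>
          .seq (extendP D (nm (vd + 2) 7) j (vd + 3) L pd (fun i => L - i)) (next (vd + 3))))))

section
variable {adj : ℕ → ℕ → Prop} {k m D T B n M L pd zd vd t : ℕ} {X Y : ℕ → ℕ}
  {NB : ℕ → ℕ → ℕ} {next : ℕ → Program} {df : ℕ → Prop} {pt : ℕ → ℕ → ℕ} {Z : ℕ → ℕ}
  {val : ℕ → Prop} {s : State}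

theorem IsSeg.injOn {pt' : ℕ → ℕ} (h : IsSeg adj k L pt') {i j : ℕ} (hi : i < L) (hj : j < L)
    (hij : pt' i = pt' j) : i = j := by
  rcases lt_trichotomy i j with h' | h' | h'
  · exact absurd hij (h j hj i h').1
  · exact h'
  · exact absurd hij.symm (h i hi j h').1

/-- The vertices of a segment are distinct. This is what the averaging over colourings in
`PathFam.sparse` requires. -/
theorem Valid.sparse (hi : Inst k m D T B n M adj X Y NB) (hLk : L + 1 ≤ k)
    (hfr : Frame adj n M L pd zd Y df pt Z s) (hv : Valid adj k M L X Y df pt val)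
    (S : Finset ℕ) (hS : ∀ e ∈ S, e < M ∧ val e)
    (hinj : ∀ e ∈ S, ∀ e' ∈ S, X e = X e' → Z e = Z e' → e = e') :
    S.card ≤ density k m * ((S.image X).card + (S.image Z).card) := by
  have hz : ∀ e ∈ S, Z e = pt (Y e) (L - 1) := fun e he =>
    hfr.z_eq e (hS e he).1 (hv e (hS e he).1 (hS e he).2).1
  refine PathFam.sparse hi.edges.symm hi.noModel hfr.fam hLk S X Y ?_ ?_ ?_ _ _
    (fun e he => Finset.mem_image_of_mem _ he)
    (fun e he => by rw [← hz e he]; exact Finset.mem_image_of_mem _ he)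
  · intro e he
    exact ⟨(hi.edges.lt e (hS e he).1).1, (hv e (hS e he).1 (hS e he).2).1,
      hi.edges.edge e (hS e he).1⟩
  · intro e he i hi' j hj hij
    exact (hv e (hS e he).1 (hS e he).2).2.injOn hi' hj hij
  · intro e he e' he' hx hz'
    rw [← hz e he, ← hz e' he'] at hz'
    exact hinj e he e' he' hx hz'

/-- Every leader sits in one of the `D` slots of its first end or of its last end, and each slot
number gives one family of paths with `L + 1` vertices for the recursion. The guarantee covers the
leaders only; other candidates are left to the branching. -/
theorem run_coreP (hnext : SearchRun adj k T B n M (L + 1) (vd + 3) t X Y NB (next (vd + 3)))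
    (hLk : L + 1 ≤ k) (hi : Inst k m D T B n M adj X Y NB) (hs : Bdd B s)
    (henv : Env T n M X Y NB s) (hfr : Frame adj n M L pd zd Y df pt Z s)
    (hf : FoundInv adj k n s) (hpd : pd ≤ vd) (hzd : zd ≤ vd)
    (hval : ∀ e < M, s.arr (nm vd 0) e ≠ 0 ↔ val e) (hv : Valid adj k M L X Y df pt val) :
    Run B (coreP D L pd zd vd next) s
      (200 * B + (1000 * timeUnit B +
        (((100 * (L + 2) * B + t) * D + 1) + ((100 * (L + 2) * B + t) * D + 1)))) fun s' =>
      Progress adj k n vd s s' ∧ ∃ ld : ℕ → ℕ,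
        (∀ e < M, val e → s'.arr (nm (vd + 1) 1) e = ld e ∧ ld e < M ∧ val (ld e) ∧
          X (ld e) = X e ∧ Z (ld e) = Z e) ∧
        (∀ e < M, ∀ e' < M, val e → val e' → X e = X e' → Z e = Z e' → ld e = ld e') ∧
        ∀ e < M, val e → ∀ q, IsCyc adj k q →
          (∀ i < L + 1, q i = consPath (X (ld e)) (pt (Y (ld e))) i) → s'.reg 2 ≠ 0 := by
  have hMB := hi.M_le
  refine Run.seq hs (run_groupP hs henv.reg0 henv.reg1 hi.n_le_B (by omega) henv.src
    hi.edges.mono hfr.z hfr.z_lt (by omega) (by omega) (by omega)) ?_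
  rintro s₁ hs₁ ⟨hk₁, hl₁, hg₁, hu₁⟩
  have hp₁ : Progress adj k n vd s s₁ := hk₁.progress (by omega) hf
  have henv₁ := henv.keep hp₁.keep
  have hfr₁ := hfr.keep hp₁.keep hpd hzd
  set lv := s₁.arr (nm (vd + 1) 2) with hlv
  set ld := s₁.arr (nm (vd + 1) 1) with hld
  have hlval : ∀ e < M, lv e ≠ 0 → val e := fun e he h => (hval e he).1 (hl₁ e he h)
  have hgr : ∀ e < M, val e → ld e < M ∧ lv (ld e) ≠ 0 ∧ X (ld e) = X e ∧ Z (ld e) = Z e :=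
    fun e he h => hg₁ e he ((hval e he).2 h)
  have hsame : ∀ e < M, ∀ e' < M, val e → val e' → X e = X e' → Z e = Z e' → ld e = ld e' := by
    intro e he e' he' h h' hx hz
    obtain ⟨a1, a2, a3, a4⟩ := hgr e he h
    obtain ⟨b1, b2, b3, b4⟩ := hgr e' he' h'
    exact hu₁ _ a1 _ b1 a2 b2 (by rw [a3, b3, hx]) (by rw [a4, b4, hz])
  refine Run.seq hs₁ (run_peelP (c := density k m) hs₁ henv₁.reg0 henv₁.reg1 hi.n_le hi.M_le
    henv₁.src (fun e he => (hi.edges.lt e he).1) hfr₁.z hfr.z_lt (by omega) (by omega) (by omega)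
    hi.degree ?_) ?_
  · intro S hS
    exact hv.sparse hi hLk hfr S (fun e he => ⟨(hS e he).1, hlval e (hS e he).1 (hS e he).2⟩)
      fun e he e' he' => hu₁ e (hS e he).1 e' (hS e' he').1 (hS e he).2 (hS e' he').2
  rintro s₂ hs₂ ⟨hk₂, harc, hL₂, hR₂⟩
  have hp₂ : Progress adj k n (vd + 1) s₁ s₂ := hk₂.progress (by omega) hp₁.inv
  have henv₂ := henv₁.keep hp₂.keep
  have hfr₂ := hfr₁.keep hp₂.keep (by omega) (by omega)
  have hptk : ∀ s₃, Progress adj k n (vd + 2) s₂ s₃ → pathPt pd s₃ = pt := fun s₃ h => by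
    rw [(h.keep.paths (n := n) (by omega)).2, hfr₂.pt_eq]
  let Goal : ℕ → ℕ → State → Prop := fun a j s' => ∀ x < n, ∀ g,
    s₂.arr (nm (vd + 2) a) (x * D + j) = g + 1 → ∀ q, IsCyc adj k q →
      (∀ i < L + 1, q i = consPath (X g) (pt (Y g)) i) → s'.reg 2 ≠ 0
  -- A cycle once found is never forgotten, so later searches preserve the goals already reached.
  have hGoal : ∀ a j s' s'', Progress adj k n (vd + 2) s' s'' → Goal a j s' → Goal a j s'' :=
    fun a j s' s'' h hg x hx g hgx q hq hqc => h.found (hg x hx g hgx q hq hqc)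
  refine Run.seq hs₂ (Run.mono (run_seqP (c := 100 * (L + 2) * B + t) _
    (fun s' => Progress adj k n (vd + 2) s₂ s') (Goal 6) (List.range D) ?_ s₂ hs₂
    (Progress.refl _ hp₂.inv)) (by simp) (Q' := fun s' => Progress adj k n (vd + 2) s₂ s' ∧
      ∀ j < D, Goal 6 j s') ?_) ?_
  · intro j hj s₃ hs₃ hp₃
    rw [List.mem_range] at hj
    have hL₂' := fun x hx g hg => hL₂ x hx j hj g hg
    refine Run.mono (run_side (m := m) (D := D) hnext hs₃ hi
      (henv₂.keep hp₃.keep) hp₃.inv (show pd ≤ vd + 2 by omega) (show vd + 2 ≤ vd + 2 by omega) id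
      (arc := fun x => s₂.arr (nm (vd + 2) 6) (x * D + j))
      (fun x _ => by rw [hp₃.keep.2 _ le_rfl _ (by simp)])
      (fun x hx g hg => (hL₂' x hx g hg).1) ?_ ?_) le_rfl ?_
    · intro pt' hpt'
      -- Each `x` has at most one arc number `j`, so the prolonged path is a function of its new
      -- first vertex.
      refine hfr.fam.prolong ?_
      rintro x ⟨hx, hx0⟩
      obtain ⟨g, hg⟩ := Nat.exists_eq_succ_of_ne_zero hx0
      obtain ⟨h1, h2, h3⟩ := hL₂' x hx g hg
      refine ⟨hx, Y g, (hv g h1 (hlval g h1 h2)).1, by rw [← h3]; exact hi.edges.edge g h1, ?_⟩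
      intro i hi'
      rw [hpt' x hx g hg i hi', hptk s₃ hp₃, h3]; rfl
    · intro x hx g hg q hq hqc
      exact ⟨q, hq, hqc⟩
    · rintro s₄ - ⟨hp₄, hg₄⟩
      refine ⟨hp₃.trans hp₄, ?_, fun j' => hGoal 6 j' _ _ hp₄⟩
      rw [hptk s₃ hp₃] at hg₄
      exact hg₄
  · rintro s' - ⟨h1, h2, -⟩
    exact ⟨h1, fun j hj => h2 j (List.mem_range.2 hj)⟩
  rintro s₃ hs₃ ⟨hp₃, hG₃⟩
  refine Run.mono (run_seqP (c := 100 * (L + 2) * B + t) _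
    (fun s' => Progress adj k n (vd + 2) s₃ s') (Goal 7) (List.range D) ?_ s₃ hs₃
    (Progress.refl _ hp₃.inv)) (by simp) ?_
  · intro j hj s₄ hs₄ hp₄
    rw [List.mem_range] at hj
    have hR₂' := fun x hx g hg => hR₂ x hx j hj g hg
    have hp₄' := hp₃.trans hp₄
    refine Run.mono (run_side (m := m) (D := D) hnext hs₄ hi
      (henv₂.keep hp₄'.keep) hp₄.inv (show pd ≤ vd + 2 by omega) (show vd + 2 ≤ vd + 2 by omega)
      (fun i => L - i) (arc := fun x => s₂.arr (nm (vd + 2) 7) (x * D + j))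
      (fun x _ => by rw [hp₄'.keep.2 _ le_rfl _ (by simp)])
      (fun x hx g hg => (hR₂' x hx g hg).1) ?_ ?_) le_rfl ?_
    · intro pt' hpt'
      -- Here the arc belongs to the last vertex, so the path is a function of that vertex and is
      -- stored reversed.
      refine hfr.fam.prolong_reverse hi.edges.symm ?_
      rintro z ⟨hz, hz0⟩
      obtain ⟨g, hg⟩ := Nat.exists_eq_succ_of_ne_zero hz0
      obtain ⟨h1, h2, h3⟩ := hR₂' z hz g hg
      have hdfg := (hv g h1 (hlval g h1 h2)).1
      refine ⟨X g, (hi.edges.lt g h1).1, Y g, hdfg, hi.edges.edge g h1,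
        by rw [← h3, hfr.z_eq g h1 hdfg], ?_⟩
      intro i hi'
      rw [hpt' z hz g hg i hi', hptk s₄ hp₄', revPath, Nat.add_sub_cancel]
    · intro x hx g hg q hq hqc
      refine ⟨_, hq.reverse hLk, fun i hi' => ?_⟩
      rw [if_pos hi', Nat.add_sub_cancel, hqc _ (by omega)]
    · rintro s₅ - ⟨hp₅, hg₅⟩
      refine ⟨hp₄.trans hp₅, ?_, fun j' => hGoal 7 j' _ _ hp₅⟩
      rw [hptk s₄ hp₄'] at hg₅
      exact hg₅
  · rintro s' - ⟨hp', hG, -⟩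
    have hp₂' : Progress adj k n (vd + 1) s₁ s' := hp₂.trans ((hp₃.trans hp').le (by omega))
    refine ⟨hp₁.trans (hp₂'.le (by omega)), ld, ?_, hsame, ?_⟩
    · intro e he hve
      obtain ⟨h1, h2, h3⟩ := hgr e he hve
      exact ⟨by rw [hp₂'.keep.2 _ le_rfl _ (by simp)], h1, hlval _ h1 h2, h3⟩
    · intro e he hve q hq hqc
      obtain ⟨h1, h2, h3⟩ := hgr e he hve
      rcases harc _ h1 h2 with ⟨j, hj, hg⟩ | ⟨j, hj, hg⟩
      · exact hp'.found (hG₃ j hj _ (hi.edges.lt _ h1).1 _ hg q hq hqc)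
      · exact hG j (List.mem_range.2 hj) _ (hfr.z_lt _ h1) _ hg q hq hqc

end

/-! ### Branching on conflicts -/

/-- Keep the candidates that avoid the element number `a` of the leader of their group. -/
def branchE (T L pd vd a : ℕ) : Expr :=
  allE [.get (nm vd 0) (.reg 3), notE (anyE ((elemsE T L pd (.reg 3)).map fun z =>
    eqE z ((elemsE T L pd (.get (nm (vd + 1) 1) (.reg 3))).getD a (.lit 0))))]

/-- A node of the search with `b` levels of branching below it. -/
def nodeP (D T L pd zd : ℕ) (next : ℕ → Program) : ℕ → ℕ → Program
  | 0, vd => coreP D L pd zd vd next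
  | b + 1, vd => .seq (coreP D L pd zd vd next)
      (seqP ((List.range ((L - 1) * (T + 2))).map fun a =>
        .seq (mapP 1 (nm (vd + 3) 0) (branchE T L pd vd a)) (nodeP D T L pd zd next b (vd + 3))))

theorem avoids_getD {a i : ℕ} {l : List Expr} (h : ∀ e ∈ l, e.avoids a) :
    (l.getD i (.lit 0)).avoids a := by
  rw [List.getD_eq_getElem?_getD]
  cases h' : l[i]? with
  | none => exact True.intro
  | some e => exact h e (List.mem_of_getElem? h')

theorem avoids_branchE {T L pd vd a b : ℕ} (h0 : b.unpair.1 ≠ 0) (hp : b.unpair.1 ≠ pd)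
    (hv : b.unpair.1 ≠ vd) (hv' : b.unpair.1 ≠ vd + 1) : (branchE T L pd vd a).avoids b := by
  have h1 : ∀ d t, d ≠ b.unpair.1 → nm d t ≠ b := by
    rintro d t hd rfl
    simp [nm] at hd
  refine avoids_allE fun e he => ?_
  simp only [List.mem_cons, List.not_mem_nil, or_false] at he
  rcases he with rfl | rfl
  · exact ⟨h1 _ _ hv.symm, True.intro⟩
  · refine avoids_notE (avoids_anyE fun e he => ?_)
    obtain ⟨z, hz, rfl⟩ := List.mem_map.1 he
    exact avoids_eqE (avoids_elemsE (ie := .reg 3) True.intro h0 hp z hz)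
      (avoids_getD (avoids_elemsE (ie := .get (nm (vd + 1) 1) (.reg 3))
        ⟨h1 _ _ hv'.symm, True.intro⟩ h0 hp))

section
variable {adj : ℕ → ℕ → Prop} {k m D T B n M L pd zd vd t : ℕ} {X Y : ℕ → ℕ}
  {NB : ℕ → ℕ → ℕ} {next : ℕ → Program} {df : ℕ → Prop} {pt : ℕ → ℕ → ℕ} {Z : ℕ → ℕ}
  {val : ℕ → Prop} {s : State}

theorem eval_branchE (henv : Env T n M X Y NB s) (hfr : Frame adj n M L pd zd Y df pt Z s)
    (hval : ∀ e < M, s.arr (nm vd 0) e ≠ 0 ↔ val e) (hv : Valid adj k M L X Y df pt val)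
    {ld : ℕ → ℕ} (hld : ∀ e < M, val e → s.arr (nm (vd + 1) 1) e = ld e ∧ ld e < M ∧ val (ld e))
    {e : ℕ} (he : e < M) (a : ℕ) :
    (branchE T L pd vd a).eval (s.setReg 3 e) ≠ 0 ↔ val e ∧
      (elems n T L NB (pt (Y (ld e)))).getD a 0 ∉ elems n T L NB (pt (Y e)) := by
  rw [branchE, allE_ne_zero]
  simp only [List.mem_cons, List.not_mem_nil, or_false, forall_eq_or_imp, forall_eq]
  have h3 : (Expr.reg 3).eval (s.setReg 3 e) = e := by simp [Expr.eval, State.setReg_reg]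
  have h0 : (s.setReg 3 e).reg 0 = n := by
    rw [State.setReg_reg, if_neg (by norm_num), henv.reg0]
  have hva : (Expr.get (nm vd 0) (.reg 3)).eval (s.setReg 3 e) ≠ 0 ↔ val e := by
    rw [← hval e he]; simp only [Expr.eval, State.setReg_arr, State.setReg_reg, if_true]
  rw [hva]
  refine and_congr_right fun hve => ?_
  obtain ⟨h1, h2, h4⟩ := hld e he hve
  have hlt : ∀ e < M, val e → ∀ i < L - 1, pathPt pd s (Y e) i < n := fun e he h i hi' => by
    rw [hfr.pt_eq]; exact hfr.fam.lt _ (hv e he h).1 i (by omega)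
  have e1 := eval_elemsE henv (State.setReg_arr s 3 e) h0 h3 he (hlt e he hve)
  have e2 := eval_elemsE (ie := .get (nm (vd + 1) 1) (.reg 3)) henv (State.setReg_arr s 3 e) h0
    (e := ld e) (by
      rw [← h1]; simp only [Expr.eval, State.setReg_arr, State.setReg_reg, if_true]) h2
    (hlt _ h2 h4)
  rw [hfr.pt_eq] at e1 e2
  have e3 : ((elemsE T L pd (.get (nm (vd + 1) 1) (.reg 3))).getD a (.lit 0)).eval
      (s.setReg 3 e) = (elems n T L NB (pt (Y (ld e)))).getD a 0 := by
    rw [← e2]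
    exact (List.getD_map _ (.lit 0) (Expr.eval (s.setReg 3 e))).symm
  rw [notE_ne_zero, ← not_iff_not, not_not, ← ne_eq, anyE_ne_zero, ← e1]
  simp only [List.mem_map, exists_exists_and_eq_and, eqE_ne_zero, e3]

/-- The set `Bs` of elements has to be avoided, and it suffices to avoid it. -/
def Blocks (n T k M L : ℕ) (X Y : ℕ → ℕ) (NB : ℕ → ℕ → ℕ) (pt : ℕ → ℕ → ℕ) (Z : ℕ → ℕ)
    (val : ℕ → Prop) (e : ℕ) (q : ℕ → ℕ) (Bs : Finset ℕ) : Prop :=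
  (∀ a ∈ elems n T L NB (pt (Y e)), a ∉ Bs) ∧
  ∀ e' < M, val e' → X e' = X e → Z e' = Z e → (∀ a ∈ elems n T L NB (pt (Y e')), a ∉ Bs) →
    ∀ a ∈ elems n T L NB (pt (Y e')), a ∉ restSet n T k (L + 1) NB q

/-- A cycle through a candidate can be rerouted along another candidate. -/
theorem exists_isCyc_of_disjoint (hk : 3 ≤ k) (hi : Inst k m D T B n M adj X Y NB)
    (hfr : Frame adj n M L pd zd Y df pt Z s) (hv : Valid adj k M L X Y df pt val) {e g : ℕ}
    (he : e < M) (hve : val e) (hg : g < M) (hvg : val g) (hx : X g = X e) (hz : Z g = Z e)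
    {q : ℕ → ℕ} (hq : IsCyc adj k q) (hqc : ∀ i < L + 1, q i = consPath (X e) (pt (Y e)) i)
    (hd : ∀ a ∈ elems n T L NB (pt (Y g)), a ∉ restSet n T k (L + 1) NB q) :
    ∃ q', IsCyc adj k q' ∧ ∀ i < L + 1, q' i = consPath (X g) (pt (Y g)) i := by
  have hL := hfr.fam.pos
  obtain ⟨hdg, hsg⟩ := hv g hg hvg
  have hde := (hv e he hve).1
  rw [disjoint_restSet_iff hi.nb (fun i hi' => hfr.fam.lt _ hdg i (by omega))
    (hq.lt hk hi.edges)] at hd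
  -- Both candidates have the same ends, so only the inner vertices of the segment are exchanged.
  refine ⟨_, hq.replace hi.edges.symm hsg ?_ ?_ ?_, fun i hi' => if_pos hi'⟩
  · rw [hqc 0 (by omega), consPath_zero, consPath_zero, hx]
  · rw [hqc _ (by omega), Nat.add_sub_cancel, consPath, consPath, if_neg (by omega),
      if_neg (by omega), ← hfr.z_eq g hg hdg, ← hfr.z_eq e he hde, hz]
  · intro i hi0 hiL j hj hLj
    obtain ⟨i, rfl⟩ := Nat.exists_eq_succ_of_ne_zero hi0.ne'
    exact hd i (by omega) j hj hLj

end

/-- The search below a node. -/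
theorem nodeP_spec {k m D T L pd zd : ℕ} {next : ℕ → Program} (hk : 3 ≤ k) (hLk : L + 1 ≤ k)
    (hnext : ∀ d, 1 ≤ d → SearchSpec k m D T (L + 1) d (next d)) :
    ∀ b vd, pd ≤ vd → zd ≤ vd → ∃ C, ∀ (B n M : ℕ) (adj : ℕ → ℕ → Prop) (X Y : ℕ → ℕ)
      (NB : ℕ → ℕ → ℕ), Inst k m D T B n M adj X Y NB → ∀ (df : ℕ → Prop) (pt : ℕ → ℕ → ℕ)
      (Z : ℕ → ℕ) (val : ℕ → Prop) (s : State), Bdd B s → Env T n M X Y NB s →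
      Frame adj n M L pd zd Y df pt Z s → FoundInv adj k n s →
      (∀ e < M, s.arr (nm vd 0) e ≠ 0 ↔ val e) → Valid adj k M L X Y df pt val →
      Run B (nodeP D T L pd zd next b vd) s (C * timeUnit B) fun s' => Progress adj k n vd s s' ∧
        ∀ e < M, val e → ∀ q, IsCyc adj k q →
          (∀ i < L + 1, q i = consPath (X e) (pt (Y e)) i) → ∀ Bs : Finset ℕ, Bs.card ≤ b →
          Blocks n T k M L X Y NB pt Z val e q Bs → s'.reg 2 ≠ 0 := by
  have hcore : ∀ C B : ℕ, 2 * B ≤ timeUnit B → 3 ≤ B → 200 * B + (1000 * timeUnit B +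
      (((100 * (L + 2) * B + C * timeUnit B) * D + 1) +
        ((100 * (L + 2) * B + C * timeUnit B) * D + 1))) ≤
      (1200 + 2 * ((100 * (L + 2) + C) * D)) * timeUnit B := by
    intro C B h h'
    have h1 : (100 * (L + 2) * B + C * timeUnit B) * D ≤
        ((100 * (L + 2) + C) * D) * timeUnit B := by
      calc (100 * (L + 2) * B + C * timeUnit B) * D
          ≤ (100 * (L + 2) * timeUnit B + C * timeUnit B) * D := by gcongr; omega
        _ = _ := by ring
    calc _ ≤ 1200 * timeUnit B + (((100 * (L + 2) + C) * D) * timeUnit B +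
        ((100 * (L + 2) + C) * D) * timeUnit B) := by omega
      _ = _ := by ring
  intro b
  induction b with
  | zero =>
    intro vd hpd hzd
    obtain ⟨C, hC⟩ := hnext (vd + 3) (by omega)
    refine ⟨1200 + 2 * ((100 * (L + 2) + C) * D),
      fun B n M adj X Y NB hi df pt Z val s hs henv hfr hf hval hv => ?_⟩
    have hMB := hi.M_le
    refine Run.mono (run_coreP (hC B n M adj X Y NB hi) hLk hi hs henv hfr hf hpd hzd hval hv)
      (hcore C B hi.timeUnit_le (by omega)) ?_
    rintro s' - ⟨hp, ld, hld, -, hfound⟩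
    refine ⟨hp, fun e he hve q hq hqc Bs hBs hbl => ?_⟩
    -- With nothing left to avoid, `Blocks` says that the leader of the group is free of conflicts.
    obtain rfl : Bs = ∅ := Finset.card_eq_zero.1 (Nat.le_zero.1 hBs)
    obtain ⟨-, h1, h2, h3, h4⟩ := hld e he hve
    obtain ⟨q', hq', hqc'⟩ := exists_isCyc_of_disjoint hk hi hfr hv he hve h1 h2 h3 h4 hq hqc
      (hbl.2 _ h1 h2 h3 h4 (by simp))
    exact hfound e he hve q' hq' hqc'
  | succ b ih =>
    intro vd hpd hzd
    obtain ⟨C, hC⟩ := hnext (vd + 3) (by omega)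
    obtain ⟨C', hC'⟩ := ih (vd + 3) (by omega) (by omega)
    obtain ⟨c, hc⟩ : ∃ c, ∀ a < (L - 1) * (T + 2), (branchE T L pd vd a).cost + 12 ≤ c :=
      ⟨_, fun a ha => Finset.le_sup (f := fun a => (branchE T L pd vd a).cost + 12)
        (Finset.mem_range.2 ha)⟩
    refine ⟨(1200 + 2 * ((100 * (L + 2) + C) * D)) + ((c + C') * ((L - 1) * (T + 2)) + 1),
      fun B n M adj X Y NB hi df pt Z val s hs henv hfr hf hval hv => ?_⟩
    have hMB := hi.M_le
    have htu := hi.timeUnit_le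
    refine Run.mono (Run.seq hs (run_coreP (hC B n M adj X Y NB hi) hLk hi hs henv hfr hf hpd hzd
      hval hv) (t' := (c + C') * timeUnit B * ((L - 1) * (T + 2)) + 1) ?_) ?_ (fun _ _ h => h)
    swap
    · calc _ ≤ (1200 + 2 * ((100 * (L + 2) + C) * D)) * timeUnit B +
          ((c + C') * timeUnit B * ((L - 1) * (T + 2)) + timeUnit B) := by
            have := hcore C B htu (by omega)
            omega
        _ = _ := by ring
    rintro s₁ hs₁ ⟨hp₁, ld, hld, hsame, hfound⟩
    -- Branch `a` discards the candidates that share element number `a` of the leader of their own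
    -- group; different groups may lose different elements.
    let val' : ℕ → ℕ → Prop := fun a e => val e ∧
      (elems n T L NB (pt (Y (ld e)))).getD a 0 ∉ elems n T L NB (pt (Y e))
    refine Run.mono (run_seqP (c := (c + C') * timeUnit B) _
      (fun s' => Progress adj k n (vd + 2) s₁ s') (fun a s' => ∀ e < M, val' a e →
        ∀ q, IsCyc adj k q → (∀ i < L + 1, q i = consPath (X e) (pt (Y e)) i) →
        ∀ Bs : Finset ℕ, Bs.card ≤ b → Blocks n T k M L X Y NB pt Z (val' a) e q Bs →
        s'.reg 2 ≠ 0) (List.range ((L - 1) * (T + 2))) ?_ s₁ hs₁ (Progress.refl _ hp₁.inv))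
      (by simp) ?_
    · intro a ha s₂ hs₂ hp₂
      rw [List.mem_range] at ha
      have hp₁₂ := hp₁.trans (hp₂.le (by omega))
      have henv₂ := henv.keep hp₁₂.keep
      have hfr₂ := hfr.keep hp₁₂.keep hpd hzd
      refine Run.mono (Run.seq hs₂ (run_mapP hs₂ (by omega) (by norm_num) henv₂.reg1
        (avoids_branchE (by simp [nm]) (by simp [nm]; omega) (by simp [nm]) (by simp [nm]))
        (fun e _ => allE_le.trans (by omega))) ?_ (t' := C' * timeUnit B)) ?_ (fun _ _ h => h)
      · rintro s₃ hs₃ e₃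
        have hk₃ : KeepDepth (vd + 3) s₂ s₃ := by
          subst e₃
          exact ⟨fun r hr => State.put_reg _ _ _ _ (by omega), fun d' t hd' =>
            State.put_arr_ne _ _ _ (by simp [hd'])⟩
        have hp₃ : Progress adj k n (vd + 2) s₂ s₃ := hk₃.progress (by omega) hp₂.inv
        have hp₁₃ := hp₁₂.trans (hp₃.le (by omega))
        have hval' : ∀ e < M, s₃.arr (nm (vd + 3) 0) e ≠ 0 ↔ val' a e := by
          intro e he
          rw [e₃, State.put_arr_same _ _ _ he]
          refine eval_branchE henv₂ hfr₂ (fun e he => ?_) hv (fun e he hve => ?_) he a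
          · rw [hp₁₂.keep.2 _ le_rfl _ (by simp)]; exact hval e he
          · rw [hp₂.keep.2 _ (by omega) _ (by simp)]
            obtain ⟨h1, h2, h3, -⟩ := hld e he hve
            exact ⟨h1, h2, h3⟩
        refine Run.mono (hC' B n M adj X Y NB hi df pt Z (val' a) s₃ hs₃
          (henv.keep hp₁₃.keep) (hfr.keep hp₁₃.keep hpd hzd) hp₃.inv hval'
          (fun e he h => hv e he h.1)) le_rfl ?_
        rintro s₄ - ⟨hp₄, hg₄⟩
        have hp₂₄ := hp₃.trans (hp₄.le (by omega))
        exact ⟨hp₂.trans hp₂₄, hg₄, fun a' h e he hve q hq hqc Bs hBs hbl =>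
          hp₂₄.found (h e he hve q hq hqc Bs hBs hbl)⟩
      · rw [add_mul c C']
        refine Nat.add_le_add_right ?_ _
        calc _ ≤ timeUnit B * c := Nat.mul_le_mul (by omega) (hc a ha)
          _ = _ := mul_comm _ _
    · rintro s' - ⟨hp', hG, -⟩
      refine ⟨hp₁.trans (hp'.le (by omega)), fun e he hve q hq hqc Bs hBs hbl => ?_⟩
      obtain ⟨-, h1, h2, h3, h4⟩ := hld e he hve
      -- If the leader avoids `Bs`, the cycle can be rerouted along it and the core finds a cycle.
      -- Otherwise it meets `Bs` in some element, say its number `a`. The candidate `e` avoids this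
      -- element, so it survives in branch `a`, where the element may be dropped from `Bs`.
      by_cases hd : ∀ a ∈ elems n T L NB (pt (Y (ld e))), a ∉ Bs
      · obtain ⟨q', hq', hqc'⟩ := exists_isCyc_of_disjoint hk hi hfr hv he hve h1 h2 h3 h4 hq hqc
          (hbl.2 _ h1 h2 h3 h4 hd)
        exact hp'.found (hfound e he hve q' hq' hqc')
      · push Not at hd
        obtain ⟨x, hx, hxB⟩ := hd
        obtain ⟨a, ha, rfl⟩ := List.getElem_of_mem hx
        have hgetD : (elems n T L NB (pt (Y (ld e)))).getD a 0 =
            (elems n T L NB (pt (Y (ld e))))[a] := by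
          rw [List.getD_eq_getElem?_getD, List.getElem?_eq_getElem ha]; rfl
        have hnot : (elems n T L NB (pt (Y (ld e)))).getD a 0 ∉ elems n T L NB (pt (Y e)) := by
          rw [hgetD]; exact fun h => hbl.1 _ h hxB
        refine hG a (List.mem_range.2 (by rwa [length_elems] at ha)) e he ⟨hve, hnot⟩ q hq hqc
          (Bs.erase _) (by rw [Finset.card_erase_of_mem hxB]; omega) ⟨?_, ?_⟩
        · exact fun x hx h => hbl.1 x hx (Finset.mem_of_mem_erase h)
        -- Candidates of the same group have the same leader, so in this branch they all avoid the
        -- dropped element, and avoiding the smaller set is as good as before.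
        · rintro e' he' ⟨hve', hne'⟩ hx' hz' hdis
          rw [hsame e' he' e he hve' hve hx' hz', hgetD] at hne'
          refine hbl.2 e' he' hve' hx' hz' fun y hy hyB => ?_
          refine hdis y hy (Finset.mem_erase.2 ⟨?_, hyB⟩)
          rintro rfl
          exact hne' hy

/-! ### The search -/

/-- Search for cycles that prolong the paths of length `k - 1 - r` stored at depth `d`. -/
def searchP (k D T : ℕ) : ℕ → ℕ → Program
  | 0, d => finalP k T (k - 1) d
  | r + 1, d =>
    .seq (mapP 1 (nm (d + 1) 0) (validE k T (k - 2 - r) d))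
      (.seq (mapP 1 (nm (d + 1) 1) (iteE (.get (nm d 9) (.get (nm 0 1) (.reg 3)))
          (.get (nm d (10 + (k - 2 - r - 1))) (.get (nm 0 1) (.reg 3))) (.lit 0)))
        (nodeP D T (k - 2 - r) d (d + 1) (searchP k D T r) (k * (T + 1)) (d + 1)))

/-- There are boundedly many prolongations still to come, and each multiplies the cost only by a
constant, so the total stays a constant multiple of `timeUnit B`. -/
theorem searchP_spec {k m D T : ℕ} (hk : 3 ≤ k) : ∀ r, r + 2 ≤ k → ∀ d, 1 ≤ d →
    SearchSpec k m D T (k - 1 - r) d (searchP k D T r d)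
  | 0, _, d, _ => finalP_spec hk (by omega)
  | r + 1, hr, d, hd => by
    have ih := fun d hd => searchP_spec (m := m) (D := D) (T := T) hk r (by omega) d hd
    obtain ⟨L, hL⟩ : ∃ L, L = k - 2 - r := ⟨_, rfl⟩
    rw [show k - 1 - r = L + 1 by omega] at ih
    rw [show k - 1 - (r + 1) = L by omega, searchP, ← hL]
    obtain ⟨C, hC⟩ := nodeP_spec (pd := d) (zd := d + 1) hk (by omega : L + 1 ≤ k) ih (k * (T + 1))
      (d + 1) (by omega) le_rfl
    obtain ⟨c₁, hc₁⟩ : ∃ c, c = (validE k T L d).cost + 12 := ⟨_, rfl⟩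
    -- Outside the domain of the paths the last vertex is set to `0`. This keeps all values below
    -- `n`, which `groupP` and `peelP` need since they index arrays by them.
    set ze : Expr := iteE (.get (nm d 9) (.get (nm 0 1) (.reg 3)))
          (.get (nm d (10 + (L - 1))) (.get (nm 0 1) (.reg 3))) (.lit 0) with hze
    obtain ⟨c₂, hc₂⟩ : ∃ c, c = ze.cost + 12 := ⟨_, rfl⟩
    refine ⟨c₁ + (c₂ + C), fun B n M adj X Y NB hi s hs henv hp hf => ?_⟩
    have hMB := hi.M_le
    have htu := hi.timeUnit_le
    have hput : ∀ (s : State) t g, KeepDepth (d + 1) s (s.put (nm (d + 1) t) M g) := fun s t g =>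
      ⟨fun r hr => State.put_reg _ _ _ _ (by omega), fun d' t hd' =>
        State.put_arr_ne _ _ _ (by simp [hd'])⟩
    rw [add_mul c₁, add_mul c₂]
    refine Run.seq hs (Run.mono (run_mapP hs (by omega) (by norm_num) henv.reg1
      (avoids_validE (by simp [nm]) (by simp [nm])) (fun e _ => allE_le.trans (by omega)))
      (by rw [← hc₁, mul_comm]; exact Nat.mul_le_mul_left _ (by omega)) (fun _ _ h => h)) ?_
    rintro s₁ hs₁ e₁
    have hk₁ : KeepDepth (d + 1) s s₁ := by rw [e₁]; exact hput _ _ _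
    have hp₁ : Progress adj k n d s s₁ := hk₁.progress (by omega) hf
    have henv₁ := henv.keep hp₁.keep
    obtain ⟨hdf₁, hpt₁⟩ := hp₁.keep.paths (n := n) le_rfl
    have hzev : ∀ e < M, ze.eval (s₁.setReg 3 e) = if s.arr (nm d 9) (Y e) ≠ 0 then
        pathPt d s (Y e) (L - 1) else 0 := by
      intro e he
      rw [hze, eval_iteE]
      simp only [Expr.eval, State.setReg_arr, State.setReg_reg, if_true, henv₁.tgt e he]
      rw [← hpt₁, hk₁.2 _ _ (by omega)]; rfl
    refine Run.seq hs₁ (Run.mono (run_mapP hs₁ (by omega) (by norm_num) henv₁.reg1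
      (show ze.avoids _ from avoids_iteE ⟨by simp, by simp, True.intro⟩
        ⟨by simp, by simp, True.intro⟩ True.intro)
      (fun e he => ?_)) (by rw [← hc₂, mul_comm]; exact Nat.mul_le_mul_left _ (by omega))
      (fun _ _ h => h)) ?_
    · rw [hzev e he]; split_ifs
      exacts [hs.arr _ _, Nat.zero_le _]
    rintro s₂ hs₂ e₂
    have hk₂ : KeepDepth (d + 1) s₁ s₂ := by rw [e₂]; exact hput _ _ _
    have hp₂ : Progress adj k n d s s₂ := hp₁.trans (hk₂.progress (by omega) hp₁.inv)
    have henv₂ := henv.keep hp₂.keep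
    obtain ⟨hdf₂, hpt₂⟩ := hp₂.keep.paths (n := n) le_rfl
    have hn0 : ∀ e < M, 0 < n := fun e he => (Nat.zero_le _).trans_lt (hi.edges.lt e he).1
    have hfr : Frame adj n M L d (d + 1) Y (pathDf n d s) (pathPt d s)
        (fun e => if s.arr (nm d 9) (Y e) ≠ 0 then pathPt d s (Y e) (L - 1) else 0) s₂ := by
      refine ⟨hp, hdf₂, hpt₂, fun e he => ?_, fun e he => ?_, fun e he h => if_pos h.2⟩
      · rw [e₂, State.put_arr_same _ _ _ he]; exact hzev e he
      · split_ifs with h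
        · exact hp.lt _ ⟨(hi.edges.lt e he).2, h⟩ _ (by have := hp.pos; omega)
        · exact hn0 e he
    refine Run.mono (hC B n M adj X Y NB hi _ _ _ (fun e => pathDf n d s (Y e) ∧
      IsSeg adj k (L + 1) (consPath (X e) (pathPt d s (Y e)))) s₂ hs₂ henv₂ hfr hp₂.inv ?_
      (fun e he h => h)) le_rfl ?_
    · intro e he
      rw [e₂, State.put_arr_ne _ _ _ (by simp), e₁, State.put_arr_same _ _ _ he]
      exact eval_validE hi henv hp he rfl (by simp [State.setReg_reg])
    · rintro s₃ - ⟨hp₃, hG⟩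
      refine ⟨hp₂.trans (hp₃.le (by omega)), fun v q hv hq hqv => ?_⟩
      obtain ⟨e, he, q', h1, h2, h3⟩ := exists_candidate hk hi.edges hp hq hv hqv
      have hseg := h2.isSeg (by omega) h3
      -- The initial set to avoid is `restSet` of the cycle that is sought; its size is the number
      -- of levels provided in `nodeP`.
      refine hG e he ⟨h1, hseg⟩ q' h2 h3 (restSet n T k (L + 1) NB q') card_restSet_le
        ⟨?_, fun e' he' _ _ _ h => h⟩
      rw [disjoint_restSet_iff hi.nb (fun i hi' => hp.lt _ h1 i (by omega)) (h2.lt hk hi.edges)]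
      intro i hi' j hj hLj
      -- Position `i + 1` is inside the segment `0, …, L`, so it is not consecutive to a position `j
      -- ≥ L + 1` of the induced cycle.
      have := h2 (i + 1) (by omega) j hj (by omega)
      rw [h3 (i + 1) (by omega), consPath_succ] at this
      refine ⟨this.1, fun h => ?_⟩
      have := this.2.1 h
      unfold CycAdj at this
      omega

/-! ### From the memory layout of the input to the final statement. -/

/-! ### Reading the input -/

/-- The neighbours of `x < n` are `Y e` for `off x ≤ e < off (x + 1)`. -/
structure Layout (adj : ℕ → ℕ → Prop) (n M : ℕ) (off Y : ℕ → ℕ) : Prop where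
  symm : ∀ u v, adj u v → adj v u
  irrefl : ∀ u, ¬ adj u u
  zero : off 0 = 0
  last : off n = M
  step : ∀ x < n, off x ≤ off (x + 1)
  edge : ∀ x < n, ∀ e, off x ≤ e → e < off (x + 1) → adj x (Y e)
  surj : ∀ u v, adj u v → u < n ∧ ∃ e, off u ≤ e ∧ e < off (u + 1) ∧ Y e = v
  inj : ∀ x < n, ∀ e e', off x ≤ e → e < off (x + 1) → off x ≤ e' → e' < off (x + 1) →
    Y e = Y e' → e = e'

section
variable {adj : ℕ → ℕ → Prop} {n M : ℕ} {off Y : ℕ → ℕ}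

theorem Layout.mono (h : Layout adj n M off Y) {x y : ℕ} (hxy : x ≤ y) (hy : y ≤ n) :
    off x ≤ off y := by
  induction y, hxy using Nat.le_induction with
  | base => exact le_rfl
  | succ y _ ih => exact (ih (by omega)).trans (h.step y (by omega))

theorem Layout.exists_src (h : Layout adj n M off Y) : ∃ X : ℕ → ℕ, ∀ e < M,
    X e < n ∧ off (X e) ≤ e ∧ e < off (X e + 1) := by
  suffices ∀ e, ∃ x, e < M → x < n ∧ off x ≤ e ∧ e < off (x + 1) by
    choose X hX using this
    exact ⟨X, hX⟩
  intro e
  by_cases he : e < M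
  · have hex : ∃ x, e < off x := ⟨n, by rwa [h.last]⟩
    have h1 := Nat.find_spec hex
    have h0 : Nat.find hex ≠ 0 := fun h0 => by rw [h0, h.zero] at h1; omega
    have hn : Nat.find hex ≤ n := Nat.find_min' hex (by rwa [h.last])
    refine ⟨Nat.find hex - 1, fun _ => ⟨by omega, ?_, ?_⟩⟩
    · exact not_lt.1 (Nat.find_min hex (by omega))
    · rwa [Nat.sub_add_cancel (by omega)]
  · exact ⟨0, fun h => absurd h he⟩

variable {X : ℕ → ℕ}

theorem Layout.src_eq (h : Layout adj n M off Y)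
    (hX : ∀ e < M, X e < n ∧ off (X e) ≤ e ∧ e < off (X e + 1)) {x e : ℕ} (hx : x < n)
    (h1 : off x ≤ e) (h2 : e < off (x + 1)) : e < M ∧ X e = x := by
  have he : e < M := h2.trans_le (by rw [← h.last]; exact h.mono (by omega) le_rfl)
  obtain ⟨a, b, c⟩ := hX e he
  refine ⟨he, ?_⟩
  rcases lt_trichotomy (X e) x with h' | h' | h'
  · have := h.mono (show X e + 1 ≤ x from h') hx.le
    omega
  · exact h'
  · have := h.mono (show x + 1 ≤ X e from h') a.le
    omega

theorem Layout.edgeList (h : Layout adj n M off Y)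
    (hX : ∀ e < M, X e < n ∧ off (X e) ≤ e ∧ e < off (X e + 1)) : EdgeList adj n M X Y where
  symm := h.symm
  irrefl := h.irrefl
  edge e he := h.edge _ (hX e he).1 e (hX e he).2.1 (hX e he).2.2
  lt e he := ⟨(hX e he).1,
    (h.surj _ _ (h.symm _ _ (h.edge _ (hX e he).1 e (hX e he).2.1 (hX e he).2.2))).1⟩
  surj u v huv := by
    obtain ⟨hu, e, h1, h2, h3⟩ := h.surj u v huv
    obtain ⟨he, h4⟩ := h.src_eq hX hu h1 h2
    exact ⟨e, he, h4, h3⟩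
  mono e e' hee he' := by
    obtain ⟨a, b, c⟩ := hX e (by omega)
    obtain ⟨a', b', c'⟩ := hX e' he'
    by_contra hlt
    have := h.mono (show X e' + 1 ≤ X e by omega) a.le
    omega
  inj e he e' he' hx hy := by
    obtain ⟨a, b, c⟩ := hX e he
    obtain ⟨a', b', c'⟩ := hX e' he'
    rw [← hx] at b' c'
    exact h.inj _ a e e' b c b' c' hy

/-- Graphs without a large complete minor are sparse. -/
theorem EdgeList.sparse (h : EdgeList adj n M X Y) {k m : ℕ} (hk : 2 ≤ k)
    (hm : ¬ KModel adj m {v | v < n}) (S : Finset ℕ) (hS : ∀ e ∈ S, e < M) :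
    S.card ≤ density k m * ((S.image X).card + (S.image Y).card) := by
  refine PathFam.sparse (df := fun v => v < n) (pt := fun v _ => v) h.symm hm
    (PathFam.trivial adj n (fun _ h => h) (fun _ _ => rfl)) hk S X Y ?_ ?_ ?_ _ _
    (fun e he => Finset.mem_image_of_mem _ he) (fun e he => Finset.mem_image_of_mem _ he)
  · exact fun e he => ⟨(h.lt e (hS e he)).1, (h.lt e (hS e he)).2, h.edge e (hS e he)⟩
  · intro e he i hi j hj hij
    have hne : X e ≠ Y e := fun h' => h.irrefl _ (by have := h.edge e (hS e he); rwa [h'] at this)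
    have hi2 : i = 0 ∨ i = 1 := by omega
    have hj2 : j = 0 ∨ j = 1 := by omega
    rcases hi2 with rfl | rfl <;> rcases hj2 with rfl | rfl <;> simp [consPath] at hij ⊢
    · exact hne hij
    · exact hne hij.symm
  · exact fun e he e' he' => h.inj e (hS e he) e' (hS e' he')

/-- Sparsity for the set of all edges: their number is linear in `n`, and so is the memory bound. -/
theorem EdgeList.card_le (h : EdgeList adj n M X Y) {k m : ℕ} (hk : 2 ≤ k)
    (hm : ¬ KModel adj m {v | v < n}) : M ≤ density k m * (2 * n) := by
  have := h.sparse hk hm (Finset.range M) (fun e he => Finset.mem_range.1 he)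
  rw [Finset.card_range] at this
  refine this.trans (Nat.mul_le_mul_left _ ?_)
  have hle : ∀ f : ℕ → ℕ, (∀ e < M, f e < n) → ((Finset.range M).image f).card ≤ n := fun f hf => by
    refine (Finset.card_le_card (t := Finset.range n) ?_).trans (by simp)
    exact Finset.image_subset_iff.2 fun e he => by simpa using hf e (by simpa using he)
  have h1 := hle X fun e he => (h.lt e he).1
  have h2 := hle Y fun e he => (h.lt e he).2
  omega

end

/-- Store the first ends of all edges. -/
def sourceP : Program :=
  .loop (.op .lt (.reg 3) (.reg 1))
    (.ite (.op .lt (.reg 3) (.get (nm 0 0) (.op .add (.reg 4) (.lit 1))))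
      (.seq (.store (nm 0 2) (.reg 3) (.reg 4)) (.assign 3 (.op .add (.reg 3) (.lit 1))))
      (.assign 4 (.op .add (.reg 4) (.lit 1))))

/-- Each step advances the edge in register `3` or the vertex in register `4`, so `n + M` steps
suffice; vertices without neighbours are passed by steps of the second kind. -/
theorem run_sourceP {adj : ℕ → ℕ → Prop} {n M B : ℕ} {off X Y : ℕ → ℕ} {s : State}
    (hs : Bdd B s) (h : Layout adj n M off Y)
    (hX : ∀ e < M, X e < n ∧ off (X e) ≤ e ∧ e < off (X e + 1)) (hnB : n ≤ B) (hMB : M ≤ B)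
    (hr1 : s.reg 1 = M) (hr3 : s.reg 3 = 0) (hr4 : s.reg 4 = 0)
    (hoff : ∀ x ≤ n, s.arr (nm 0 0) x = off x) :
    Run B sourceP s (100 * B) fun s' => (∀ r < 3, s'.reg r = s.reg r) ∧
      (∀ a ≠ nm 0 2, s'.arr a = s.arr a) ∧ ∀ e < M, s'.arr (nm 0 2) e = X e := by
  have h2B := hs.two_le
  let Inv : ℕ → State → Prop := fun j s' => (∀ r < 3, s'.reg r = s.reg r) ∧
    (∀ a ≠ nm 0 2, s'.arr a = s.arr a) ∧ s'.reg 3 + s'.reg 4 + j = n + M ∧ s'.reg 3 ≤ M ∧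
    s'.reg 4 ≤ n ∧ off (s'.reg 4) ≤ s'.reg 3 ∧ ∀ e < s'.reg 3, s'.arr (nm 0 2) e = X e
  have hcond : ∀ s' : State, (∀ r < 3, s'.reg r = s.reg r) →
      ((Expr.op .lt (.reg 3) (.reg 1)).eval s' ≠ 0 ↔ s'.reg 3 < M) := by
    intro s' hr
    simp only [Expr.eval, BinOp.eval, hr 1 (by norm_num), hr1]
    split_ifs with hc <;> simp [hc]
  refine Run.mono (Run.loop (t := 20) Inv (n + M) hs ?_ ?_ ?_)
    (by simp only [Expr.cost]; nlinarith) ?_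
  · refine ⟨fun _ _ => rfl, fun _ _ => rfl, by omega, by omega, by omega, ?_, ?_⟩
    · rw [hr4, h.zero]; exact Nat.zero_le _
    · intro e he; omega
  · rintro j s' ⟨hr, ha, hj, h3, h4, hle, hsrc⟩ hc
    rw [hcond s' hr] at hc
    omega
  · rintro j s' hs' ⟨hr, ha, hj, h3, h4, hle, hsrc⟩ hc
    rw [hcond s' hr] at hc
    have h4n : s'.reg 4 < n := by
      rcases h4.lt_or_eq with h' | h'
      · exact h'
      · rw [h', h.last] at hle; omega
    have hev : (Expr.op .lt (.reg 3) (.get (nm 0 0) (.op .add (.reg 4) (.lit 1)))).eval s' =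
        if s'.reg 3 < off (s'.reg 4 + 1) then 1 else 0 := by
      show (if s'.reg 3 < s'.arr (nm 0 0) (s'.reg 4 + 1) then 1 else 0) = _
      rw [ha _ (by simp), hoff _ h4n]
    refine Run.ite hs' (t := 10) ?_ ?_ (by simp [Expr.cost])
    · intro hc'
      have hlt : s'.reg 3 < off (s'.reg 4 + 1) := by
        by_contra hc''; rw [hev, if_neg hc''] at hc'; exact hc' rfl
      obtain ⟨-, hXe⟩ := h.src_eq hX h4n hle hlt
      refine Run.mono (Run.seq hs' (Run.store hs' (t := 3)
        (Q := (· = s'.setArr (nm 0 2) (s'.reg 3) (s'.reg 4))) (hs'.reg 4) rfl le_rfl) ?_ (t' := 4))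
        (by norm_num) (fun _ _ h => h)
      rintro s₁ hs₁ rfl
      refine Run.assign hs₁ (by simp only [Expr.eval, BinOp.eval, State.setArr_reg]; omega) ?_ le_rfl
      have e3 : (Expr.op .add (.reg 3) (.lit 1)).eval
          (s'.setArr (nm 0 2) (s'.reg 3) (s'.reg 4)) = s'.reg 3 + 1 := rfl
      rw [e3]
      refine ⟨fun r hr' => ?_, fun a ha' => ?_, ?_, ?_, ?_, ?_, ?_⟩
      · rw [State.setReg_reg, if_neg (by omega)]; exact hr r hr'
      · rw [State.setReg_arr, ← ha a ha']
        funext x; simp [State.setArr_arr, ha']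
      all_goals simp only [State.setReg_reg, State.setReg_arr, State.setArr_reg, if_true,
        show (4 : ℕ) ≠ 3 by norm_num, if_false]
      · omega
      · omega
      · omega
      · omega
      · intro e he
        rw [State.setArr_arr]
        by_cases hee : e = s'.reg 3
        · rw [if_pos ⟨rfl, hee⟩, hee, hXe]
        · rw [if_neg (by simp [hee])]; exact hsrc e (by omega)
    · intro hc'
      have hlt : off (s'.reg 4 + 1) ≤ s'.reg 3 := by
        by_contra hc''; rw [hev, if_pos (by omega)] at hc'; exact one_ne_zero hc'
      refine Run.assign hs' (by simp only [Expr.eval, BinOp.eval]; omega) ?_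
        (by simp [Expr.cost])
      have e4 : (Expr.op .add (.reg 4) (.lit 1)).eval s' = s'.reg 4 + 1 := rfl
      rw [e4]
      refine ⟨fun r hr' => ?_, fun a ha' => ?_, ?_, ?_, ?_, ?_, ?_⟩
      · rw [State.setReg_reg, if_neg (by omega)]; exact hr r hr'
      · exact ha a ha'
      all_goals simp only [State.setReg_reg, State.setReg_arr, if_true,
        show (3 : ℕ) ≠ 4 by norm_num, if_false]
      · omega
      · omega
      · omega
      · exact hlt
      · exact hsrc
  · rintro s' - ⟨hc, j, hr, ha, hj, h3, h4, hle, hsrc⟩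
    refine ⟨hr, ha, fun e he => hsrc e ?_⟩
    have : ¬ s'.reg 3 < M := fun h => (hcond s' hr).2 h hc
    omega

/-- The out-neighbours in an orientation. -/
def nbE (D t : ℕ) : Expr :=
  if t < D then
    iteE (.get (nm 1 6) (.op .add (.op .mul (.reg 3) (.lit D)) (.lit t)))
      (.get (nm 0 1)
        (.op .sub (.get (nm 1 6) (.op .add (.op .mul (.reg 3) (.lit D)) (.lit t))) (.lit 1)))
      (.reg 3)
  else
    iteE (.get (nm 1 7) (.op .add (.op .mul (.reg 3) (.lit D)) (.lit (t - D))))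
      (.get (nm 0 2)
        (.op .sub (.get (nm 1 7) (.op .add (.op .mul (.reg 3) (.lit D)) (.lit (t - D)))) (.lit 1)))
      (.reg 3)

/-- The values of `nbE`, in terms of the arcs of the orientation. -/
def nbVal (D : ℕ) (X Y arcL arcR : ℕ → ℕ) (t v : ℕ) : ℕ :=
  if t < D then if arcL (v * D + t) ≠ 0 then Y (arcL (v * D + t) - 1) else v
  else if arcR (v * D + (t - D)) ≠ 0 then X (arcR (v * D + (t - D)) - 1) else v

/-- Arcs of left ends lead to `Y`, those of right ends to `X`. An empty slot yields `v` itself,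
which is harmless because adjacency is only asked for distinct vertices. -/
theorem EdgeList.outNb {adj : ℕ → ℕ → Prop} {n M D : ℕ} {X Y arcL arcR : ℕ → ℕ}
    (h : EdgeList adj n M X Y)
    (harc : ∀ e < M, (∃ j < D, arcL (X e * D + j) = e + 1) ∨ ∃ j < D, arcR (Y e * D + j) = e + 1)
    (hL : ∀ x < n, ∀ j < D, ∀ e, arcL (x * D + j) = e + 1 → e < M ∧ X e = x)
    (hR : ∀ x < n, ∀ j < D, ∀ e, arcR (x * D + j) = e + 1 → e < M ∧ Y e = x) :
    OutNb adj n (2 * D) (nbVal D X Y arcL arcR) := by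
  have key : ∀ t < 2 * D, ∀ v < n, nbVal D X Y arcL arcR t v = v ∨
      adj v (nbVal D X Y arcL arcR t v) := by
    intro t ht v hv
    unfold nbVal
    split_ifs with h1 h2 h2
    · obtain ⟨e, he⟩ := Nat.exists_eq_succ_of_ne_zero h2
      obtain ⟨a, b⟩ := hL v hv t h1 e he
      right; rw [he, Nat.succ_sub_one, ← b]; exact h.edge e a
    · exact Or.inl rfl
    · obtain ⟨e, he⟩ := Nat.exists_eq_succ_of_ne_zero h2
      obtain ⟨a, b⟩ := hR v hv _ (by omega) e he
      right; rw [he, Nat.succ_sub_one, ← b]; exact h.symm _ _ (h.edge e a)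
    · exact Or.inl rfl
  refine ⟨fun t ht v hv => ?_, fun u hu v hv => ⟨fun huv => ⟨?_, ?_⟩, ?_⟩⟩
  · rcases key t ht v hv with h' | h'
    · rwa [h']
    · exact h.lt_of_adj (h.symm _ _ h')
  · rintro rfl; exact h.irrefl _ huv
  · obtain ⟨e, he, rfl, rfl⟩ := h.surj u v huv
    rcases harc e he with ⟨j, hj, hg⟩ | ⟨j, hj, hg⟩
    · exact ⟨j, by omega, Or.inl (by simp [nbVal, hj, hg])⟩
    · exact ⟨D + j, by omega, Or.inr (by simp [nbVal, hg])⟩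
  · rintro ⟨huv, t, ht, h' | h'⟩
    · rcases key t ht u hu with h'' | h''
      · exact absurd (h''.symm.trans h') huv
      · rwa [h'] at h''
    · rcases key t ht v hv with h'' | h''
      · exact absurd (h'.symm.trans h'') huv
      · rw [h'] at h''; exact h.symm _ _ h''

/-- Prepare the search: store the first ends of the edges and the out-neighbours in an
orientation. -/
def ingestP (D : ℕ) : Program :=
  .seq (.assign 1 (.get (nm 0 0) (.reg 0))) (.seq sourceP
    (.seq (mapP 1 (nm 2 0) (.lit 1)) (.seq (peelP D 1 (nm 0 2) (nm 0 1) (nm 2 0))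
      (seqP ((List.range (2 * D)).map fun t => mapP 0 (nm 0 (4 + t)) (nbE D t))))))

theorem cost_nbE_le (D t : ℕ) : (nbE D t).cost ≤ 30 := by
  unfold nbE
  split_ifs <;> simp [iteE, notE, Expr.cost]

/-- The orientation procedure expects a bipartite graph; the list of ordered pairs, with sources on
the left and targets on the right, presents the input as its bipartite double cover. -/
theorem run_ingestP {adj : ℕ → ℕ → Prop} {n M B D k m : ℕ} {off X Y : ℕ → ℕ} {s : State}
    (hs : Bdd B s) (h : Layout adj n M off Y)
    (hX : ∀ e < M, X e < n ∧ off (X e) ≤ e ∧ e < off (X e + 1)) (hk : 2 ≤ k)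
    (hm : ¬ KModel adj m {v | v < n}) (hD : 4 * density k m ≤ D) (hnB : n * (D + 1) ≤ B)
    (hMB : 2 * M + 3 ≤ B) (hreg : ∀ r, s.reg r = if r = 0 then n else 0)
    (hoff : ∀ x ≤ n, s.arr (nm 0 0) x = off x) (hY : ∀ e < M, s.arr (nm 0 1) e = Y e) :
    Run B (ingestP D) s ((1200 + 200 * D) * timeUnit B) fun s' => s'.reg 2 = 0 ∧
      ∃ NB, Inst k m D (2 * D) B n M adj X Y NB ∧ Env (2 * D) n M X Y NB s' := by
  have h2B := hs.two_le
  have hedges := h.edgeList hX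
  have hnB' : n ≤ B := (Nat.le_mul_of_pos_right n (Nat.succ_pos D)).trans hnB
  have htu : 2 * B ≤ timeUnit B := by unfold timeUnit; nlinarith
  refine Run.mono (t := 3 + (100 * B + ((M + 1) * 13 + (1000 * timeUnit B +
    (84 * B * (2 * D) + 1))))) (Run.seq hs (Run.assign (Q := (· = s.setReg 1 M)) hs ?_ ?_
      (by simp [Expr.cost])) ?_) ?_ (fun _ _ h => h)
  · exact hs.arr _ _
  · simp only [Expr.eval]
    rw [hreg 0, if_pos rfl, hoff n le_rfl, h.last]
  · rintro s₀ hs₀ rfl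
    refine Run.seq hs₀ (run_sourceP hs₀ h hX hnB' (by omega) (by simp [State.setReg_reg])
      (by simp [State.setReg_reg, hreg]) (by simp [State.setReg_reg, hreg]) hoff) ?_
    rintro s₁ hs₁ ⟨hr₁, ha₁, hsrc₁⟩
    have r0 : s₁.reg 0 = n := by
      rw [hr₁ 0 (by norm_num), State.setReg_reg, if_neg (by norm_num), hreg, if_pos rfl]
    have r1 : s₁.reg 1 = M := by rw [hr₁ 1 (by norm_num), State.setReg_reg, if_pos rfl]
    have r2 : s₁.reg 2 = 0 := by
      rw [hr₁ 2 (by norm_num), State.setReg_reg, if_neg (by norm_num), hreg, if_neg (by norm_num)]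
    refine Run.seq hs₁ (run_mapP hs₁ (by omega) (by norm_num) r1 True.intro (fun _ _ => by
      simp only [Expr.eval]; omega)) ?_
    rintro s₂ hs₂ e₂
    have hk₂ : KeepDepth 2 s₁ s₂ := by
      rw [e₂]
      exact ⟨fun r hr => State.put_reg _ _ _ _ (by omega), fun d' t hd' =>
        State.put_arr_ne _ _ _ (by simp [hd'])⟩
    have hlive : ∀ e < M, s₂.arr (nm 2 0) e ≠ 0 := fun e he => by
      rw [e₂, State.put_arr_same _ _ _ he]; exact one_ne_zero
    have src₂ : ∀ e < M, s₂.arr (nm 0 2) e = X e := fun e he => by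
      rw [hk₂.2 _ _ (by norm_num), hsrc₁ e he]
    have tgt₂ : ∀ e < M, s₂.arr (nm 0 1) e = Y e := fun e he => by
      rw [hk₂.2 _ _ (by norm_num), ha₁ _ (by simp), State.setReg_arr, hY e he]
    refine Run.seq hs₂ (run_peelP (c := density k m) hs₂ (by rw [hk₂.1 0 (by norm_num), r0])
      (by rw [hk₂.1 1 (by norm_num), r1]) hnB hMB src₂ (fun e he => (hedges.lt e he).1) tgt₂
      (fun e he => (hedges.lt e he).2) (by norm_num) (by norm_num) (by norm_num) hD
      (fun S hS => hedges.sparse hk hm S fun e he => (hS e he).1)) ?_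
    rintro s₃ hs₃ ⟨hk₃, harc, hL, hR⟩
    have hNB := hedges.outNb (fun e he => harc e he (hlive e he))
      (fun x hx j hj e he => ⟨(hL x hx j hj e he).1, (hL x hx j hj e he).2.2⟩)
      (fun x hx j hj e he => ⟨(hR x hx j hj e he).1, (hR x hx j hj e he).2.2⟩)
    have src₃ : ∀ e < M, s₃.arr (nm 0 2) e = X e := fun e he => by
      rw [hk₃.2 _ _ (by norm_num), src₂ e he]
    have tgt₃ : ∀ e < M, s₃.arr (nm 0 1) e = Y e := fun e he => by
      rw [hk₃.2 _ _ (by norm_num), tgt₂ e he]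
    have q0 : s₃.reg 0 = n := by rw [hk₃.1 0 (by norm_num), hk₂.1 0 (by norm_num), r0]
    have q1 : s₃.reg 1 = M := by rw [hk₃.1 1 (by norm_num), hk₂.1 1 (by norm_num), r1]
    have q2 : s₃.reg 2 = 0 := by rw [hk₃.1 2 (by norm_num), hk₂.1 2 (by norm_num), r2]
    set NB := nbVal D X Y (s₃.arr (nm 1 6)) (s₃.arr (nm 1 7)) with hNBdef
    refine Run.mono (run_seqP (c := 84 * B) _ (fun s' => (∀ r < 3, s'.reg r = s₃.reg r) ∧
      ∀ d t, (d = 0 → t < 4) → s'.arr (nm d t) = s₃.arr (nm d t))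
      (fun t s' => ∀ v < n, s'.arr (nm 0 (4 + t)) v = NB t v) (List.range (2 * D)) ?_ s₃ hs₃
      ⟨fun _ _ => rfl, fun _ _ _ => rfl⟩) (by simp) ?_
    · intro t ht s₄ hs₄ ⟨hr₄, ha₄⟩
      rw [List.mem_range] at ht
      have hev : ∀ v < n, (nbE D t).eval (s₄.setReg 3 v) = NB t v := by
        intro v hv
        rw [nbE, hNBdef, nbVal]
        split_ifs with h1 h2 h2
        · obtain ⟨e, he⟩ := Nat.exists_eq_succ_of_ne_zero h2
          have heM := (hL v hv t h1 e he).1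
          rw [eval_iteE]
          simp only [Expr.eval, BinOp.eval, State.setReg_reg, State.setReg_arr, if_true,
            ha₄ 1 6 (by simp), ha₄ 0 1 (by simp), he, Nat.succ_sub_one, tgt₃ e heM]
          simp
        · rw [eval_iteE]
          simp only [Expr.eval, BinOp.eval, State.setReg_reg, State.setReg_arr, if_true,
            ha₄ 1 6 (by simp)]
          rw [if_neg h2]
        · obtain ⟨e, he⟩ := Nat.exists_eq_succ_of_ne_zero h2
          have heM := (hR v hv _ (by omega) e he).1
          rw [eval_iteE]
          simp only [Expr.eval, BinOp.eval, State.setReg_reg, State.setReg_arr, if_true,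
            ha₄ 1 7 (by simp), ha₄ 0 2 (by simp), he, Nat.succ_sub_one, src₃ e heM]
          simp
        · rw [eval_iteE]
          simp only [Expr.eval, BinOp.eval, State.setReg_reg, State.setReg_arr, if_true,
            ha₄ 1 7 (by simp)]
          rw [if_neg h2]
      refine Run.mono (run_mapP hs₄ hnB' (by norm_num) (by rw [hr₄ 0 (by norm_num), q0]) ?_
        (fun v hv => by rw [hev v hv]; exact (hNB.lt t ht v hv).le.trans hnB')) ?_ ?_
      · unfold nbE
        split_ifs
        · exact avoids_iteE ⟨by simp, ⟨True.intro, True.intro⟩, True.intro⟩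
            ⟨by simp; omega, ⟨by simp, ⟨True.intro, True.intro⟩, True.intro⟩, True.intro⟩ True.intro
        · exact avoids_iteE ⟨by simp, ⟨True.intro, True.intro⟩, True.intro⟩
            ⟨by simp; omega, ⟨by simp, ⟨True.intro, True.intro⟩, True.intro⟩, True.intro⟩ True.intro
      · calc _ ≤ (2 * B) * 42 := Nat.mul_le_mul (by omega) (by have := cost_nbE_le D t; omega)
          _ = _ := by ring
      · rintro s₅ - rfl
        refine ⟨⟨fun r hr => ?_, fun d t' h0 => ?_⟩, fun v hv => ?_, fun t' h' v hv => ?_⟩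
        · rw [State.put_reg _ _ _ _ (by omega)]; exact hr₄ r hr
        · rw [State.put_arr_ne _ _ _ (by simp; omega)]; exact ha₄ d t' h0
        · rw [State.put_arr_same _ _ _ hv, hev v hv]
        · by_cases htt : t' = t
          · subst htt; rw [State.put_arr_same _ _ _ hv, hev v hv]
          · rw [State.put_arr_ne _ _ _ (by simp [htt])]; exact h' v hv
    · rintro s' - ⟨⟨hr', ha'⟩, hg, -⟩
      refine ⟨by rw [hr' 2 (by norm_num), q2], NB, ⟨hedges, hNB, hm, hD, hnB, hMB⟩, ?_⟩
      refine ⟨by rw [hr' 0 (by norm_num), q0], by rw [hr' 1 (by norm_num), q1], ?_, ?_, ?_⟩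
      · intro e he; rw [ha' 0 2 (by simp), src₃ e he]
      · intro e he; rw [ha' 0 1 (by simp), tgt₃ e he]
      · exact fun t ht => hg t (List.mem_range.2 ht)
  · have : 84 * B * (2 * D) ≤ 84 * D * timeUnit B := by
      calc _ = 84 * D * (2 * B) := by ring
        _ ≤ _ := Nat.mul_le_mul_left _ htu
    nlinarith

/-! ### Adjacency lists -/

theorem length_flatten_take_succ {α : Type*} (l : List (List α)) {x : ℕ} (hx : x < l.length) :
    (l.take (x + 1)).flatten.length = (l.take x).flatten.length + l[x].length := by
  rw [List.take_succ_eq_append_getElem hx, List.flatten_append, List.length_append,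
    List.flatten_singleton]

theorem getElem?_flatten {α : Type*} (l : List (List α)) {x i : ℕ} (hx : x < l.length)
    (hi : i < l[x].length) : l.flatten[(l.take x).flatten.length + i]? = some l[x][i] := by
  have h : l.flatten = (l.take x).flatten ++ (l[x] ++ (l.drop (x + 1)).flatten) := by
    rw [← List.flatten_cons, ← List.drop_eq_getElem_cons hx, ← List.flatten_append,
      List.take_append_drop]
  rw [h, List.getElem?_append_right (Nat.le_add_right _ _), Nat.add_sub_cancel_left,
    List.getElem?_append_left hi, List.getElem?_eq_getElem hi]

/-- The names `nm 0 0` and `nm 0 1` are the numbers `0` and `1`, so the input arrays already belong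
to depth `0` and need not be copied. -/
theorem layout_inputState {n : ℕ} {G : SimpleGraph (Fin n)} {adj : Fin n → List (Fin n)}
    (h : IsAdjacencyLists G adj) : Layout (natAdj G) n ((inputState adj).arr (nm 0 0) n)
      ((inputState adj).arr (nm 0 0)) ((inputState adj).arr (nm 0 1)) := by
  set l := List.ofFn adj with hl
  have hlen : l.length = n := by simp [hl]
  have hget : ∀ x (hx : x < n), l[x]'(by omega) = adj ⟨x, hx⟩ := fun x hx => by simp [hl]
  have hoff : ∀ x ≤ n, (inputState adj).arr (nm 0 0) x = (l.take x).flatten.length := by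
    intro x hx
    simp [inputState, nm, Nat.pair, hx, hl]
  have hsucc : ∀ x (hx : x < n), (inputState adj).arr (nm 0 0) (x + 1) =
      (inputState adj).arr (nm 0 0) x + (adj ⟨x, hx⟩).length := by
    intro x hx
    rw [hoff x hx.le, hoff _ hx, length_flatten_take_succ l (by omega), hget x hx]
  have hY : ∀ x (hx : x < n) i (hi : i < (adj ⟨x, hx⟩).length),
      (inputState adj).arr (nm 0 1) ((inputState adj).arr (nm 0 0) x + i) =
        ((adj ⟨x, hx⟩)[i] : ℕ) := by
    intro x hx i hi
    have h1 := getElem?_flatten l (x := x) (i := i) (by omega) (by rw [hget x hx]; exact hi)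
    rw [hoff x hx.le]
    simp only [hget x hx] at h1
    have h2 : (inputState adj).arr (nm 0 1) = fun i => (l.flatten.map Fin.val).getD i 0 := by
      funext i; simp [inputState, nm, Nat.pair, hl]
    rw [h2]
    simp only [List.getD_eq_getElem?_getD, List.getElem?_map, h1]
    rfl
  refine ⟨natAdj_symm G, natAdj_irrefl G, ?_, rfl, ?_, ?_, ?_, ?_⟩
  · rw [hoff 0 (Nat.zero_le _)]; simp
  · intro x hx
    rw [hsucc x hx]; omega
  · intro x hx e h1 h2
    rw [hsucc x hx] at h2
    obtain ⟨i, rfl⟩ := Nat.exists_eq_add_of_le h1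
    have hi : i < (adj ⟨x, hx⟩).length := by omega
    rw [hY x hx i hi]
    exact ⟨hx, ((adj ⟨x, hx⟩)[i]).2, ((h ⟨x, hx⟩).2 _).1 (List.getElem_mem hi)⟩
  · rintro u v ⟨hu, hv, huv⟩
    obtain ⟨i, hi, hiv⟩ := List.getElem_of_mem (((h ⟨u, hu⟩).2 _).2 huv)
    refine ⟨hu, _, Nat.le_add_right _ i, by rw [hsucc u hu]; omega, ?_⟩
    rw [hY u hu i hi, hiv]
  · intro x hx e e' h1 h2 h1' h2' hee
    rw [hsucc x hx] at h2 h2'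
    obtain ⟨i, rfl⟩ := Nat.exists_eq_add_of_le h1
    obtain ⟨i', rfl⟩ := Nat.exists_eq_add_of_le h1'
    have hi : i < (adj ⟨x, hx⟩).length := by omega
    have hi' : i' < (adj ⟨x, hx⟩).length := by omega
    rw [hY x hx i hi, hY x hx i' hi'] at hee
    rw [(h ⟨x, hx⟩).1.getElem_inj_iff.1 (Fin.ext hee)]

theorem bdd_inputState {n B : ℕ} {G : SimpleGraph (Fin n)} {adj : Fin n → List (Fin n)}
    (h : IsAdjacencyLists G adj) (h2 : 2 ≤ B) (hn : n ≤ B)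
    (hM : (inputState adj).arr (nm 0 0) n ≤ B) : Bdd B (inputState adj) where
  two_le := h2
  reg r := by
    simp only [inputState]
    split_ifs <;> omega
  arr a i := by
    have hl := layout_inputState h
    by_cases h0 : a = 0
    · subst h0
      by_cases hi : i ≤ n
      · exact (hl.mono hi le_rfl).trans hM
      · simp [inputState, hi]
    by_cases h1 : a = 1
    · subst h1
      simp only [inputState, if_neg h0, if_true, List.getD_eq_getElem?_getD, List.getElem?_map]
      cases (List.ofFn adj).flatten[i]? with
      | none => exact Nat.zero_le _
      | some v => exact v.2.le.trans hn
    · simp [inputState, h0, h1]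

/-! ### The algorithm -/

def mainP (k D : ℕ) : Program :=
  .seq (ingestP D) (.seq (mapP 0 (nm 3 9) (.lit 1)) (.seq (mapP 0 (nm 3 10) (.reg 3))
    (.seq (searchP k D (2 * D) (k - 2) 3)
      (.seq (seqP ((List.range k).map fun i => .store (nm 0 0) (.lit i) (.get (nm 0 3) (.lit i))))
        (.assign 0 (.reg 2))))))

/-- The search starts at depth `3` from all vertices as paths with one vertex; depths `1` and `2`
have been used for the orientation of the input. -/
theorem run_mainP {k m D : ℕ} (hk : 3 ≤ k) : ∃ C, ∀ (B n M : ℕ) (adj : ℕ → ℕ → Prop)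
    (off Y : ℕ → ℕ) (s : State), Bdd B s → Layout adj n M off Y → ¬ KModel adj m {v | v < n} →
    4 * density k m ≤ D → n * (D + 1) ≤ B → 2 * M + 3 ≤ B →
    (∀ r, s.reg r = if r = 0 then n else 0) → (∀ x ≤ n, s.arr (nm 0 0) x = off x) →
    (∀ e < M, s.arr (nm 0 1) e = Y e) →
    Run B (mainP k D) s (C * timeUnit B) fun s' =>
      (s'.reg 0 = 1 ∧ IsCyc adj k (s'.arr (nm 0 0)) ∧ ∀ i < k, s'.arr (nm 0 0) i < n) ∨
      (s'.reg 0 = 0 ∧ ¬ ∃ q, IsCyc adj k q) := by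
  obtain ⟨C, hC⟩ := searchP_spec (m := m) (D := D) (T := 2 * D) hk (k - 2) (by omega) 3 (by norm_num)
  rw [show k - 1 - (k - 2) = 1 by omega] at hC
  refine ⟨(1200 + 200 * D) + (13 + (13 + (C + (4 * k + 3)))),
    fun B n M adj off Y s hs hl hm hD hnB hMB hreg hoff hY => ?_⟩
  have htu : 2 * B ≤ timeUnit B := by unfold timeUnit; nlinarith
  have hnB' : n ≤ B := (Nat.le_mul_of_pos_right n (Nat.succ_pos D)).trans hnB
  obtain ⟨X, hX⟩ := hl.exists_src
  have hmap : ∀ c, c ≤ 13 → (n + 1) * c ≤ 13 * timeUnit B := fun c hc =>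
    (Nat.mul_le_mul (show n + 1 ≤ timeUnit B by omega) hc).trans_eq (mul_comm _ _)
  simp only [add_mul (1200 + 200 * D), add_mul 13, add_mul C]
  refine Run.seq hs (run_ingestP hs hl hX (by omega) hm hD hnB hMB hreg hoff hY) ?_
  rintro s₁ hs₁ ⟨hr2, NB, hi, henv⟩
  have hput : ∀ (s : State) t g, KeepDepth 3 s (s.put (nm 3 t) n g) := fun s t g =>
    ⟨fun r hr => State.put_reg _ _ _ _ (by omega), fun d' t hd' =>
      State.put_arr_ne _ _ _ (by simp [hd'])⟩
  refine Run.seq hs₁ (Run.mono (run_mapP hs₁ hnB' (by norm_num) henv.reg0 True.intro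
    (fun _ _ => by simp only [Expr.eval]; omega)) (hmap _ (by simp [Expr.cost]))
    (fun _ _ h => h)) ?_
  rintro s₂ hs₂ e₂
  have hp₂ : Progress adj k n 2 s₁ s₂ := by
    rw [e₂]; exact (hput _ _ _).progress (by norm_num) (Or.inl hr2)
  refine Run.seq hs₂ (Run.mono (run_mapP hs₂ hnB' (by norm_num) (henv.keep hp₂.keep).reg0 True.intro
    (fun x hx => by simp only [Expr.eval, State.setReg_reg, if_true]; omega))
    (hmap _ (by simp [Expr.cost])) (fun _ _ h => h)) ?_
  rintro s₃ hs₃ e₃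
  have hp₃ : Progress adj k n 2 s₁ s₃ := by
    rw [e₃]; exact hp₂.trans ((hput _ _ _).progress (by norm_num) hp₂.inv)
  have hdf : ∀ v < n, pathDf n 3 s₃ v := fun v hv => ⟨hv, by
    rw [e₃, State.put_arr_ne _ _ _ (by simp), e₂, State.put_arr_same _ _ _ hv]; exact one_ne_zero⟩
  have hpt : ∀ v < n, pathPt 3 s₃ v 0 = v := fun v hv => by
    rw [pathPt, e₃, State.put_arr_same _ _ _ hv]; simp [Expr.eval, State.setReg_reg]
  refine Run.seq hs₃ (hC B n M adj X Y NB hi s₃ hs₃ (henv.keep hp₃.keep)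
    (PathFam.trivial adj n (fun v h => h.1) fun v h => hpt v h.1) hp₃.inv) ?_
  rintro s₄ hs₄ ⟨hp₄, hfound⟩
  refine Run.mono (Run.seq hs₄ (run_seqP (c := 4) _ (fun s' => s'.reg = s₄.reg ∧
    ∀ a ≠ nm 0 0, s'.arr a = s₄.arr a) (fun i s' => s'.arr (nm 0 0) i = s₄.arr (nm 0 3) i)
    (List.range k) ?_ s₄ hs₄ ⟨rfl, fun _ _ => rfl⟩) (t' := 2)
    (Q' := fun s' => (s'.reg 0 = 1 ∧ IsCyc adj k (s'.arr (nm 0 0)) ∧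
      ∀ i < k, s'.arr (nm 0 0) i < n) ∨ (s'.reg 0 = 0 ∧ ¬ ∃ q, IsCyc adj k q)) ?_) ?_
    (fun _ _ h => h)
  · rintro i - s₅ hs₅ ⟨hr₅, ha₅⟩
    refine Run.store hs₅ (hs₅.arr _ _) ⟨⟨by rw [State.setArr_reg, hr₅], fun a ha => ?_⟩, ?_, ?_⟩
      (by simp [Expr.cost])
    · funext x; simp [State.setArr_arr, ha, ha₅ a ha]
    · simp [State.setArr_arr, Expr.eval, ha₅ (nm 0 3) (by simp)]
    · intro i' hi'
      simp only [State.setArr_arr, Expr.eval, true_and]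
      split_ifs with h
      · rw [h, ha₅ (nm 0 3) (by simp)]
      · exact hi'
  · rintro s₅ hs₅ ⟨⟨hr₅, ha₅⟩, hg, -⟩
    refine Run.assign hs₅ (hs₅.reg _) ?_ le_rfl
    simp only [State.setReg_reg, State.setReg_arr, if_true, Expr.eval, hr₅]
    have hg' : ∀ i < k, s₅.arr (nm 0 0) i = s₄.arr (nm 0 3) i := fun i hi' =>
      hg i (List.mem_range.2 hi')
    rcases hp₄.inv with h0 | ⟨h1, h2, h3⟩
    · refine Or.inr ⟨h0, ?_⟩
      rintro ⟨q, hq⟩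
      have hlt := hq.lt hk hi.edges 0 (by omega)
      -- Any induced cycle prolongs the path that consists of its vertex number `0`.
      refine hfound (q 0) q (hdf _ hlt) hq (fun i hi' => ?_) h0
      obtain rfl : i = 0 := by omega
      exact (hpt _ hlt).symm
    · refine Or.inl ⟨h1, fun i hi' j hj hij => ?_, fun i hi' => by rw [hg' i hi']; exact h3 i hi'⟩
      rw [hg' i hi', hg' j hj]; exact h2 i hi' j hj hij
  · rw [List.length_range]
    have : 1 ≤ timeUnit B := by omega
    calc _ = (4 * k + 3) * 1 := by ring
      _ ≤ _ := Nat.mul_le_mul_left _ this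

/-! ### Cycles as graphs -/

theorem cycleGraph_adj_iff {k : ℕ} (hk : 3 ≤ k) (i j : Fin k) :
    (SimpleGraph.cycleGraph k).Adj i j ↔ CycAdj k i j := by
  obtain ⟨k, rfl⟩ := Nat.exists_eq_add_of_le' (show 2 ≤ k by omega)
  rw [SimpleGraph.cycleGraph_adj']
  have hi := i.2
  have hj := j.2
  unfold CycAdj
  rcases lt_trichotomy i j with h | h | h
  · rw [Fin.coe_sub_iff_lt.2 h, Fin.sub_val_of_le h.le]
    rw [Fin.lt_def] at h
    omega
  · subst h
    simp only [sub_self, Fin.val_zero]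
    omega
  · rw [Fin.coe_sub_iff_lt.2 h, Fin.sub_val_of_le h.le]
    rw [Fin.lt_def] at h
    omega

/-- The embedding of a cycle graph that is given by a sequence of vertices. -/
def IsCyc.embedding {n k : ℕ} {G : SimpleGraph (Fin n)} {q : ℕ → ℕ} (hk : 3 ≤ k)
    (hq : IsCyc (natAdj G) k q) (hlt : ∀ i < k, q i < n) : SimpleGraph.cycleGraph k ↪g G where
  toFun i := ⟨q i, hlt i i.2⟩
  inj' i j hij := by
    by_contra hne
    exact (hq i i.2 j j.2 (fun h => hne (Fin.ext h))).1 (congrArg Fin.val hij)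
  map_rel_iff' := by
    intro i j
    by_cases hij : i = j
    · subst hij; simp
    · rw [cycleGraph_adj_iff hk, ← (hq i i.2 j j.2 (fun h => hij (Fin.ext h))).2]
      exact ⟨fun h => ⟨hlt i i.2, hlt j j.2, h⟩, fun ⟨_, _, h⟩ => h⟩

theorem exists_isCyc {n k : ℕ} {G : SimpleGraph (Fin n)} (hk : 3 ≤ k)
    (φ : SimpleGraph.cycleGraph k ↪g G) : ∃ q, IsCyc (natAdj G) k q := by
  refine ⟨fun i => if h : i < k then φ ⟨i, h⟩ else 0, fun i hi j hj hij => ?_⟩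
  simp only [dif_pos hi, dif_pos hj]
  refine ⟨fun h => hij (congrArg Fin.val (φ.injective (Fin.ext h))), ?_⟩
  rw [← cycleGraph_adj_iff hk ⟨i, hi⟩ ⟨j, hj⟩, ← φ.map_adj_iff]
  exact ⟨fun ⟨_, _, h⟩ => h, fun h => ⟨(φ _).2, (φ _).2, h⟩⟩

/-! ### Asymptotics -/

/-- Here `K * (n + 2) ≤ n ^ 3`, and `log 2 > 1 / 2` gives `6 * log n` for the logarithm to base `2`;
the remaining `4 * log n` absorb the summand `2`. -/
theorem log_size_le {K n : ℕ} (hK : K + 2 ≤ n) :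
    (Nat.log 2 (K * (n + 2)) : ℝ) + 2 ≤ 10 * Real.log n := by
  have h2 := Real.log_two_gt_d9
  have hn2 : (2 : ℝ) ≤ n := by exact_mod_cast (show 2 ≤ n by omega)
  have hlog : Real.log 2 ≤ Real.log n := Real.log_le_log (by norm_num) hn2
  have h1 : Nat.log 2 (K * (n + 2)) ≤ Nat.log 2 (n ^ 3) := by
    refine Nat.log_mono_right ?_
    calc K * (n + 2) ≤ n * (n * n) := Nat.mul_le_mul (by omega) (by nlinarith)
      _ = n ^ 3 := by ring
  have h3 : (Nat.log 2 (n ^ 3) : ℝ) ≤ 3 * (Real.log n / Real.log 2) := by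
    have := Real.natLog_le_logb (n ^ 3) 2
    rw [Real.logb, Nat.cast_pow, Real.log_pow] at this
    push_cast at this
    linarith [mul_div_assoc (3 : ℝ) (Real.log n) (Real.log 2)]
  have h4 : Real.log n / Real.log 2 ≤ 2 * Real.log n := by
    rw [div_le_iff₀ (by linarith)]
    nlinarith
  have h5 : (Nat.log 2 (K * (n + 2)) : ℝ) ≤ Nat.log 2 (n ^ 3) := by exact_mod_cast h1
  linarith

theorem isBigO_time (C K : ℕ) : (fun n : ℕ => ((C * timeUnit (K * (n + 2)) : ℕ) : ℝ))
    =O[Filter.atTop] fun n : ℕ => (n : ℝ) * Real.log n := by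
  refine Asymptotics.IsBigO.of_bound (C * K * 20) ?_
  filter_upwards [Filter.eventually_ge_atTop (K + 2)] with n hn
  have h := log_size_le hn
  have hn2 : (2 : ℝ) ≤ n := by exact_mod_cast (show 2 ≤ n by omega)
  have h0 : 0 ≤ Real.log n := Real.log_nonneg (by linarith)
  rw [Real.norm_of_nonneg (Nat.cast_nonneg _), Real.norm_of_nonneg (by positivity), timeUnit]
  push_cast at h ⊢
  calc (C : ℝ) * (K * (n + 2) * (Nat.log 2 (K * (n + 2)) + 2))
      ≤ C * (K * (2 * n) * (10 * Real.log n)) := by gcongr; linarith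
    _ = _ := by ring

theorem isBigO_wordSize (W K : ℕ) :
    (fun n : ℕ => ((W * (Nat.log 2 (K * (n + 2)) + 1) + 1 : ℕ) : ℝ))
    =O[Filter.atTop] fun n : ℕ => Real.log n := by
  refine Asymptotics.IsBigO.of_bound ((W + 1) * 10) ?_
  filter_upwards [Filter.eventually_ge_atTop (K + 2)] with n hn
  have h := log_size_le hn
  have hn2 : (2 : ℝ) ≤ n := by exact_mod_cast (show 2 ≤ n by omega)
  have h0 : 0 ≤ Real.log n := Real.log_nonneg (by linarith)
  rw [Real.norm_of_nonneg (Nat.cast_nonneg _), Real.norm_of_nonneg h0]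
  push_cast at h ⊢
  have hl : (0 : ℝ) ≤ Nat.log 2 (K * (n + 2)) := Nat.cast_nonneg _
  calc (W : ℝ) * (Nat.log 2 (K * (n + 2)) + 1) + 1
      ≤ W * (10 * Real.log n) + 10 * Real.log n := by gcongr <;> linarith
    _ = _ := by ring

end InducedCycle

theorem mainTheorem7 (F : InducedCycle.GraphFamily) (hF : F.MinorClosed) (hF' : F.NonTrivial)
    (k : ℕ) (hk : 3 ≤ k) :
    ∃ (P : InducedCycle.Program) (T w : ℕ → ℕ),
      ((fun n : ℕ => (T n : ℝ)) =O[Filter.atTop] fun n : ℕ => (n : ℝ) * Real.log n) ∧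
      ((fun n : ℕ => (w n : ℝ)) =O[Filter.atTop] fun n : ℕ => Real.log n) ∧
      ∀ (n : ℕ) (G : SimpleGraph (Fin n)), G ∈ F n →
        ∀ adj : Fin n → List (Fin n), InducedCycle.IsAdjacencyLists G adj →
          ∃ (s : InducedCycle.State) (t : ℕ),
            InducedCycle.Exec (w n) P (InducedCycle.inputState adj) s t ∧
            t ≤ T n ∧ InducedCycle.CorrectOutput k G s := by
  open InducedCycle in
  obtain ⟨m, H, hH⟩ := hF'
  have hno : ∀ n (G : SimpleGraph (Fin n)), G ∈ F n → ¬ KModel (natAdj G) m {v | v < n} :=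
    fun n G hG h => hH (hF n m G H hG (h.isMinor H))
  obtain ⟨D, hD⟩ : ∃ D, D = 4 * density k m := ⟨_, rfl⟩
  obtain ⟨C, hC⟩ := run_mainP (m := m) (D := D) hk
  -- Memory is bounded by `B = K * (n + 2)`. Since `D` is four times the density, `M` edges satisfy
  -- `2 * M ≤ D * n`, so `B` exceeds both `n * (D + 1)` and `2 * M + 3`.
  obtain ⟨K, hK⟩ : ∃ K, K = D + 4 := ⟨_, rfl⟩
  refine ⟨mainP k D, fun n => C * timeUnit (K * (n + 2)),
    fun n => (mainP k D).wt * (Nat.log 2 (K * (n + 2)) + 1) + 1, isBigO_time C K,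
    isBigO_wordSize _ K, fun n G hG adj hadj => ?_⟩
  have hl := layout_inputState hadj
  obtain ⟨X, hX⟩ := hl.exists_src
  have hM := (hl.edgeList hX).card_le (by omega : 2 ≤ k) (hno n G hG)
  have hDn : 4 * (density k m * (2 * n)) = 2 * (D * n) := by rw [hD]; ring
  have hB : K * (n + 2) = D * n + 2 * D + 4 * n + 8 := by rw [hK]; ring
  have hnB : n * (D + 1) ≤ K * (n + 2) := by
    have : n * (D + 1) = D * n + n := by ring
    omega
  have hMB : 2 * (inputState adj).arr (nm 0 0) n + 3 ≤ K * (n + 2) := by omega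
  obtain ⟨s, t, h1, h2, -, h3⟩ := hC (K * (n + 2)) n _ _ _ _ (inputState adj)
    (bdd_inputState hadj (by omega) (by omega) (by omega)) hl (hno n G hG) hD.ge hnB hMB
    (fun r => rfl) (fun _ _ => rfl) (fun _ _ => rfl)
    ((mainP k D).wt * (Nat.log 2 (K * (n + 2)) + 1) + 1) (by
      -- `B < 2 ^ (log B + 1)`, so multiplying the exponent by the weight of the program bounds
      -- every value that occurs.
      refine (Nat.pow_le_pow_left (Nat.lt_pow_succ_log_self one_lt_two _).le _).trans_lt ?_
      rw [← pow_mul, mul_comm]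
      exact Nat.pow_lt_pow_right one_lt_two (Nat.lt_succ_self _))
  refine ⟨s, t, h1, h2, ?_⟩
  rcases h3 with ⟨hr, hcyc, hlt⟩ | ⟨hr, hno⟩
  · exact Or.inl ⟨hr, hcyc.embedding hk hlt, fun i => rfl⟩
  · exact Or.inr ⟨hr, fun ⟨φ⟩ => hno (exists_isCyc hk φ)⟩
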